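/- Let $d\in\{2,3\}$ and let $\mathcal D\subset\mathbb R^d$ be a bounded polyhedral domain, i.e. an open connected set with $\mathcal D=\operatorname{int}\overline{\mathcal D}$ whose closure is a finite union of the simplices of a triangulation. Let $X:\mathbb R^d\to\mathbb R^d$ be a smooth vector field with $\operatorname{div}X=0$ in $\mathcal D$ and $X\cdot n=0$ on (the flat part of) $\partial\mathcal D$, let $T>0$, $u_0\in L^2(\mathcal D)$ (deterministic) and $\kappa>0$. Write $(\cdot,\cdot)$ for the inner product of $L^2(\mathcal D)$ and $\bar u_0=|\mathcal D|^{-1}(u_0,1)$. For a finite conforming triangulation $\mathcal T_h$ of $\mathcal D$ put $$V_h=\{v\in H^1(\mathcal D): v|_K\text{ is affine for every }K\in\mathcal T_h\},\qquad \mathring V_h=\{v\in V_h:(v,1)=0\}.$$ For $\zeta\in\mathring V_h$ let $\Delta_h^{-1}\zeta\in\mathring V_h$ be defined by $(\nabla(-\Delta_h^{-1}\zeta),\nabla v)=(\zeta,v)$ for all $v\in V_h$, and let $\|\zeta\|_{-1,h}=\|\nabla\Delta_h^{-1}\zeta\|_{L^2(\mathcal D)}$. Then there are a constant $C_0>0$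 and a function $C(\cdot,\cdot)$, depending only on $d,\mathcal D,X,T,u_0,\kappa$, such that the following holds for all $\delta,\epsilon>0$, all triangulations $\mathcal T_h$ of $\mathcal D$ that are quasi-uniform with constant $\kappa$ (every element contains a ball of radius $\kappa h$, where $h$ is the largest diameter of an element), and all $N\ge1$ such that $\tau=T/N$ satisfies the mesh constraint $$\tau\le C_0\,(\epsilon^{-3}+\epsilon^{-1}\delta^4)^{-1}.$$ Let $W$ be a standard real-valued Wiener process on a filtered probability space $(\Omega,\mathcal F,\{\mathcal F_t\}_{t\ge0},\mathbb P)$, let $t_n=n\tau$, and let $(u_h^n,w_h^n)$, $0\le n\le N$, be a $V_h\times V_h$-valued process, adapted to $\mathcal F_{t_n}$, which satisfies $\mathbb P$-almost surely, for $n=0,\dots,N-1$ and all $\eta_h,v_h\in V_h$, $$(u_h^{n+1},\eta_h)=(u_h^n,\eta_h)-\tau(\nabla w_h^{n+1},\nabla\eta_h)-\tau\tfrac{\delta^2}{2}(\nabla u_h^{n+1}\cdot X,\nabla\eta_h\cdot X)+\delta\big(\nabla u_h^n\cdot X\,(W_{t_{n+1}}-W_{t_n}),\eta_h\big),$$ $$(w_h^{n+1},v_h)=\epsilon(\nabla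 u_h^{n+1},\nabla v_h)+\tfrac1\epsilon\big((u_h^{n+1})^3-u_h^{n+1},v_h\big),$$ with the initial values given by $(u_h^0,v_h)=(u_0,v_h)$ and $(w_h^0,v_h)=\epsilon(\nabla u_h^0,\nabla v_h)+\frac1\epsilon((u_h^0)^3-u_h^0,v_h)$ for all $v_h\in V_h$. Then, for every $0\le n\le N$, $u_h^n-\bar u_0\in\mathring V_h$ almost surely, the expectations below exist and are finite, and $$\sup_{0\le n\le N}\mathbb E\big[\|u_h^n-\bar u_0\|_{-1,h}^2\big]+\mathbb E\Big[\sum_{n=1}^N\tau\|\nabla u_h^n\|_{L^2(\mathcal D)}^2\Big]\le C(\delta,\epsilon^{-1}).$$ -/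

import Mathlib

open MeasureTheory ProbabilityTheory Filter Topology
open scoped NNReal

namespace SCH

noncomputable section

/-- The Euclidean space `ℝ^d`. -/
abbrev E (d : ℕ) : Type := EuclideanSpace ℝ (Fin d)

/-! ### The domain and the vector field -/

/-- `ν` is the outward unit normal of `D` at a flat boundary point `x`: near `x` the set `D` is the
open half-space through `x` that lies opposite to `ν`. For a polyhedral domain such a `ν` exists
exactly at the points in the relative interior of the boundary faces, where it is unique. -/
def IsOutwardNormal {d : ℕ} (D : Set (E d)) (x ν : E d) : Prop :=
  ‖ν‖ = 1 ∧ ∀ᶠ y in 𝓝 x, (y ∈ D ↔ inner ℝ ν (y - x) < 0)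

/-- `X · n = 0` on the boundary of `D`. -/
def IsTangential {d : ℕ} (D : Set (E d)) (X : E d → E d) : Prop :=
  ∀ x ν, IsOutwardNormal D x ν → inner ℝ (X x) ν = 0

/-- The divergence of a vector field. -/
def divergence {d : ℕ} (X : E d → E d) (x : E d) : ℝ :=
  ∑ i : Fin d, (fderiv ℝ X x (EuclideanSpace.single i 1)) i

/-! ### Function spaces -/

/-- `G` is the weak gradient of `v` in `D`, tested with `C_c^∞(D)`. -/
def HasWeakGradient {d : ℕ} (D : Set (E d)) (v : E d → ℝ) (G : E d → E d) : Prop :=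
  ∀ φ : E d → ℝ, ContDiff ℝ (⊤ : ℕ∞) φ → HasCompactSupport φ → tsupport φ ⊆ D →
    ∫ x in D, v x • gradient φ x = - ∫ x in D, φ x • G x

/-- `v ∈ H¹(D)`. -/
def MemH1 {d : ℕ} (D : Set (E d)) (v : E d → ℝ) : Prop :=
  MemLp v 2 (volume.restrict D) ∧
    ∃ G : E d → E d, MemLp G 2 (volume.restrict D) ∧ HasWeakGradient D v G

/-- The inner product of `L²(D)`. -/
def ip {d : ℕ} (D : Set (E d)) (f g : E d → ℝ) : ℝ := ∫ x in D, f x * g x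

/-- `(∇ f, ∇ g)`, the `L²(D)` inner product of gradients. It is only used for piecewise affine
functions in `H¹(D)`, whose weak gradient is almost everywhere the classical gradient. -/
def gradIp {d : ℕ} (D : Set (E d)) (f g : E d → ℝ) : ℝ :=
  ∫ x in D, inner ℝ (gradient f x) (gradient g x)

/-- The squared norm `‖∇ f‖²` in `L²(D)`. -/
def gradNormSq {d : ℕ} (D : Set (E d)) (f : E d → ℝ) : ℝ := ∫ x in D, ‖gradient f x‖ ^ 2

/-- The function `∇ f · X`. -/
def gradDot {d : ℕ} (X : E d → E d) (f : E d → ℝ) (x : E d) : ℝ := inner ℝ (gradient f x) (X x)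

/-- The mean value `|D|⁻¹ (f, 1)`. -/
def mean {d : ℕ} (D : Set (E d)) (f : E d → ℝ) : ℝ := (volume.real D)⁻¹ * ∫ x in D, f x

/-- `v - c` on the closure of `D`, with functions on the closure of `D` extended by zero. -/
def subConst {d : ℕ} (D : Set (E d)) (v : E d → ℝ) (c : ℝ) : E d → ℝ :=
  fun x => v x - (closure D).indicator (fun _ => c) x

/-! ### Triangulations and finite element spaces -/

/-- A finite conforming triangulation of `D` into closed `d`-simplices. Conformity, and the
non-degeneracy of the simplices, are part of the notion of a geometric simplicial complex. -/
structure IsTriangulation {d : ℕ} (D : Set (E d)) (S : Geometry.SimplicialComplex ℝ (E d)) :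
    Prop where
  finite : S.faces.Finite
  pure : ∀ s ∈ S.faces, ∃ t ∈ S.faces, s ⊆ t ∧ t.card = d + 1
  space_eq : S.space = closure D

/-- The elements `K` of the triangulation: the convex hulls of the `d`-dimensional faces. -/
def elements {d : ℕ} (S : Geometry.SimplicialComplex ℝ (E d)) : Set (Set (E d)) :=
  {K | ∃ s ∈ S.faces, s.card = d + 1 ∧ K = convexHull ℝ (s : Set (E d))}

/-- Quasi-uniformity with constant `κ`: every element contains a ball of radius `κ h`, where `h` is
the largest diameter of an element. -/
def IsQuasiUniform {d : ℕ} (κ : ℝ) (S : Geometry.SimplicialComplex ℝ (E d)) : Prop :=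
  ∀ K ∈ elements S, ∀ L ∈ elements S, ∃ c, Metric.ball c (κ * Metric.diam L) ⊆ K

/-- The space `V_h` of functions in `H¹(D)` that are affine on every element. Its members are
functions on the closure of `D`, extended by zero. -/
def Vh {d : ℕ} (D : Set (E d)) (S : Geometry.SimplicialComplex ℝ (E d)) : Set (E d → ℝ) :=
  {v | MemH1 D v ∧ (∀ x, x ∉ closure D → v x = 0) ∧
    ∀ K ∈ elements S, ∃ p : E d →ᵃ[ℝ] ℝ, Set.EqOn v p K}

/-- The functions of zero mean in `V_h`. -/
def Vh0 {d : ℕ} (D : Set (E d)) (S : Geometry.SimplicialComplex ℝ (E d)) : Set (E d → ℝ) :=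
  {v | v ∈ Vh D S ∧ ∫ x in D, v x = 0}

/-- `z = Δ_h⁻¹ ζ`. -/
def IsDiscInvLap {d : ℕ} (D : Set (E d)) (S : Geometry.SimplicialComplex ℝ (E d))
    (ζ z : E d → ℝ) : Prop :=
  z ∈ Vh0 D S ∧ ∀ v ∈ Vh D S, gradIp D (-z) v = ip D ζ v

open Classical in
/-- The inverse discrete Laplace operator `Δ_h⁻¹`, meant for arguments `ζ` of zero mean in `V_h`. -/
def discInvLap {d : ℕ} (D : Set (E d)) (S : Geometry.SimplicialComplex ℝ (E d))
    (ζ : E d → ℝ) : E d → ℝ :=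
  if h : ∃ z, IsDiscInvLap D S ζ z then h.choose else 0

/-- The discrete `H⁻¹` inner product `(ζ, Φ)_{-1,h}`. -/
def negIp {d : ℕ} (D : Set (E d)) (S : Geometry.SimplicialComplex ℝ (E d))
    (ζ Φ : E d → ℝ) : ℝ :=
  gradIp D (-discInvLap D S ζ) (-discInvLap D S Φ)

/-- The discrete `H⁻¹` norm `‖ζ‖_{-1,h}`. -/
def negNorm {d : ℕ} (D : Set (E d)) (S : Geometry.SimplicialComplex ℝ (E d))
    (ζ : E d → ℝ) : ℝ :=
  Real.sqrt (negIp D S ζ ζ)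

/-! ### Wiener process and scheme -/

/-- `W` is a standard real-valued Wiener process with respect to the filtration `ℱ`. -/
structure IsWiener {Ω : Type*} [m : MeasurableSpace Ω] (P : Measure Ω) (ℱ : Filtration ℝ≥0 m)
    (W : ℝ≥0 → Ω → ℝ) : Prop where
  brownian : IsBrownianReal W P
  adapted : Adapted ℱ W
  indep : ∀ s t : ℝ≥0, s ≤ t →
    Indep (MeasurableSpace.comap (fun ω => W t ω - W s ω) inferInstance) (ℱ s) P

/-- The nonlinearity `u³ - u`. -/
def fNl {d : ℕ} (u : E d → ℝ) (x : E d) : ℝ := u x ^ 3 - u x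

/-- `(u_h^n, w_h^n)`, `0 ≤ n ≤ N`, is a solution of the fully discrete mixed finite element scheme
with time step `τ` and initial datum `u0`: a `V_h × V_h`-valued process, adapted to
`ℱ_{t_n}` with `t_n = n τ`, that almost surely solves the equations of the scheme. -/
structure IsDiscreteSolution {d : ℕ} (D : Set (E d)) (X : E d → E d) (u0 : E d → ℝ) (δ ε : ℝ)
    (S : Geometry.SimplicialComplex ℝ (E d)) (N : ℕ) (τ : ℝ≥0)
    {Ω : Type*} [m : MeasurableSpace Ω] (P : Measure Ω) (ℱ : Filtration ℝ≥0 m)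
    (W : ℝ≥0 → Ω → ℝ) (u w : ℕ → Ω → E d → ℝ) : Prop where
  mem_u : ∀ n ≤ N, ∀ ω, u n ω ∈ Vh D S
  mem_w : ∀ n ≤ N, ∀ ω, w n ω ∈ Vh D S
  adapted_u : ∀ n ≤ N, ∀ x, Measurable[ℱ (n * τ)] (fun ω => u n ω x)
  adapted_w : ∀ n ≤ N, ∀ x, Measurable[ℱ (n * τ)] (fun ω => w n ω x)
  init_u : ∀ᵐ ω ∂P, ∀ v ∈ Vh D S, ip D (u 0 ω) v = ip D u0 v
  init_w : ∀ᵐ ω ∂P, ∀ v ∈ Vh D S,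
    ip D (w 0 ω) v = ε * gradIp D (u 0 ω) v + ε⁻¹ * ip D (fNl (u 0 ω)) v
  step_u : ∀ᵐ ω ∂P, ∀ n < N, ∀ η ∈ Vh D S,
    ip D (u (n + 1) ω) η = ip D (u n ω) η
      - τ * gradIp D (w (n + 1) ω) η
      - τ * (δ ^ 2 / 2) * ip D (gradDot X (u (n + 1) ω)) (gradDot X η)
      + δ * ip D (fun x => gradDot X (u n ω) x *
          (W ((n + 1 : ℕ) * τ) ω - W (n * τ) ω)) η
  step_w : ∀ᵐ ω ∂P, ∀ n < N, ∀ v ∈ Vh D S,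
    ip D (w (n + 1) ω) v = ε * gradIp D (u (n + 1) ω) v + ε⁻¹ * ip D (fNl (u (n + 1) ω)) v

end

end SCH

namespace SCH

/-! ### Triangulations and piecewise affine functions -/

section Triangulation

variable {d : ℕ} {D : Set (E d)} {S : Geometry.SimplicialComplex ℝ (E d)}

/-! Write `ζⁿ = uⁿ - ū₀`, `T = -Δ_h⁻¹`, `f(u) = u³ - u`, and let `ξ` be the Wiener increment.
Testing with constants shows that the mean is conserved, so `Tζⁿ⁺¹` may be used as test function in
the first equation and `ζⁿ⁺¹` in the second. This gives `½‖ζⁿ⁺¹‖²₋₁ - ½‖ζⁿ‖²₋₁ + ½‖ζⁿ⁺¹ - ζⁿ‖²₋₁ +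
τε‖∇ζⁿ⁺¹‖² = -τε⁻¹(f(uⁿ⁺¹), ζⁿ⁺¹) - τ(δ²/2)(∇ζⁿ⁺¹·X, ∇Tζⁿ⁺¹·X) + δξ(∇ζⁿ·X, Tζⁿ⁺¹)`.

The first two terms on the right are harmless. Since the cubic part is monotone, `(f(u), ζ) ≥
-‖ζ‖²`, and the interpolation `‖ζ‖² ≤ ‖ζ‖₋₁‖∇ζ‖` together with Young's inequality trades this for a
part of `ε‖∇ζ‖²` plus `ε⁻³‖ζ‖²₋₁`. The correction term is handled in the same way and costs
`ε⁻¹δ⁴‖ζ‖²₋₁`. In the noise term, `Tζⁿ⁺¹` is split into `Tζⁿ`, which has mean zero by independence,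
and `T(ζⁿ⁺¹ - ζⁿ)`. On the latter the derivative along `X` is integrated by parts, so that the term
is absorbed by `½‖ζⁿ⁺¹ - ζⁿ‖²₋₁` at the price of `δ²ξ²‖ζⁿ‖²`. Its expectation is `τδ²E‖ζⁿ‖²`, again
interpolated, now at the old time level. A discrete Gronwall argument under the mesh constraint
concludes (`IsInverse.energy_step`, `energy_estimate`, `discrete_gronwall`).

Two facts about the polyhedral domain carry the estimate uniformly in the mesh. One is a Poincaré
inequality whose constant depends on `D` alone (`exists_poincare`): oscillations are compared along
segments inside convex sets and chained through the connected domain. The other is the skew-symmetry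
of `v ↦ ∇v·X` on `V_h` (`IsPolyhedral.inner_gradX_val`). No trace theory enters there: the product
of two discrete functions is multiplied by a cutoff in the distance to the complement. Near flat
boundary points tangency of `X` keeps the derivative of the cutoff along `X` bounded, and near the
faces of codimension two its size `r⁻¹` is beaten by the volume of their `r`-neighbourhood
(`IsTriangulation.integral_fderiv_tangential`). -/

theorem IsTriangulation.finite_elements (hS : IsTriangulation D S) : (elements S).Finite := by
  refine (hS.finite.image fun s : Finset (E d) => convexHull ℝ (s : Set (E d))).subset ?_
  rintro K ⟨s, hs, -, rfl⟩
  exact ⟨s, hs, rfl⟩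

theorem isCompact_of_mem_elements {K : Set (E d)} (hK : K ∈ elements S) : IsCompact K := by
  obtain ⟨s, -, -, rfl⟩ := hK
  exact s.finite_toSet.isCompact_convexHull ℝ

theorem convex_of_mem_elements {K : Set (E d)} (hK : K ∈ elements S) : Convex ℝ K := by
  obtain ⟨s, -, -, rfl⟩ := hK
  exact convex_convexHull ℝ _

theorem IsTriangulation.closure_eq (hS : IsTriangulation D S) : closure D = ⋃₀ elements S := by
  rw [← hS.space_eq]
  ext x
  rw [Geometry.SimplicialComplex.mem_space_iff, Set.mem_sUnion]
  constructor
  · rintro ⟨s, hs, hx⟩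
    obtain ⟨t, ht, hst, hc⟩ := hS.pure s hs
    exact ⟨_, ⟨t, ht, hc, rfl⟩, convexHull_mono (by exact_mod_cast hst) hx⟩
  · rintro ⟨K, ⟨s, hs, -, rfl⟩, hx⟩
    exact ⟨s, hs, hx⟩

theorem IsTriangulation.subset_closure (hS : IsTriangulation D S) {K : Set (E d)}
    (hK : K ∈ elements S) : K ⊆ closure D := by
  rw [hS.closure_eq]
  exact Set.subset_sUnion_of_mem hK

theorem IsTriangulation.ae_notMem_frontier (hS : IsTriangulation D S) :
    ∀ᵐ x : E d, ∀ K ∈ elements S, x ∉ frontier K := by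
  rw [ae_ball_iff hS.finite_elements.countable]
  intro K hK
  exact measure_eq_zero_iff_ae_notMem.1 ((convex_of_mem_elements hK).addHaar_frontier _)

/-- Boundaries of convex sets are null. Hence almost everywhere in `D` a function of `V_h` is
locally affine and `gradient` is the honest classical gradient. -/
theorem IsTriangulation.ae_mem_interior (hS : IsTriangulation D S) (hD : MeasurableSet D) :
    ∀ᵐ x ∂volume.restrict D, ∃ K ∈ elements S, x ∈ interior K := by
  rw [ae_restrict_iff' hD]
  filter_upwards [hS.ae_notMem_frontier] with x hx hxD
  have : x ∈ ⋃₀ elements S := hS.closure_eq ▸ _root_.subset_closure hxD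
  obtain ⟨K, hK, hxK⟩ := this
  refine ⟨K, hK, ?_⟩
  by_contra h
  exact hx K hK ⟨_root_.subset_closure hxK, h⟩

/-- The gradient of an affine function. -/
noncomputable def slope (p : E d →ᵃ[ℝ] ℝ) : E d :=
  (InnerProductSpace.toDual ℝ (E d)).symm (LinearMap.toContinuousLinearMap p.linear)

theorem inner_slope (p : E d →ᵃ[ℝ] ℝ) (y : E d) : inner ℝ (slope p) y = p.linear y := by
  simp [slope]

theorem affine_apply_eq (p : E d →ᵃ[ℝ] ℝ) (x y : E d) :
    p y = p x + inner ℝ (slope p) (y - x) := by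
  rw [inner_slope, ← vsub_eq_sub y x, p.linearMap_vsub]
  simp

theorem hasGradientAt_affine (p : E d →ᵃ[ℝ] ℝ) (x : E d) : HasGradientAt p (slope p) x := by
  have : (p : E d → ℝ) = fun y => p x + inner ℝ (slope p) (y - x) :=
    funext fun y => affine_apply_eq p x y
  rw [this, hasGradientAt_iff_hasFDerivAt]
  have h : HasFDerivAt (fun y : E d => (InnerProductSpace.toDual ℝ (E d) (slope p)) (y - x))
      (InnerProductSpace.toDual ℝ (E d) (slope p)) x := by
    have := (InnerProductSpace.toDual ℝ (E d) (slope p)).hasFDerivAt (x := x)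
    simpa only [map_sub] using this.sub_const (InnerProductSpace.toDual ℝ (E d) (slope p) x)
  simpa using h.const_add (p x)

theorem continuous_affine (p : E d →ᵃ[ℝ] ℝ) : Continuous p :=
  p.continuous_of_finiteDimensional

/-- `v` coincides with the affine function `p K` on every element `K`. -/
def IsPieces (S : Geometry.SimplicialComplex ℝ (E d)) (v : E d → ℝ)
    (p : Set (E d) → E d →ᵃ[ℝ] ℝ) : Prop :=
  ∀ K ∈ elements S, Set.EqOn v (p K) K

theorem exists_isPieces {v : E d → ℝ} (hv : v ∈ Vh D S) : ∃ p, IsPieces S v p := by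
  classical
  choose! p hp using hv.2.2
  exact ⟨p, fun K hK => hp K hK⟩

theorem IsPieces.hasGradientAt {v : E d → ℝ} {p : Set (E d) → E d →ᵃ[ℝ] ℝ} (hp : IsPieces S v p)
    {K : Set (E d)} (hK : K ∈ elements S) {x : E d} (hx : x ∈ interior K) :
    HasGradientAt v (slope (p K)) x := by
  have h := hasGradientAt_affine (p K) x
  rw [hasGradientAt_iff_hasFDerivAt] at h ⊢
  refine h.congr_of_eventuallyEq ?_
  filter_upwards [mem_interior_iff_mem_nhds.1 hx] with y hy using hp K hK hy

/-- The affine formulas hold on the closed elements, and finitely many closed sets cover `closure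
D`, so the pieces paste together continuously. -/
theorem IsTriangulation.continuousOn (hS : IsTriangulation D S) {v : E d → ℝ}
    (hv : v ∈ Vh D S) : ContinuousOn v (closure D) := by
  obtain ⟨p, hp⟩ := exists_isPieces hv
  have := hS.finite_elements.to_subtype
  rw [hS.closure_eq, Set.sUnion_eq_iUnion]
  refine (locallyFinite_of_finite _).continuousOn_iUnion
    (fun K => (isCompact_of_mem_elements K.2).isClosed) fun K => ?_
  exact (continuous_affine (p K)).continuousOn.congr (hp K K.2)

theorem IsTriangulation.exists_bound (hS : IsTriangulation D S)
    (hDb : Bornology.IsBounded D) {v : E d → ℝ} (hv : v ∈ Vh D S) :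
    ∃ M, ∀ x, |v x| ≤ M := by
  obtain ⟨M, hM⟩ := hDb.isCompact_closure.exists_bound_of_continuousOn (hS.continuousOn hv)
  refine ⟨max M 0, fun x => ?_⟩
  by_cases hx : x ∈ closure D
  · exact (hM x hx).trans (le_max_left _ _)
  · simp [hv.2.1 x hx]

theorem IsTriangulation.measurable (hS : IsTriangulation D S) {v : E d → ℝ} (hv : v ∈ Vh D S) :
    Measurable v := by
  classical
  have h1 : v = (closure D).indicator v := by
    ext x
    by_cases hx : x ∈ closure D
    · simp [hx]
    · simp [hx, hv.2.1 x hx]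
  rw [h1]
  have := (hS.continuousOn hv).measurable_piecewise (g := fun _ => (0 : ℝ))
    (continuousOn_const) isClosed_closure.measurableSet
  rwa [← Set.piecewise_eq_indicator]

theorem measurable_gradient (v : E d → ℝ) : Measurable (gradient v) := by
  unfold gradient
  exact (LinearIsometryEquiv.continuous _).measurable.comp (measurable_fderiv ℝ v)

theorem IsTriangulation.ae_differentiableAt (hS : IsTriangulation D S) (hD : MeasurableSet D)
    {v : E d → ℝ} (hv : v ∈ Vh D S) : ∀ᵐ x ∂volume.restrict D, DifferentiableAt ℝ v x := by
  obtain ⟨p, hp⟩ := exists_isPieces hv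
  filter_upwards [hS.ae_mem_interior hD] with x ⟨K, hK, hx⟩
  exact (hasGradientAt_iff_hasFDerivAt.1 (hp.hasGradientAt hK hx)).differentiableAt

theorem IsTriangulation.exists_gradient_bound (hS : IsTriangulation D S) (hD : MeasurableSet D)
    {v : E d → ℝ} (hv : v ∈ Vh D S) :
    ∃ M, ∀ᵐ x ∂volume.restrict D, ‖gradient v x‖ ≤ M := by
  obtain ⟨p, hp⟩ := exists_isPieces hv
  obtain ⟨M, hM⟩ := (hS.finite_elements.image fun K => ‖slope (p K)‖).bddAbove
  refine ⟨M, ?_⟩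
  filter_upwards [hS.ae_mem_interior hD] with x ⟨K, hK, hx⟩
  rw [(hp.hasGradientAt hK hx).gradient]
  exact hM ⟨K, hK, rfl⟩

/-! ### Restriction to segments -/

/-- The supremum of the slopes of the pieces that meet at a point. -/
noncomputable def maxSlope (S : Geometry.SimplicialComplex ℝ (E d))
    (p : Set (E d) → E d →ᵃ[ℝ] ℝ) (x : E d) : ENNReal :=
  ⨆ K ∈ elements S, K.indicator (fun _ => ‖slope (p K)‖ₑ) x

theorem IsTriangulation.measurable_maxSlope (hS : IsTriangulation D S)
    (p : Set (E d) → E d →ᵃ[ℝ] ℝ) : Measurable (maxSlope S p) := by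
  refine Measurable.biSup _ hS.finite_elements.countable fun K hK => ?_
  exact measurable_const.indicator (isCompact_of_mem_elements hK).isClosed.measurableSet

/-- A segment may run inside a facet, where `v` need not be differentiable and `gradient v` says
nothing. `maxSlope` bounds the derivative along every such segment, and it may be replaced by the
gradient as soon as one integrates over `D`. -/
theorem IsTriangulation.maxSlope_ae_eq (hS : IsTriangulation D S) (hD : MeasurableSet D)
    {v : E d → ℝ} {p : Set (E d) → E d →ᵃ[ℝ] ℝ} (hp : IsPieces S v p) :
    ∀ᵐ x ∂volume.restrict D, maxSlope S p x = ‖gradient v x‖ₑ := by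
  filter_upwards [hS.ae_mem_interior hD, ae_restrict_of_ae hS.ae_notMem_frontier]
    with x ⟨K, hK, hx⟩ hfr
  refine le_antisymm (iSup₂_le fun L hL => ?_) ?_
  · by_cases hxL : x ∈ L
    · have : x ∈ interior L := by
        by_contra h
        exact hfr L hL ⟨_root_.subset_closure hxL, h⟩
      rw [Set.indicator_of_mem hxL, (hp.hasGradientAt hL this).gradient]
    · simp [hxL]
  · rw [(hp.hasGradientAt hK hx).gradient]
    refine le_trans ?_ (le_iSup₂ (f := fun K (_ : K ∈ elements S) =>
      K.indicator (fun _ => ‖slope (p K)‖ₑ) x) K hK)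
    rw [Set.indicator_of_mem (interior_subset hx)]

/-- Along a segment in the closure of the domain, a piecewise affine function is differentiable off
a finite set, and its derivative is that of one of its pieces. -/
theorem IsTriangulation.exists_finite_hasDerivAt (hS : IsTriangulation D S) {v : E d → ℝ}
    {p : Set (E d) → E d →ᵃ[ℝ] ℝ} (hp : IsPieces S v p) {x y : E d}
    (hxy : segment ℝ x y ⊆ closure D) :
    ∃ F : Set ℝ, F.Finite ∧ ∀ t ∈ Set.Ioo (0 : ℝ) 1 \ F, ∃ K ∈ elements S,
      AffineMap.lineMap x y t ∈ K ∧
      HasDerivAt (fun t : ℝ => v (AffineMap.lineMap x y t)) (inner ℝ (slope (p K)) (y - x)) t := by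
  classical
  -- The parameters at which the segment lies in a given convex element form a compact interval. The
  -- exceptional set consists of the end points of these intervals: any other `t` is interior to the
  -- interval of each element through its point.
  let I : Set (E d) → Set ℝ := fun K => Set.Icc 0 1 ∩ (fun t => AffineMap.lineMap x y t) ⁻¹' K
  have hcont : Continuous fun t : ℝ => (AffineMap.lineMap x y t : E d) := AffineMap.lineMap_continuous
  refine ⟨(fun K => sInf (I K)) '' elements S ∪ (fun K => sSup (I K)) '' elements S,
    (hS.finite_elements.image _).union (hS.finite_elements.image _), ?_⟩
  rintro t ⟨ht, htF⟩
  have hmem : (AffineMap.lineMap x y t : E d) ∈ closure D := by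
    apply hxy
    rw [segment_eq_image_lineMap]
    exact ⟨t, ⟨ht.1.le, ht.2.le⟩, rfl⟩
  rw [hS.closure_eq] at hmem
  obtain ⟨K, hK, htK⟩ := hmem
  refine ⟨K, hK, htK, ?_⟩
  have hIc : IsCompact (I K) :=
    isCompact_Icc.inter_right ((isCompact_of_mem_elements hK).isClosed.preimage hcont)
  have htI : t ∈ I K := ⟨⟨ht.1.le, ht.2.le⟩, htK⟩
  have hIo : (I K).OrdConnected := by
    apply Convex.ordConnected
    exact (convex_Icc 0 1).inter ((convex_of_mem_elements hK).affine_preimage _)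
  have h1 : sInf (I K) < t :=
    lt_of_le_of_ne (csInf_le hIc.bddBelow htI) fun h => htF (Or.inl ⟨K, hK, h⟩)
  have h2 : t < sSup (I K) :=
    lt_of_le_of_ne (le_csSup hIc.bddAbove htI) fun h => htF (Or.inr ⟨K, hK, h.symm⟩)
  have hev : (fun t : ℝ => v (AffineMap.lineMap x y t)) =ᶠ[𝓝 t]
      fun t => p K x + t * inner ℝ (slope (p K)) (y - x) := by
    filter_upwards [Ioo_mem_nhds h1 h2] with s hs
    have hs' : s ∈ I K := hIo.out (hIc.sInf_mem ⟨t, htI⟩) (hIc.sSup_mem ⟨t, htI⟩) ⟨hs.1.le, hs.2.le⟩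
    rw [hp K hK hs'.2, affine_apply_eq (p K) x]
    simp [AffineMap.lineMap_apply, inner_smul_right]
  refine HasDerivAt.congr_of_eventuallyEq ?_ hev
  simpa using ((hasDerivAt_id t).mul_const (inner ℝ (slope (p K)) (y - x))).const_add (p K x)

theorem IsTriangulation.continuousOn_lineMap (hS : IsTriangulation D S) {v : E d → ℝ}
    (hv : v ∈ Vh D S) {x y : E d} (hxy : segment ℝ x y ⊆ closure D) :
    ContinuousOn (fun t : ℝ => v (AffineMap.lineMap x y t)) (Set.Icc 0 1) := by
  refine (hS.continuousOn hv).comp (AffineMap.lineMap_continuous).continuousOn fun t ht => ?_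
  apply hxy
  rw [segment_eq_image_lineMap]
  exact ⟨t, ht, rfl⟩

/-- The increment of a piecewise affine function along a segment is controlled by the slopes. -/
theorem IsTriangulation.enorm_sub_le (hS : IsTriangulation D S) {v : E d → ℝ} (hv : v ∈ Vh D S)
    {p : Set (E d) → E d →ᵃ[ℝ] ℝ} (hp : IsPieces S v p) {x y : E d}
    (hxy : segment ℝ x y ⊆ closure D) :
    ‖v x - v y‖ₑ ≤ ‖y - x‖ₑ *
      ∫⁻ t in Set.Icc (0 : ℝ) 1, maxSlope S p (AffineMap.lineMap x y t) := by
  obtain ⟨F, hF, hd⟩ := hS.exists_finite_hasDerivAt hp hxy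
  let φ : ℝ → ℝ := fun t => v (AffineMap.lineMap x y t)
  obtain ⟨M, hM⟩ := (hS.finite_elements.image fun K => ‖slope (p K)‖).bddAbove
  have hae : ∀ᵐ t ∂volume.restrict (Set.Icc (0 : ℝ) 1), t ∈ Set.Ioo (0 : ℝ) 1 \ F := by
    rw [← Measure.restrict_congr_set (Ioo_ae_eq_Icc (μ := volume) (a := (0:ℝ)) (b := 1)),
      ae_restrict_iff' measurableSet_Ioo]
    filter_upwards [measure_eq_zero_iff_ae_notMem.1 (hF.measure_zero volume)] with t h1 h2
    exact ⟨h2, h1⟩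
  have hbd : ∀ t ∈ Set.Ioo (0 : ℝ) 1 \ F, ‖deriv φ t‖ₑ ≤
      ‖y - x‖ₑ * maxSlope S p (AffineMap.lineMap x y t) := by
    intro t ht
    obtain ⟨K, hK, htK, hder⟩ := hd t ht
    rw [hder.deriv, mul_comm]
    have h1 : ‖slope (p K)‖ₑ ≤ maxSlope S p (AffineMap.lineMap x y t) := by
      refine le_trans ?_ (le_iSup₂ (f := fun K (_ : K ∈ elements S) =>
        K.indicator (fun _ => ‖slope (p K)‖ₑ) (AffineMap.lineMap x y t)) K hK)
      rw [Set.indicator_of_mem htK]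
    refine le_trans ?_ (mul_le_mul_left h1 _)
    rw [← ofReal_norm, ← ofReal_norm, ← ofReal_norm,
      ← ENNReal.ofReal_mul (norm_nonneg _)]
    exact ENNReal.ofReal_le_ofReal (norm_inner_le_norm _ _)
  have hint : IntervalIntegrable (deriv φ) volume 0 1 := by
    rw [intervalIntegrable_iff_integrableOn_Icc_of_le zero_le_one]
    refine Measure.integrableOn_of_bounded (M := M * ‖y - x‖) (by simp)
      (measurable_deriv φ).aestronglyMeasurable ?_
    filter_upwards [hae] with t ht
    obtain ⟨K, hK, htK, hder⟩ := hd t ht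
    rw [hder.deriv]
    exact (norm_inner_le_norm _ _).trans (by gcongr; exact hM ⟨K, hK, rfl⟩)
  have hftc : ∫ t in (0 : ℝ)..1, deriv φ t = φ 1 - φ 0 := by
    refine integral_eq_of_hasDerivAt_off_countable_of_le φ (deriv φ) zero_le_one
      hF.countable (hS.continuousOn_lineMap hv hxy) (fun t ht => ?_) hint
    obtain ⟨K, hK, htK, hder⟩ := hd t ht
    exact hder.differentiableAt.hasDerivAt
  have h3 : v x - v y = - ∫ t in Set.Icc (0 : ℝ) 1, deriv φ t := by
    rw [integral_Icc_eq_integral_Ioc, ← intervalIntegral.integral_of_le zero_le_one, hftc]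
    simp [φ]
  rw [h3, enorm_neg]
  refine (enorm_integral_le_lintegral_enorm _).trans ?_
  rw [← lintegral_const_mul' _ _ (by simp)]
  refine lintegral_mono_ae ?_
  filter_upwards [hae] with t ht using hbd t ht

/-- A piecewise affine function is Lipschitz along the segments in the closure of the domain. -/
theorem IsTriangulation.exists_lipschitz_segment (hS : IsTriangulation D S) {v : E d → ℝ}
    (hv : v ∈ Vh D S) :
    ∃ M, ∀ x y, segment ℝ x y ⊆ closure D → |v x - v y| ≤ M * ‖x - y‖ := by
  obtain ⟨p, hp⟩ := exists_isPieces hv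
  obtain ⟨M, hM⟩ := (hS.finite_elements.image fun K => ‖slope (p K)‖).bddAbove
  refine ⟨max M 0, fun x y hxy => ?_⟩
  have h := hS.enorm_sub_le hv hp hxy
  have h2 : ∫⁻ t in Set.Icc (0 : ℝ) 1, maxSlope S p (AffineMap.lineMap x y t) ≤
      ENNReal.ofReal (max M 0) := by
    refine (lintegral_mono (g := fun _ => ENNReal.ofReal (max M 0)) fun t => ?_).trans (by simp)
    refine iSup₂_le fun K hK => ?_
    refine (Set.indicator_le_self' (by simp) _).trans ?_
    rw [← ofReal_norm]
    exact ENNReal.ofReal_le_ofReal ((hM ⟨K, hK, rfl⟩).trans (le_max_left _ _))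
  have h3 := h.trans (mul_le_mul_right h2 _)
  rw [← ofReal_norm, ← ofReal_norm, ← ENNReal.ofReal_mul (norm_nonneg _),
    ENNReal.ofReal_le_ofReal_iff (by positivity)] at h3
  rw [norm_sub_rev x y, mul_comm]
  exact h3

end Triangulation

end SCH

namespace SCH

/-! ### The Poincaré inequality -/

section Poincare

variable {d : ℕ} {D : Set (E d)} {S : Geometry.SimplicialComplex ℝ (E d)}

theorem sq_lintegral_le_lintegral_sq {α : Type*} [MeasurableSpace α] {μ : Measure α}
    [IsProbabilityMeasure μ] {f : α → ENNReal} (hf : AEMeasurable f μ) :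
    (∫⁻ a, f a ∂μ) ^ 2 ≤ ∫⁻ a, f a ^ 2 ∂μ := by
  have h := ENNReal.lintegral_mul_le_Lp_mul_Lq μ Real.HolderConjugate.two_two hf
    (aemeasurable_const (b := (1 : ENNReal)))
  simp only [Pi.mul_apply, mul_one, lintegral_const, measure_univ, ENNReal.rpow_ofNat, one_pow,
    ENNReal.one_rpow] at h
  calc (∫⁻ a, f a ∂μ) ^ 2 ≤ ((∫⁻ a, f a ^ 2 ∂μ) ^ (1 / 2 : ℝ)) ^ 2 := by gcongr
    _ = ∫⁻ a, f a ^ 2 ∂μ := by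
      rw [← ENNReal.rpow_natCast, ← ENNReal.rpow_mul]
      norm_num

theorem lintegral_rotate {α β γ : Type*} [MeasurableSpace α] [MeasurableSpace β]
    [MeasurableSpace γ] {μ : Measure α} {ν : Measure β} {ρ : Measure γ} [SFinite μ] [SFinite ν]
    [SFinite ρ] {f : α → β → γ → ENNReal}
    (hf : Measurable fun q : (α × β) × γ => f q.1.1 q.1.2 q.2) :
    ∫⁻ x, ∫⁻ y, ∫⁻ t, f x y t ∂ρ ∂ν ∂μ = ∫⁻ t, ∫⁻ x, ∫⁻ y, f x y t ∂ν ∂μ ∂ρ := by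
  have h1 : ∀ x, ∫⁻ y, ∫⁻ t, f x y t ∂ρ ∂ν = ∫⁻ t, ∫⁻ y, f x y t ∂ν ∂ρ := fun x => by
    have hx : Measurable fun q : β × γ => ((x, q.1), q.2) := by fun_prop
    exact lintegral_lintegral_swap (hf.comp hx).aemeasurable
  have h2 : Measurable fun q : (α × γ) × β => ((q.1.1, q.2), q.1.2) := by fun_prop
  simp only [h1]
  exact lintegral_lintegral_swap (Measurable.lintegral_prod_right' (hf.comp h2)).aemeasurable

/-- The substitution `z = c + t y` has Jacobian `t⁻ᵈ`, which is at most `2ᵈ` because `t` stays away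
from zero. -/
theorem setLIntegral_comp_add_smul_le {A : Set (E d)} (hA : MeasurableSet A)
    {g : E d → ENNReal} (hg : Measurable g) (c : E d) {t : ℝ} (ht : 1 / 2 ≤ t)
    (hmem : ∀ y ∈ A, c + t • y ∈ A) :
    ∫⁻ y in A, g (c + t • y) ≤ ENNReal.ofReal (2 ^ d) * ∫⁻ y in A, g y := by
  have ht0 : 0 < t := by linarith
  have hm : Measurable (A.indicator g) := hg.indicator hA
  calc ∫⁻ y in A, g (c + t • y) ≤ ∫⁻ y, A.indicator g (c + t • y) := by
        rw [← lintegral_indicator hA]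
        refine lintegral_mono fun y => ?_
        by_cases hy : y ∈ A
        · simp [hy, hmem y hy]
        · simp [hy]
    _ = ∫⁻ z, A.indicator g (c + z) ∂(Measure.map (fun y : E d => t • y) volume) := by
        rw [lintegral_map (f := fun z => A.indicator g (c + z)) (hm.comp (measurable_const_add c))
          (measurable_const_smul t)]
    _ = ENNReal.ofReal |(t ^ d)⁻¹| * ∫⁻ z, A.indicator g (c + z) := by
        rw [Measure.map_addHaar_smul _ ht0.ne', lintegral_smul_measure]
        simp
    _ = ENNReal.ofReal |(t ^ d)⁻¹| * ∫⁻ y in A, g y := by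
        rw [lintegral_add_left_eq_self, lintegral_indicator hA]
    _ ≤ _ := by
        gcongr
        rw [abs_of_pos (by positivity), ← inv_pow]
        gcongr
        rw [inv_le_comm₀ ht0 two_pos]
        linarith

/-- The oscillation of discrete functions between `A` and `B` is controlled by the `L²`-norm of their
gradients on `D`, uniformly in the triangulation. -/
def OscControlled (D A B : Set (E d)) : Prop :=
  ∃ C : ℝ≥0, ∀ S : Geometry.SimplicialComplex ℝ (E d), IsTriangulation D S → ∀ v ∈ Vh D S,
    ∫⁻ x in A, ∫⁻ y in B, ‖v x - v y‖ₑ ^ 2 ≤ C * ∫⁻ x in D, ‖gradient v x‖ₑ ^ 2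

/-- The increment of `v` between `x` and `y` is an integral of slopes over the segment, so its
square is bounded by an average of squared slopes at the points `(1 - t)x + t y`. One of `t` and `1
- t` is at least `1/2`; changing variables in the corresponding end point costs the factor `2ᵈ`
only. The constant sees the diameter and the volume of `A`, never the mesh. -/
theorem oscControlled_of_convex {A : Set (E d)} (hD : MeasurableSet D) (hAo : IsOpen A)
    (hAc : Convex ℝ A) (hAD : A ⊆ D) (hDb : Bornology.IsBounded D) : OscControlled D A A := by
  have hA : MeasurableSet A := hAo.measurableSet
  have hAb : Bornology.IsBounded A := hDb.subset hAD
  have hAfin : volume A ≠ ⊤ := hAb.measure_lt_top.ne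
  let R : ℝ≥0 := ⟨Metric.diam A, Metric.diam_nonneg⟩
  refine ⟨R ^ 2 * (Real.toNNReal (2 ^ d) * (volume A).toNNReal), fun S hS v hv => ?_⟩
  obtain ⟨p, hp⟩ := exists_isPieces hv
  set g : E d → ENNReal := fun x => maxSlope S p x ^ 2 with hgdef
  have hgm : Measurable g := (hS.measurable_maxSlope p).pow_const 2
  have hG : ∫⁻ x in A, g x ≤ ∫⁻ x in D, ‖gradient v x‖ₑ ^ 2 := by
    refine (lintegral_mono_set hAD).trans (lintegral_mono_ae ?_)
    filter_upwards [hS.maxSlope_ae_eq hD hp] with x hx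
    rw [hgdef]
    simp only [hx, le_refl]
  have hline : Measurable fun q : (E d × E d) × ℝ => (AffineMap.lineMap q.1.1 q.1.2 q.2 : E d) := by
    have : Continuous fun q : (E d × E d) × ℝ => (AffineMap.lineMap q.1.1 q.1.2 q.2 : E d) := by
      simp only [AffineMap.lineMap_apply_module]
      fun_prop
    exact this.measurable
  have hpt : ∀ x ∈ A, ∀ y ∈ A, ‖v x - v y‖ₑ ^ 2 ≤
      (R : ENNReal) ^ 2 * ∫⁻ t in Set.Icc (0 : ℝ) 1, g (AffineMap.lineMap x y t) := by
    intro x hx y hy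
    have hseg : segment ℝ x y ⊆ closure D :=
      (hAc.segment_subset hx hy).trans (hAD.trans subset_closure)
    have h1 := hS.enorm_sub_le hv hp hseg
    have hprob : IsProbabilityMeasure (volume.restrict (Set.Icc (0 : ℝ) 1)) := ⟨by simp⟩
    have h2 : (∫⁻ t in Set.Icc (0 : ℝ) 1, maxSlope S p (AffineMap.lineMap x y t)) ^ 2 ≤
        ∫⁻ t in Set.Icc (0 : ℝ) 1, g (AffineMap.lineMap x y t) := by
      apply sq_lintegral_le_lintegral_sq
      exact ((hS.measurable_maxSlope p).comp
        (hline.comp (measurable_prodMk_left (x := (x, y))))).aemeasurable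
    have h3 : ‖y - x‖ₑ ≤ (R : ENNReal) := by
      rw [← ofReal_norm, ← dist_eq_norm, ← ENNReal.ofReal_coe_nnreal]
      exact ENNReal.ofReal_le_ofReal (Metric.dist_le_diam_of_mem hAb hy hx)
    calc ‖v x - v y‖ₑ ^ 2 ≤ _ := pow_le_pow_left₀ (zero_le) h1 2
      _ = ‖y - x‖ₑ ^ 2 * _ := mul_pow _ _ 2
      _ ≤ _ := by gcongr
  have hslice : ∀ t ∈ Set.Icc (0 : ℝ) 1,
      ∫⁻ x in A, ∫⁻ y in A, g (AffineMap.lineMap x y t) ≤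
        ENNReal.ofReal (2 ^ d) * (∫⁻ y in A, g y) * volume A := by
    have key : ∀ t ∈ Set.Icc (1 / 2 : ℝ) 1, ∫⁻ x in A, ∫⁻ y in A, g (AffineMap.lineMap x y t) ≤
        ENNReal.ofReal (2 ^ d) * (∫⁻ y in A, g y) * volume A := by
      intro t ht
      rw [← setLIntegral_const]
      refine setLIntegral_mono' hA fun x hx => ?_
      simp only [AffineMap.lineMap_apply_module]
      refine setLIntegral_comp_add_smul_le hA hgm _ ht.1 fun y hy => ?_
      exact hAc hx hy (by linarith [ht.2]) (by linarith [ht.1]) (by ring)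
    -- For `t ≤ 1/2` the roles of `x` and `y` are exchanged by Tonelli.
    intro t ht
    rcases le_total (1 / 2) t with h | h
    · exact key t ⟨h, ht.2⟩
    · rw [lintegral_lintegral_swap]
      · refine le_trans (le_of_eq ?_) (key (1 - t) ⟨by linarith, by linarith [ht.1]⟩)
        refine lintegral_congr fun x => lintegral_congr fun y => ?_
        rw [AffineMap.lineMap_apply_one_sub]
      · exact (hgm.comp (hline.comp (measurable_prodMk_right (y := t)))).aemeasurable
  have hswap : ∫⁻ x in A, ∫⁻ y in A, ∫⁻ t in Set.Icc (0 : ℝ) 1, g (AffineMap.lineMap x y t) =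
      ∫⁻ t in Set.Icc (0 : ℝ) 1, ∫⁻ x in A, ∫⁻ y in A, g (AffineMap.lineMap x y t) :=
    lintegral_rotate (f := fun x y t => g (AffineMap.lineMap x y t)) (hgm.comp hline)
  calc ∫⁻ x in A, ∫⁻ y in A, ‖v x - v y‖ₑ ^ 2
      ≤ ∫⁻ x in A, ∫⁻ y in A, (R : ENNReal) ^ 2 *
          ∫⁻ t in Set.Icc (0 : ℝ) 1, g (AffineMap.lineMap x y t) :=
        setLIntegral_mono' hA fun x hx => setLIntegral_mono' hA fun y hy => hpt x hx y hy
    _ = (R : ENNReal) ^ 2 * ∫⁻ x in A, ∫⁻ y in A,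
          ∫⁻ t in Set.Icc (0 : ℝ) 1, g (AffineMap.lineMap x y t) := by
        rw [← lintegral_const_mul' _ _ (by simp)]
        refine lintegral_congr fun x => ?_
        rw [lintegral_const_mul' _ _ (by simp)]
    _ ≤ (R : ENNReal) ^ 2 * (ENNReal.ofReal (2 ^ d) * (∫⁻ y in A, g y) * volume A) := by
        gcongr
        rw [hswap]
        refine (setLIntegral_mono' measurableSet_Icc hslice).trans ?_
        simp
    _ ≤ (R : ENNReal) ^ 2 * (ENNReal.ofReal (2 ^ d) *
          (∫⁻ x in D, ‖gradient v x‖ₑ ^ 2) * volume A) := by gcongr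
    _ = _ := by
        push_cast
        rw [ENNReal.coe_toNNReal hAfin, ENNReal.ofReal]
        ring

theorem IsTriangulation.measurable_osc (hS : IsTriangulation D S) {v : E d → ℝ} (hv : v ∈ Vh D S) :
    Measurable fun q : E d × E d => ‖v q.1 - v q.2‖ₑ ^ 2 := by
  have := hS.measurable hv
  fun_prop

theorem OscControlled.symm {A B : Set (E d)} (h : OscControlled D A B) : OscControlled D B A := by
  obtain ⟨C, hC⟩ := h
  refine ⟨C, fun S hS v hv => ?_⟩
  rw [lintegral_lintegral_swap (hS.measurable_osc hv).aemeasurable]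
  simpa only [enorm_sub_rev] using hC S hS v hv

theorem OscControlled.mono {A B A' B' : Set (E d)} (h : OscControlled D A B) (hA : A' ⊆ A)
    (hB : B' ⊆ B) : OscControlled D A' B' := by
  obtain ⟨C, hC⟩ := h
  refine ⟨C, fun S hS v hv => le_trans ?_ (hC S hS v hv)⟩
  exact (lintegral_mono_set hA).trans (lintegral_mono fun x => lintegral_mono_set hB)

/-- Insert a point `z ∈ B` into `|v x - v y|²`, bound by twice the two squares, and average over
`z`. Positive volume of the intermediate set is what allows the division. -/
theorem OscControlled.trans {A B C : Set (E d)} (h₁ : OscControlled D A B)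
    (h₂ : OscControlled D B C) (hA : volume A ≠ ⊤) (hB : volume B ≠ 0) (hB' : volume B ≠ ⊤)
    (hC : volume C ≠ ⊤) : OscControlled D A C := by
  obtain ⟨c₁, hc₁⟩ := h₁
  obtain ⟨c₂, hc₂⟩ := h₂
  refine ⟨(volume B).toNNReal⁻¹ * (2 * (volume C).toNNReal * c₁ + 2 * (volume A).toNNReal * c₂),
    fun S hS v hv => ?_⟩
  set G := ∫⁻ x in D, ‖gradient v x‖ₑ ^ 2
  have hm := hS.measurable_osc hv
  have hvm := hS.measurable hv
  have hpt : ∀ x y z, ‖v x - v y‖ₑ ^ 2 ≤ 2 * ‖v x - v z‖ₑ ^ 2 + 2 * ‖v z - v y‖ₑ ^ 2 := by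
    intro x y z
    have : (v x - v y) ^ 2 ≤ 2 * (v x - v z) ^ 2 + 2 * (v z - v y) ^ 2 := by
      nlinarith [sq_nonneg (v x - v z - (v z - v y))]
    have e : ∀ a : ℝ, ‖a‖ₑ ^ 2 = ENNReal.ofReal (a ^ 2) := fun a => by
      rw [← ofReal_norm, ← ENNReal.ofReal_pow (norm_nonneg _), Real.norm_eq_abs, sq_abs]
    rw [e, e, e]
    have e2 : (2 : ENNReal) = ENNReal.ofReal 2 := by simp
    rw [e2, ← ENNReal.ofReal_mul (by norm_num), ← ENNReal.ofReal_mul (by norm_num),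
      ← ENNReal.ofReal_add (by positivity) (by positivity)]
    exact ENNReal.ofReal_le_ofReal this
  have hmain : volume B * ∫⁻ x in A, ∫⁻ y in C, ‖v x - v y‖ₑ ^ 2 ≤
      2 * volume C * (c₁ * G) + 2 * volume A * (c₂ * G) := by
    calc volume B * ∫⁻ x in A, ∫⁻ y in C, ‖v x - v y‖ₑ ^ 2
        = ∫⁻ x in A, ∫⁻ y in C, ∫⁻ _ in B, ‖v x - v y‖ₑ ^ 2 := by
          rw [← lintegral_const_mul' _ _ hB']
          refine lintegral_congr fun x => ?_
          rw [← lintegral_const_mul' _ _ hB']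
          refine lintegral_congr fun y => ?_
          rw [setLIntegral_const, mul_comm]
      _ ≤ ∫⁻ x in A, ∫⁻ y in C, ∫⁻ z in B, (2 * ‖v x - v z‖ₑ ^ 2 + 2 * ‖v z - v y‖ₑ ^ 2) :=
          lintegral_mono fun x => lintegral_mono fun y => lintegral_mono fun z => hpt x y z
      _ = ∫⁻ x in A, ∫⁻ y in C, (2 * (∫⁻ z in B, ‖v x - v z‖ₑ ^ 2) +
            2 * ∫⁻ z in B, ‖v z - v y‖ₑ ^ 2) := by
          refine lintegral_congr fun x => lintegral_congr fun y => ?_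
          rw [lintegral_add_left (by fun_prop), lintegral_const_mul' _ _ (by simp),
            lintegral_const_mul' _ _ (by simp)]
      _ = ∫⁻ x in A, (2 * (∫⁻ z in B, ‖v x - v z‖ₑ ^ 2) * volume C +
            2 * ∫⁻ z in B, ∫⁻ y in C, ‖v z - v y‖ₑ ^ 2) := by
          refine lintegral_congr fun x => ?_
          rw [lintegral_add_left (by fun_prop), setLIntegral_const, lintegral_const_mul' _ _ (by simp),
            lintegral_lintegral_swap (f := fun y z => ‖v z - v y‖ₑ ^ 2) (by
              exact (hm.comp measurable_swap).aemeasurable)]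
      _ = 2 * volume C * (∫⁻ x in A, ∫⁻ z in B, ‖v x - v z‖ₑ ^ 2) +
            2 * volume A * ∫⁻ z in B, ∫⁻ y in C, ‖v z - v y‖ₑ ^ 2 := by
          rw [lintegral_add_right _ measurable_const, setLIntegral_const,
            lintegral_mul_const' _ _ hC, lintegral_const_mul' _ _ (by simp)]
          ring
      _ ≤ _ := by
          gcongr
          · exact hc₁ S hS v hv
          · exact hc₂ S hS v hv
  rw [ENNReal.coe_mul, ENNReal.coe_inv (by simp [ENNReal.toNNReal_eq_zero_iff, hB, hB']),
    ENNReal.coe_toNNReal hB', mul_assoc, mul_comm, ← div_eq_mul_inv,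
    ENNReal.le_div_iff_mul_le (Or.inl hB) (Or.inl hB'), mul_comm]
  refine hmain.trans (le_of_eq ?_)
  push_cast
  rw [ENNReal.coe_toNNReal hA, ENNReal.coe_toNNReal hC]
  ring

/-- Chain through overlapping convex open sets. Call two points related if the claim holds for all
convex open neighbourhoods of them in `D`. This relation is symmetric and transitive, and it holds
near the diagonal because of balls inside `D`, so connectedness relates any two points. -/
theorem oscControlled_of_isConnected (hDo : IsOpen D) (hDc : IsConnected D)
    (hDb : Bornology.IsBounded D) {A B : Set (E d)} (hAo : IsOpen A) (hAc : Convex ℝ A)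
    (hAD : A ⊆ D) (hBo : IsOpen B) (hBc : Convex ℝ B) (hBD : B ⊆ D) : OscControlled D A B := by
  have hfin : ∀ A : Set (E d), A ⊆ D → volume A ≠ ⊤ := fun A hA =>
    (hDb.subset hA).measure_lt_top.ne
  rcases A.eq_empty_or_nonempty with rfl | ⟨a, ha⟩
  · exact ⟨0, fun S hS v hv => by simp⟩
  rcases B.eq_empty_or_nonempty with rfl | ⟨b, hb⟩
  · exact ⟨0, fun S hS v hv => by simp⟩
  let P : E d → E d → Prop := fun x y => ∀ A B : Set (E d), IsOpen A → Convex ℝ A → A ⊆ D → x ∈ A →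
    IsOpen B → Convex ℝ B → B ⊆ D → y ∈ B → OscControlled D A B
  have hP : P a b := by
    refine hDc.isPreconnected.induction₂ P ?_ ?_ ?_ (hAD ha) (hBD hb)
    · intro x hx
      obtain ⟨r, hr, hrD⟩ := Metric.isOpen_iff.1 hDo x hx
      filter_upwards [mem_nhdsWithin_of_mem_nhds (Metric.ball_mem_nhds x hr)] with y hy
      intro A B hAo hAc hAD hxA hBo hBc hBD hyB
      have hI : ∀ U : Set (E d), IsOpen U → Convex ℝ U → U ⊆ D → OscControlled D U U :=
        fun U hUo hUc hUD => oscControlled_of_convex hDo.measurableSet hUo hUc hUD hDb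
      have hball := hI _ Metric.isOpen_ball (convex_ball x r) hrD
      have h1 : OscControlled D A (A ∩ Metric.ball x r) :=
        (hI A hAo hAc hAD).mono subset_rfl Set.inter_subset_left
      have h2 : OscControlled D (A ∩ Metric.ball x r) (B ∩ Metric.ball x r) :=
        hball.mono Set.inter_subset_right Set.inter_subset_right
      have h3 : OscControlled D (B ∩ Metric.ball x r) B :=
        (hI B hBo hBc hBD).mono Set.inter_subset_left subset_rfl
      have hA' := (hAo.inter (Metric.isOpen_ball (x := x) (ε := r))).measure_pos volume
        ⟨x, hxA, Metric.mem_ball_self hr⟩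
      have hB' := (hBo.inter (Metric.isOpen_ball (x := x) (ε := r))).measure_pos volume
        ⟨y, hyB, hy⟩
      exact (h1.trans h2 (hfin _ hAD) hA'.ne' (hfin _ (Set.inter_subset_left.trans hAD))
        (hfin _ (Set.inter_subset_left.trans hBD))).trans h3 (hfin _ hAD) hB'.ne'
        (hfin _ (Set.inter_subset_left.trans hBD)) (hfin _ hBD)
    · intro x y z _ hy _ hxy hyz A B hAo hAc hAD hxA hBo hBc hBD hzB
      obtain ⟨r, hr, hrD⟩ := Metric.isOpen_iff.1 hDo y hy
      refine (hxy A _ hAo hAc hAD hxA Metric.isOpen_ball (convex_ball y r) hrD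
        (Metric.mem_ball_self hr)).trans (hyz _ B Metric.isOpen_ball (convex_ball y r) hrD
        (Metric.mem_ball_self hr) hBo hBc hBD hzB) (hfin _ hAD) ?_ (hfin _ hrD) (hfin _ hBD)
      exact (Metric.measure_ball_pos volume y hr).ne'
    · intro x y _ _ hxy A B hAo hAc hAD hxA hBo hBc hBD hyB
      exact (hxy B A hBo hBc hBD hyB hAo hAc hAD hxA).symm
  exact hP A B hAo hAc hAD ha hBo hBc hBD hb

theorem OscControlled.union_left {A A' B : Set (E d)} (h : OscControlled D A B)
    (h' : OscControlled D A' B) : OscControlled D (A ∪ A') B := by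
  obtain ⟨C, hC⟩ := h
  obtain ⟨C', hC'⟩ := h'
  refine ⟨C + C', fun S hS v hv => (lintegral_union_le _ _ _).trans ?_⟩
  rw [ENNReal.coe_add, add_mul]
  exact add_le_add (hC S hS v hv) (hC' S hS v hv)

theorem OscControlled.biUnion_left {ι : Type*} {s : Set ι} (hs : s.Finite) {A : ι → Set (E d)}
    {B : Set (E d)} (h : ∀ i ∈ s, OscControlled D (A i) B) :
    OscControlled D (⋃ i ∈ s, A i) B := by
  induction s, hs using Set.Finite.induction_on with
  | empty => exact ⟨0, fun S hS v hv => by simp⟩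
  | insert _ _ ih =>
    rw [Set.biUnion_insert]
    exact (h _ (Set.mem_insert _ _)).union_left (ih fun i hi => h i (Set.mem_insert_of_mem _ hi))

/-- The triangulation serves only as a finite cover of `D`, up to a null set, by convex open sets.
The resulting constant is then valid for the discrete functions on every other triangulation. -/
theorem IsTriangulation.oscControlled (hS : IsTriangulation D S) (hDo : IsOpen D)
    (hDc : IsConnected D) (hDb : Bornology.IsBounded D) (hDr : interior (closure D) = D) :
    OscControlled D D D := by
  have hsub : ∀ K ∈ elements S, interior K ⊆ D := fun K hK => by
    rw [← hDr]
    exact interior_mono (hS.subset_closure hK)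
  have hU : OscControlled D (⋃ K ∈ elements S, interior K) (⋃ K ∈ elements S, interior K) := by
    refine OscControlled.biUnion_left hS.finite_elements fun K hK => OscControlled.symm ?_
    refine OscControlled.biUnion_left hS.finite_elements fun L hL => ?_
    exact oscControlled_of_isConnected hDo hDc hDb isOpen_interior
      (convex_of_mem_elements hL).interior (hsub L hL) isOpen_interior
      (convex_of_mem_elements hK).interior (hsub K hK)
  have hle : volume.restrict D ≤ volume.restrict (⋃ K ∈ elements S, interior K) := by
    refine Measure.restrict_mono_ae ?_
    have := hS.ae_mem_interior hDo.measurableSet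
    rw [ae_restrict_iff' hDo.measurableSet] at this
    filter_upwards [this] with x hx hxD
    exact Set.mem_iUnion₂.2 (by simpa using hx hxD)
  obtain ⟨C, hC⟩ := hU
  refine ⟨C, fun S' hS' v hv => le_trans ?_ (hC S' hS' v hv)⟩
  exact lintegral_mono' hle fun x => lintegral_mono' hle fun y => le_rfl

/-- The Poincaré inequality for discrete functions of zero mean, with a constant that does not
depend on the triangulation. -/
theorem exists_poincare (hDo : IsOpen D) (hDc : IsConnected D) (hDb : Bornology.IsBounded D)
    (hDr : interior (closure D) = D) :
    ∃ C : ℝ, 0 ≤ C ∧ ∀ S : Geometry.SimplicialComplex ℝ (E d), IsTriangulation D S → ∀ v ∈ Vh D S,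
      ∫ x in D, v x = 0 → ∫ x in D, v x ^ 2 ≤ C * gradNormSq D v := by
  by_cases hex : ∃ S : Geometry.SimplicialComplex ℝ (E d), IsTriangulation D S
  swap
  · exact ⟨0, le_rfl, fun S hS => (hex ⟨S, hS⟩).elim⟩
  -- One triangulation is fixed to produce the constant; `S` below is arbitrary.
  obtain ⟨S₀, hS₀⟩ := hex
  obtain ⟨C, hC⟩ := hS₀.oscControlled hDo hDc hDb hDr
  have hfin : IsFiniteMeasure (volume.restrict D) := ⟨by simpa using hDb.measure_lt_top⟩
  have hpos : 0 < volume.real D :=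
    ENNReal.toReal_pos (hDo.measure_pos volume hDc.nonempty).ne' hDb.measure_lt_top.ne
  refine ⟨C / volume.real D, by positivity, fun S hS v hv hv0 => ?_⟩
  have h := hC S hS v hv
  obtain ⟨M, hM⟩ := hS.exists_bound hDb hv
  obtain ⟨M', hM'⟩ := hS.exists_gradient_bound hDo.measurableSet hv
  have hvm := hS.measurable hv
  have hi1 : Integrable v (volume.restrict D) :=
    Integrable.of_bound hvm.aestronglyMeasurable M (ae_of_all _ hM)
  have hi2 : Integrable (fun x => v x ^ 2) (volume.restrict D) :=
    Integrable.of_bound (hvm.pow_const 2).aestronglyMeasurable (M ^ 2) (ae_of_all _ fun x => by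
      rw [norm_pow]
      exact pow_le_pow_left₀ (norm_nonneg _) (hM x) 2)
  have hig : Integrable (fun x => ‖gradient v x‖ ^ 2) (volume.restrict D) := by
    refine Integrable.of_bound (((measurable_gradient v).norm.pow_const 2).aestronglyMeasurable)
      (M' ^ 2) ?_
    filter_upwards [hM'] with x hx
    rw [norm_pow, norm_norm]
    exact pow_le_pow_left₀ (norm_nonneg _) hx 2
  have e : ∀ a : ℝ, ‖a‖ₑ ^ 2 = ENNReal.ofReal (a ^ 2) := fun a => by
    rw [← ofReal_norm, ← ENNReal.ofReal_pow (norm_nonneg _), Real.norm_eq_abs, sq_abs]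
  have hR : ∫⁻ x in D, ‖gradient v x‖ₑ ^ 2 = ENNReal.ofReal (gradNormSq D v) := by
    rw [gradNormSq, ofReal_integral_eq_lintegral_ofReal hig (ae_of_all _ fun x => by positivity)]
    refine lintegral_congr fun x => ?_
    rw [← ofReal_norm, ENNReal.ofReal_pow (norm_nonneg _)]
  -- Expanding the square, the cross term disappears because `v` has mean zero; after the second
  -- integration the double integral equals `2|D|‖v‖²`.
  have hin : ∀ x, ∫⁻ y in D, ‖v x - v y‖ₑ ^ 2 =
      ENNReal.ofReal (volume.real D * v x ^ 2 + ∫ y in D, v y ^ 2) := by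
    intro x
    have hexp : (fun y => (v x - v y) ^ 2) = fun y => (v x ^ 2 - 2 * v x * v y) + v y ^ 2 := by
      ext y
      ring
    have hi3 : Integrable (fun y => v x ^ 2 - 2 * v x * v y) (volume.restrict D) :=
      (integrable_const _).sub (hi1.const_mul _)
    simp_rw [e]
    rw [← ofReal_integral_eq_lintegral_ofReal (by rw [hexp]; exact hi3.add hi2)
      (ae_of_all _ fun y => by positivity), hexp, integral_add hi3 hi2,
      integral_sub (integrable_const _) (hi1.const_mul _), integral_const_mul, hv0]
    simp
  have hL : ∫⁻ x in D, ∫⁻ y in D, ‖v x - v y‖ₑ ^ 2 =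
      ENNReal.ofReal (2 * volume.real D * ∫ y in D, v y ^ 2) := by
    have hnn : 0 ≤ ∫ y in D, v y ^ 2 := integral_nonneg fun y => by positivity
    have hi4 : Integrable (fun x => volume.real D * v x ^ 2 + ∫ y in D, v y ^ 2)
        (volume.restrict D) := (hi2.const_mul _).add (integrable_const _)
    simp_rw [hin]
    rw [← ofReal_integral_eq_lintegral_ofReal hi4 (ae_of_all _ fun y => by positivity),
      integral_add (hi2.const_mul _) (integrable_const _), integral_const_mul]
    congr 1
    simp
    ring
  have hG : 0 ≤ gradNormSq D v := integral_nonneg fun y => by positivity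
  rw [hL, hR, ← ENNReal.ofReal_coe_nnreal, ← ENNReal.ofReal_mul C.coe_nonneg,
    ENNReal.ofReal_le_ofReal_iff (mul_nonneg C.coe_nonneg hG)] at h
  have hnn : 0 ≤ ∫ y in D, v y ^ 2 := integral_nonneg fun y => by positivity
  rw [div_mul_eq_mul_div, le_div_iff₀ hpos]
  nlinarith [mul_nonneg hnn hpos.le]

end Poincare

end SCH

namespace SCH

/-! ### Flat boundary points -/

section Flat

variable {d : ℕ} {D : Set (E d)} {S : Geometry.SimplicialComplex ℝ (E d)}

/-- The union of the faces of codimension at least two. -/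
def codimTwoSkeleton (S : Geometry.SimplicialComplex ℝ (E d)) : Set (E d) :=
  ⋃ s ∈ {s ∈ S.faces | s.card + 1 ≤ d}, convexHull ℝ (s : Set (E d))

theorem exists_affineBasis {s : Finset (E d)} (hs : s ∈ S.faces) (hc : s.card = d + 1) :
    ∃ b : AffineBasis s ℝ (E d), ∀ i, b i = i := by
  refine ⟨⟨(↑), S.indep hs, ?_⟩, fun _ => rfl⟩
  rw [(S.indep hs).affineSpan_eq_top_iff_card_eq_finrank_add_one]
  simp [hc]

theorem affine_eq_sum_coord {ι : Type*} [Fintype ι] (b : AffineBasis ι ℝ (E d))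
    (p : E d →ᵃ[ℝ] ℝ) (y : E d) : p y = ∑ i, b.coord i y * p (b i) := by
  have h : ∀ z, p z = p 0 + inner ℝ (slope p) z := fun z => by
    simpa using affine_apply_eq p 0 z
  calc p y = p 0 + inner ℝ (slope p) (∑ i, b.coord i y • b i) := by
        rw [b.linear_combination_coord_eq_self, h]
    _ = (∑ i, b.coord i y) * p 0 + ∑ i, b.coord i y * inner ℝ (slope p) (b i) := by
        rw [b.sum_coord_apply_eq_one, inner_sum, one_mul]
        simp only [inner_smul_right]
    _ = ∑ i, b.coord i y * p (b i) := by
        rw [Finset.sum_mul, ← Finset.sum_add_distrib]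
        exact Finset.sum_congr rfl fun i _ => by rw [h (b i), mul_add]

section Basis

variable {s : Finset (E d)} {b : AffineBasis s ℝ (E d)}

theorem range_affineBasis (hb : ∀ i, b i = i) : Set.range b = (s : Set (E d)) := by
  ext x
  constructor
  · rintro ⟨i, rfl⟩
    rw [hb]
    exact i.2
  · intro hx
    exact ⟨⟨x, hx⟩, hb _⟩

theorem mem_convexHull_iff_coord (hb : ∀ i, b i = i) {x : E d} :
    x ∈ convexHull ℝ (s : Set (E d)) ↔ ∀ i, 0 ≤ b.coord i x := by
  rw [← range_affineBasis hb, b.convexHull_eq_nonneg_coord]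
  rfl

theorem mem_interior_convexHull_iff_coord (hb : ∀ i, b i = i) {x : E d} :
    x ∈ interior (convexHull ℝ (s : Set (E d))) ↔ ∀ i, 0 < b.coord i x := by
  rw [← range_affineBasis hb, b.interior_convexHull]
  rfl

theorem mem_convexHull_of_coord_eq_zero (hb : ∀ i, b i = i) {x : E d} {t : Finset (E d)}
    (hx : x ∈ convexHull ℝ (s : Set (E d))) (h0 : ∀ i : s, (i : E d) ∉ t → b.coord i x = 0) :
    x ∈ convexHull ℝ (t : Set (E d)) := by
  classical
  have hx' := (mem_convexHull_iff_coord hb).1 hx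
  have e1 : ∑ i ∈ Finset.univ.filter (fun i : s => (i : E d) ∈ t), b.coord i x = 1 := by
    rw [Finset.sum_filter_of_ne, b.sum_coord_apply_eq_one x]
    intro i _ hi
    by_contra h
    exact hi (h0 i h)
  have e2 : ∑ i ∈ Finset.univ.filter (fun i : s => (i : E d) ∈ t), b.coord i x • b i = x := by
    rw [Finset.sum_filter_of_ne, b.linear_combination_coord_eq_self x]
    intro i _ hi
    by_contra h
    exact hi (by rw [h0 i h, zero_smul])
  rw [← e2]
  refine (convex_convexHull ℝ _).sum_mem (fun i _ => hx' i) e1 fun i hi => ?_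
  rw [hb]
  exact subset_convexHull ℝ _ (Finset.mem_filter.1 hi).2

theorem coord_eq_zero_of_mem_convexHull (hb : ∀ i, b i = i) {x : E d} {t : Finset (E d)}
    (hts : t ⊆ s) (hx : x ∈ convexHull ℝ (t : Set (E d))) (i : s) (hi : (i : E d) ∉ t) :
    b.coord i x = 0 := by
  have hc : Convex ℝ (b.coord i ⁻¹' {0}) := (convex_singleton 0).affine_preimage _
  refine convexHull_min (fun y hy => ?_) hc hx
  have : y = b ⟨y, hts hy⟩ := (hb ⟨y, hts hy⟩).symm
  rw [Set.mem_preimage, Set.mem_singleton_iff, this, b.coord_apply_ne]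
  rintro rfl
  exact hi hy

end Basis

/-- A boundary point that is not on the skeleton lies on exactly one facet of an element. -/
theorem exists_unique_coord_eq_zero {s : Finset (E d)} (hs : s ∈ S.faces) (hc : s.card = d + 1)
    {b : AffineBasis s ℝ (E d)} (hb : ∀ i, b i = i) {x : E d}
    (hx : x ∈ convexHull ℝ (s : Set (E d))) (hxi : x ∉ interior (convexHull ℝ (s : Set (E d))))
    (hxs : x ∉ codimTwoSkeleton S) : ∃ i, b.coord i x = 0 ∧ ∀ j ≠ i, 0 < b.coord j x := by
  classical
  have hx' := (mem_convexHull_iff_coord hb).1 hx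
  rw [mem_interior_convexHull_iff_coord hb] at hxi
  push Not at hxi
  obtain ⟨i, hi⟩ := hxi
  have hi0 : b.coord i x = 0 := le_antisymm hi (hx' i)
  refine ⟨i, hi0, fun j hj => lt_of_le_of_ne (hx' j) fun hj0 => hxs ?_⟩
  -- Two vanishing coordinates would put `x` on the face spanned by the remaining `d - 1` vertices,
  -- which belongs to the skeleton.
  have hmem : x ∈ convexHull ℝ (((s.erase i).erase j : Finset (E d)) : Set (E d)) := by
    refine mem_convexHull_of_coord_eq_zero hb hx fun k hk => ?_
    by_cases h1 : k = j
    · rw [h1, ← hj0]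
    by_cases h2 : k = i
    · rw [h2, hi0]
    · exact absurd (by simp [Subtype.coe_ne_coe.2 h1, Subtype.coe_ne_coe.2 h2]) hk
  have hne : ((s.erase i).erase j).Nonempty := by
    rw [← Finset.coe_nonempty, ← convexHull_nonempty_iff (𝕜 := ℝ)]
    exact ⟨x, hmem⟩
  refine Set.mem_biUnion (x := (s.erase i).erase j) ⟨S.down_closed hs ?_ hne, ?_⟩ hmem
  · exact (Finset.erase_subset _ _).trans (Finset.erase_subset _ _)
  · rw [Finset.card_erase_of_mem (Finset.mem_erase.2 ⟨Subtype.coe_ne_coe.2 hj, j.2⟩),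
      Finset.card_erase_of_mem i.2, hc]
    have := Finset.card_pos.2 hne
    rw [Finset.card_erase_of_mem (Finset.mem_erase.2 ⟨Subtype.coe_ne_coe.2 hj, j.2⟩),
      Finset.card_erase_of_mem i.2, hc] at this
    omega

theorem eventually_coord_pos {s : Finset (E d)} {b : AffineBasis s ℝ (E d)} {x : E d} {i : s}
    (h : ∀ j ≠ i, 0 < b.coord j x) : ∀ᶠ y in 𝓝 x, ∀ j ≠ i, 0 < b.coord j y := by
  rw [eventually_all]
  intro j
  by_cases hj : j = i
  · exact Eventually.of_forall fun y h => (h hj).elim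
  · have hc : Continuous (b.coord j) := (b.coord j).continuous_of_finiteDimensional
    filter_upwards [hc.continuousAt.eventually (lt_mem_nhds (h j hj))] with y hy _ using hy

/-- The facets of two elements on which a point lies, if it is not on the skeleton, coincide. -/
theorem erase_eq_inter {s t : Finset (E d)} [DecidableEq (E d)] (hs : s ∈ S.faces)
    (ht : t ∈ S.faces)
    (hsc : s.card = d + 1) (htc : t.card = d + 1) (hst : s ≠ t)
    {b : AffineBasis s ℝ (E d)} (hb : ∀ i, b i = i) {x : E d}
    (hxs : x ∈ convexHull ℝ (s : Set (E d))) (hxt : x ∈ convexHull ℝ (t : Set (E d))) {i : s} (hi : ∀ j ≠ i, 0 < b.coord j x) :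
    s ∩ t = s.erase i := by
  have hmem : x ∈ convexHull ℝ ((s ∩ t : Finset (E d)) : Set (E d)) := by
    rw [Finset.coe_inter]
    exact S.inter_subset_convexHull hs ht ⟨hxs, hxt⟩
  -- All coordinates other than the `i`-th are positive at `x`, so a face of `s` that contains `x`
  -- must contain all these vertices. Counting then leaves only the facet, since `s` and `t` are
  -- different.
  have hsub : s.erase i ⊆ s ∩ t := by
    intro y hy
    obtain ⟨hyi, hys⟩ := Finset.mem_erase.1 hy
    by_contra hyt
    have h0 := coord_eq_zero_of_mem_convexHull hb Finset.inter_subset_left hmem ⟨y, hys⟩ hyt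
    exact (hi ⟨y, hys⟩ fun h => hyi (congrArg Subtype.val h)).ne' h0
  refine (Finset.eq_of_subset_of_card_le hsub ?_).symm
  rw [Finset.card_erase_of_mem i.2, hsc, Nat.add_sub_cancel]
  by_contra! hlt
  have h1 : s ∩ t = s := Finset.eq_of_subset_of_card_le Finset.inter_subset_left (by omega)
  have h2 : s ∩ t = t := Finset.eq_of_subset_of_card_le Finset.inter_subset_right (by omega)
  exact hst (h1.symm.trans h2)

/-- Both coordinates are affine and vanish on the common facet, so they are proportional. The sign
of the factor `c.coord j i` tells on which side of the facet the two simplices lie. -/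
theorem coord_eq_smul_coord {s t : Finset (E d)} [DecidableEq (E d)]
    {b : AffineBasis s ℝ (E d)} (hb : ∀ i, b i = i) {c : AffineBasis t ℝ (E d)} (hc : ∀ i, c i = i)
    {i : s} {j : t} (hij : s.erase i = t.erase j) (y : E d) :
    c.coord j y = c.coord j i * b.coord i y := by
  rw [affine_eq_sum_coord b (c.coord j) y, Finset.sum_eq_single i, hb, mul_comm]
  · intro k _ hk
    have hk' : (k : E d) ∈ t.erase j := hij ▸ Finset.mem_erase.2 ⟨Subtype.coe_ne_coe.2 hk, k.2⟩
    obtain ⟨h1, h2⟩ := Finset.mem_erase.1 hk'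
    have h3 : (k : E d) = c ⟨k, h2⟩ := (hc ⟨k, h2⟩).symm
    have h4 : j ≠ ⟨k, h2⟩ := by
      rintro rfl
      exact h1 rfl
    rw [hb, h3, c.coord_apply_ne h4, mul_zero]
  · simp

/-- The boundary of a polyhedral domain is flat off the skeleton of a triangulation. -/
theorem IsTriangulation.exists_isOutwardNormal (hS : IsTriangulation D S) (hDo : IsOpen D)
    (hDr : interior (closure D) = D) {x : E d} (hx : x ∈ frontier D)
    (hxS : x ∉ codimTwoSkeleton S) : ∃ ν, IsOutwardNormal D x ν := by
  classical
  have hxD : x ∉ D := by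
    rw [hDo.frontier_eq] at hx
    exact hx.2
  have hxc : x ∈ closure D := frontier_subset_closure hx
  have hint : ∀ K ∈ elements S, x ∉ interior K := fun K hK h =>
    hxD (hDr ▸ interior_mono (hS.subset_closure hK) h)
  obtain ⟨K, ⟨s, hs, hsc, rfl⟩, hxs⟩ : ∃ K ∈ elements S, x ∈ K := by
    rw [hS.closure_eq] at hxc
    exact hxc
  obtain ⟨b, hb⟩ := exists_affineBasis hs hsc
  obtain ⟨i, hi0, hipos⟩ := exists_unique_coord_eq_zero hs hsc hb hxs
    (hint _ ⟨s, hs, hsc, rfl⟩) hxS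
  -- Near `x` the element fills the whole side `0 ≤ b.coord i` of its facet.
  have hsloc : ∀ᶠ y in 𝓝 x, 0 ≤ b.coord i y → y ∈ convexHull ℝ (s : Set (E d)) := by
    filter_upwards [eventually_coord_pos hipos] with y hy hyi
    rw [mem_convexHull_iff_coord hb]
    intro j
    by_cases hj : j = i
    · rwa [hj]
    · exact (hy j hj).le
  have hother : ∀ L ∈ elements S, ∀ᶠ y in 𝓝 x, y ∈ L → 0 ≤ b.coord i y := by
    intro L hL
    by_cases hxL : x ∈ L
    swap
    · filter_upwards [(isCompact_of_mem_elements hL).isClosed.isOpen_compl.mem_nhds hxL] with y hy hyL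
      exact (hy hyL).elim
    obtain ⟨t, ht, htc, rfl⟩ := hL
    by_cases hst : s = t
    · subst hst
      exact Eventually.of_forall fun y hy => (mem_convexHull_iff_coord hb).1 hy i
    obtain ⟨c, hc⟩ := exists_affineBasis ht htc
    obtain ⟨j, hj0, hjpos⟩ := exists_unique_coord_eq_zero ht htc hc hxL
      (hint _ ⟨t, ht, htc, rfl⟩) hxS
    have e1 := erase_eq_inter hs ht hsc htc hst hb hxs hxL hipos
    have e2 := erase_eq_inter ht hs htc hsc (Ne.symm hst) hc hxL hxs hjpos
    rw [Finset.inter_comm, e1] at e2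
    have hcoord := coord_eq_smul_coord hb hc e2
    have hne : c.coord j i ≠ 0 := by
      intro h0
      have := hcoord (c j)
      rw [c.coord_apply_eq, h0, zero_mul] at this
      exact one_ne_zero this
    -- A negative factor means that the elements lie on opposite sides of the facet and together
    -- fill a neighbourhood of `x`, which contradicts `x ∉ D`. A positive one puts the other element
    -- on the same side.
    rcases lt_or_gt_of_ne hne with hneg | hpos
    · refine (hxD ?_).elim
      rw [← hDr, mem_interior_iff_mem_nhds]
      filter_upwards [hsloc, eventually_coord_pos hjpos] with y hy1 hy2
      rcases le_total 0 (b.coord i y) with h | h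
      · exact hS.subset_closure ⟨s, hs, hsc, rfl⟩ (hy1 h)
      · refine hS.subset_closure ⟨t, ht, htc, rfl⟩ ((mem_convexHull_iff_coord hc).2 fun k => ?_)
        by_cases hk : k = j
        · rw [hk, hcoord]
          exact mul_nonneg_of_nonpos_of_nonpos hneg.le h
        · exact (hy2 k hk).le
    · refine Eventually.of_forall fun y hy => ?_
      have := (mem_convexHull_iff_coord hc).1 hy j
      rw [hcoord] at this
      exact nonneg_of_mul_nonneg_right this hpos
  have hloc : ∀ᶠ y in 𝓝 x, (y ∈ closure D ↔ 0 ≤ b.coord i y) := by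
    filter_upwards [hsloc, (eventually_all_finite hS.finite_elements).2 hother] with y h1 h2
    constructor
    · intro hy
      rw [hS.closure_eq] at hy
      obtain ⟨L, hL, hyL⟩ := hy
      exact h2 L hL hyL
    · exact fun h => hS.subset_closure ⟨s, hs, hsc, rfl⟩ (h1 h)
  set G := slope (b.coord i) with hG
  have hform : ∀ y z, b.coord i y = b.coord i z + inner ℝ G (y - z) := fun y z =>
    affine_apply_eq _ _ _
  have hG0 : G ≠ 0 := by
    intro h0
    have := hform (b i) x
    rw [b.coord_apply_eq, hi0, h0, inner_zero_left, add_zero] at this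
    exact one_ne_zero this
  have hGn : 0 < ‖G‖ := norm_pos_iff.2 hG0
  refine ⟨-(‖G‖⁻¹ • G), ?_, ?_⟩
  · rw [norm_neg, norm_smul, norm_inv, norm_norm, inv_mul_cancel₀ hGn.ne']
  · filter_upwards [hloc.eventually_nhds] with y hy
    have hsign : inner ℝ (-(‖G‖⁻¹ • G)) (y - x) < 0 ↔ 0 < b.coord i y := by
      rw [hform y x, hi0, zero_add, inner_neg_left, inner_smul_left, neg_lt_zero]
      simp [hGn]
    rw [hsign]
    have hcont : Continuous (b.coord i) := (b.coord i).continuous_of_finiteDimensional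
    constructor
    · intro hyD
      -- The local description concerns `closure D`; strict positivity on the open set `D` follows
      -- by a small move from `y` against the gradient `G`, which stays in `D` and lowers the
      -- coordinate.
      have h1 : ∀ᶠ z in 𝓝 y, 0 ≤ b.coord i z := by
        filter_upwards [hy, hDo.mem_nhds hyD] with z hz hzD
        exact hz.1 (_root_.subset_closure hzD)
      have h2 : Tendsto (fun r : ℝ => y - r • G) (𝓝[>] 0) (𝓝 y) := by
        have : Continuous fun r : ℝ => y - r • G := by fun_prop
        have h3 : Tendsto (fun r : ℝ => y - r • G) (𝓝 0) (𝓝 (y - (0 : ℝ) • G)) :=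
          this.continuousAt
        rw [zero_smul, sub_zero] at h3
        exact h3.mono_left nhdsWithin_le_nhds
      obtain ⟨r, hr, hr0⟩ := ((h2.eventually h1).and self_mem_nhdsWithin).exists
      rw [hform _ y] at hr
      have hr0 : (0 : ℝ) < r := hr0
      have e : inner ℝ G (y - r • G - y) = - (r * ‖G‖ ^ 2) := by
        rw [sub_sub_cancel_left, inner_neg_right, inner_smul_right, real_inner_self_eq_norm_sq]
      rw [e] at hr
      have : 0 < r * ‖G‖ ^ 2 := by positivity
      linarith
    · intro hpos
      rw [← hDr, mem_interior_iff_mem_nhds]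
      filter_upwards [hy, hcont.continuousAt.eventually (lt_mem_nhds hpos)] with z hz hz0
      exact hz.2 hz0.le

end Flat

end SCH

namespace SCH

/-! ### The distance to the complement -/

section Distance

variable {d : ℕ} {D : Set (E d)}

theorem exists_nearest (hDo : IsOpen D) (hne : Dᶜ.Nonempty) (x : E d) :
    ∃ p ∈ Dᶜ, Metric.infDist x Dᶜ = ‖x - p‖ := by
  obtain ⟨p, hp, h⟩ := hDo.isClosed_compl.exists_infDist_eq_dist hne x
  exact ⟨p, hp, by rw [h, dist_eq_norm]⟩

theorem infDist_compl_pos (hDo : IsOpen D) (hne : Dᶜ.Nonempty) {x : E d} (hx : x ∈ D) :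
    0 < Metric.infDist x Dᶜ := by
  rw [← hDo.isClosed_compl.notMem_iff_infDist_pos hne]
  exact fun h => h hx

theorem ball_infDist_subset (x : E d) : Metric.ball x (Metric.infDist x Dᶜ) ⊆ D := by
  intro y hy
  by_contra hyD
  exact absurd (Metric.infDist_le_dist_of_mem (x := x) hyD) (not_le.2 (by rwa [dist_comm]))

/-- The open ball about `x` of radius equal to the distance to the complement lies in `D`, and the
segment lies in its closure. -/
theorem segment_nearest_subset (hDo : IsOpen D) {x p : E d} (hx : x ∈ D) (hp : p ∈ Dᶜ)
    (h : Metric.infDist x Dᶜ = ‖x - p‖) : segment ℝ x p ⊆ closure D := by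
  have hpos := infDist_compl_pos hDo ⟨p, hp⟩ hx
  have hsub : segment ℝ x p ⊆ Metric.closedBall x (Metric.infDist x Dᶜ) := by
    refine (convex_closedBall x _).segment_subset (Metric.mem_closedBall_self hpos.le) ?_
    rw [h, mem_closedBall_iff_norm, norm_sub_rev]
  rw [← closure_ball x hpos.ne'] at hsub
  exact hsub.trans (closure_mono (ball_infDist_subset x))

/-- The function `y ↦ ‖y - p‖² - dist(y, Dᶜ)²` is nonnegative and vanishes at `x`, so its derivative
at this minimum is zero. Working with squares identifies the derivative of the distance without
dividing by it. -/
theorem infDist_mul_fderiv {x p : E d} (hp : p ∈ Dᶜ) (h : Metric.infDist x Dᶜ = ‖x - p‖)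
    (hd : DifferentiableAt ℝ (fun y => Metric.infDist y Dᶜ) x) (w : E d) :
    Metric.infDist x Dᶜ * fderiv ℝ (fun y => Metric.infDist y Dᶜ) x w = inner ℝ (x - p) w := by
  set ρ : E d → ℝ := fun y => Metric.infDist y Dᶜ with hρ
  have hmin : IsLocalMin (fun y => ‖y - p‖ ^ 2 - ρ y ^ 2) x := by
    refine Eventually.of_forall fun y => ?_
    have h1 : ρ y ≤ ‖y - p‖ := by
      rw [← dist_eq_norm]
      exact Metric.infDist_le_dist_of_mem hp
    have h2 : 0 ≤ ρ y := Metric.infDist_nonneg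
    have h3 : ρ x = ‖x - p‖ := h
    simp only [h3, sub_self]
    nlinarith
  have h1 : HasFDerivAt (fun y : E d => ‖y - p‖ ^ 2) (2 • (innerSL ℝ (x - p))) x := by
    simpa using ((hasFDerivAt_id x).sub_const p).norm_sq
  have h2 := h1.sub (hd.hasFDerivAt.pow 2)
  have h3 := hmin.hasFDerivAt_eq_zero h2
  have h4 := congrArg (fun φ => φ w) h3
  simp at h4
  rw [inner_sub_left]
  change ρ x * _ = _
  linarith

/-- A ball inside `D` that touches a flat boundary point must touch it along the normal. Otherwise a
small tangential step from `p`, in the direction of `w` or of `-w`, enters the ball and hence `D`,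
although it stays on the boundary hyperplane. -/
theorem inner_eq_zero_of_isOutwardNormal {x p ν w : E d} {r : ℝ}
    (hball : Metric.ball x r ⊆ D) (hr : ‖x - p‖ = r) (hν : IsOutwardNormal D p ν)
    (hw : inner ℝ w ν = 0) : inner ℝ (x - p) w = 0 := by
  have key : ∀ w : E d, inner ℝ w ν = 0 → ¬ 0 < inner ℝ (x - p) w := by
    intro w hw hpos
    have ht : Tendsto (fun s : ℝ => p + s • w) (𝓝[>] 0) (𝓝 p) := by
      have h1 : Continuous fun s : ℝ => p + s • w := by fun_prop
      have h2 : Tendsto (fun s : ℝ => p + s • w) (𝓝 0) (𝓝 (p + (0 : ℝ) • w)) := h1.continuousAt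
      rw [zero_smul, add_zero] at h2
      exact h2.mono_left nhdsWithin_le_nhds
    have hs : ∀ᶠ s : ℝ in 𝓝[>] 0, s * ‖w‖ ^ 2 < 2 * inner ℝ (x - p) w := by
      have h1 : Continuous fun s : ℝ => s * ‖w‖ ^ 2 := by fun_prop
      have h2 : Tendsto (fun s : ℝ => s * ‖w‖ ^ 2) (𝓝 0) (𝓝 (0 * ‖w‖ ^ 2)) := h1.continuousAt
      rw [zero_mul] at h2
      exact (h2.mono_left nhdsWithin_le_nhds).eventually (gt_mem_nhds (by linarith))
    obtain ⟨s, ⟨hs1, hs2⟩, hs0⟩ := (((ht.eventually hν.2).and hs).and self_mem_nhdsWithin).exists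
    have hs0 : (0 : ℝ) < s := hs0
    have hmem : p + s • w ∈ Metric.ball x r := by
      rw [mem_ball_iff_norm, ← hr, ← sq_lt_sq₀ (norm_nonneg _) (norm_nonneg _)]
      have e : p + s • w - x = -((x - p) - s • w) := by abel
      rw [e, norm_neg, norm_sub_sq_real, inner_smul_right, norm_smul, mul_pow, Real.norm_eq_abs,
        sq_abs]
      nlinarith
    have := hs1.1 (hball hmem)
    rw [add_sub_cancel_left, inner_smul_right, real_inner_comm, hw, mul_zero] at this
    exact lt_irrefl _ this
  refine le_antisymm (not_lt.1 (key w hw)) ?_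
  have := key (-w) (by rw [inner_neg_left, hw, neg_zero])
  rw [inner_neg_right] at this
  linarith

/-- A function that is Lipschitz along the segments in `closure D` and vanishes off `D` is
Lipschitz. -/
theorem exists_lipschitzWith_of_segment (hDo : IsOpen D) {f : E d → ℝ} {L : ℝ}
    (hL : ∀ x y, segment ℝ x y ⊆ closure D → |f x - f y| ≤ L * ‖x - y‖)
    (h0 : ∀ x, x ∉ D → f x = 0) : ∃ C, LipschitzWith C f := by
  have hL' : ∀ x y, segment ℝ x y ⊆ closure D → |f x - f y| ≤ |L| * ‖x - y‖ := fun x y h =>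
    (hL x y h).trans (by gcongr; exact le_abs_self L)
  -- Going from `x` to a nearest point of the complement, where `f` vanishes, bounds `f x` by the
  -- distance. A segment that leaves `D` is then treated by comparing both end values with the zero
  -- at a point off `D`.
  have hhalf : ∀ x z, z ∉ D → |f x| ≤ |L| * ‖x - z‖ := by
    intro x z hz
    by_cases hx : x ∈ D
    · obtain ⟨p, hp, h⟩ := exists_nearest hDo ⟨z, hz⟩ x
      have h1 := hL' x p (segment_nearest_subset hDo hx hp h)
      rw [h0 p hp, sub_zero] at h1
      refine h1.trans ?_
      gcongr
      rw [← h, ← dist_eq_norm]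
      exact Metric.infDist_le_dist_of_mem hz
    · rw [h0 x hx, abs_zero]
      positivity
  refine ⟨⟨2 * |L|, by positivity⟩, LipschitzWith.of_dist_le_mul fun x y => ?_⟩
  rw [dist_eq_norm, dist_eq_norm, Real.norm_eq_abs]
  change |f x - f y| ≤ 2 * |L| * ‖x - y‖
  by_cases hseg : segment ℝ x y ⊆ D
  · have := hL' x y (hseg.trans subset_closure)
    nlinarith [mul_nonneg (abs_nonneg L) (norm_nonneg (x - y))]
  · obtain ⟨z, hz, hzD⟩ := Set.not_subset.1 hseg
    have h1 := hhalf x z hzD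
    have h2 := hhalf y z hzD
    have h3 : ‖x - z‖ ≤ ‖x - y‖ := by
      have := norm_sub_le_of_mem_segment hz
      rwa [norm_sub_rev, norm_sub_rev y x] at this
    have h4 : ‖y - z‖ ≤ ‖x - y‖ := by
      rw [segment_symm] at hz
      have := norm_sub_le_of_mem_segment hz
      rwa [norm_sub_rev] at this
    have h5 := abs_sub (f x) (f y)
    nlinarith [mul_le_mul_of_nonneg_left h3 (abs_nonneg L),
      mul_le_mul_of_nonneg_left h4 (abs_nonneg L)]

/-- `f` is bounded on `closure D` and Lipschitz along the segments in `closure D`. -/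
def SegmentLipschitz (D : Set (E d)) (f : E d → ℝ) : Prop :=
  ∃ M L : ℝ, (∀ x ∈ closure D, |f x| ≤ M) ∧
    ∀ x y, segment ℝ x y ⊆ closure D → |f x - f y| ≤ L * ‖x - y‖

theorem SegmentLipschitz.mul {f g : E d → ℝ} (hf : SegmentLipschitz D f)
    (hg : SegmentLipschitz D g) : SegmentLipschitz D fun x => f x * g x := by
  obtain ⟨M, L, hM, hL⟩ := hf
  obtain ⟨M', L', hM', hL'⟩ := hg
  refine ⟨M * M', L * M' + M * L', fun x hx => ?_, fun x y hxy => ?_⟩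
  · rw [abs_mul]
    exact mul_le_mul (hM x hx) (hM' x hx) (abs_nonneg _) ((abs_nonneg _).trans (hM x hx))
  · have hx := hxy (left_mem_segment ℝ x y)
    have hy := hxy (right_mem_segment ℝ x y)
    have e : f x * g x - f y * g y = (f x - f y) * g x + f y * (g x - g y) := by ring
    rw [e]
    refine (abs_add_le _ _).trans ?_
    rw [abs_mul, abs_mul]
    have h1 := mul_le_mul (hL x y hxy) (hM' x hx) (abs_nonneg _) ((abs_nonneg _).trans (hL x y hxy))
    have h2 := mul_le_mul (hM y hy) (hL' x y hxy) (abs_nonneg _) ((abs_nonneg _).trans (hM y hy))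
    nlinarith

theorem segmentLipschitz_of_lipschitzOnWith {f : E d → ℝ} {C : ℝ≥0} (hDb : Bornology.IsBounded D)
    (hf : LipschitzOnWith C f (closure D)) : SegmentLipschitz D f := by
  obtain ⟨M, hM⟩ := hDb.isCompact_closure.exists_bound_of_continuousOn hf.continuousOn
  refine ⟨M, C, hM, fun x y hxy => ?_⟩
  have := hf.dist_le_mul x (hxy (left_mem_segment ℝ x y)) y (hxy (right_mem_segment ℝ x y))
  rwa [dist_eq_norm, dist_eq_norm] at this

theorem exists_lipschitzOnWith_of_contDiff {F : Type*} [NormedAddCommGroup F] [NormedSpace ℝ F]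
    {f : E d → F} (hf : ContDiff ℝ 1 f)
    {A : Set (E d)} (hA : Bornology.IsBounded A) : ∃ C : ℝ≥0, LipschitzOnWith C f A := by
  obtain ⟨R, hR⟩ := hA.subset_closedBall 0
  obtain ⟨C, hC⟩ := (isCompact_closedBall (0 : E d) R).exists_bound_of_continuousOn
    (hf.continuous_fderiv one_ne_zero).continuousOn
  refine ⟨C.toNNReal, LipschitzOnWith.mono ?_ hR⟩
  refine (convex_closedBall 0 R).lipschitzOnWith_of_nnnorm_fderiv_le
    (fun x _ => hf.differentiable one_ne_zero x) fun x hx => ?_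
  exact_mod_cast (hC x hx).trans (Real.le_coe_toNNReal C)

/-- A cutoff function that vanishes off `D` and equals one at distance `r` from the complement. -/
noncomputable def cutoff (D : Set (E d)) (r : ℝ) (x : E d) : ℝ := min 1 (r⁻¹ * Metric.infDist x Dᶜ)

theorem lipschitzWith_cutoff (D : Set (E d)) {r : ℝ} (hr : 0 < r) :
    LipschitzWith (Real.toNNReal r⁻¹) (cutoff D r) := by
  have h : LipschitzWith (Real.toNNReal r⁻¹) fun x => r⁻¹ * Metric.infDist x Dᶜ := by
    refine LipschitzWith.of_dist_le_mul fun x y => ?_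
    rw [Real.coe_toNNReal _ (by positivity), Real.dist_eq, ← mul_sub, abs_mul,
      abs_of_pos (by positivity : 0 < r⁻¹)]
    gcongr
    have := (Metric.lipschitz_infDist_pt Dᶜ).dist_le_mul x y
    simpa [Real.dist_eq] using this
  exact h.const_min 1

theorem cutoff_nonneg {r : ℝ} (hr : 0 < r) (x : E d) : 0 ≤ cutoff D r x :=
  le_min zero_le_one (mul_nonneg (by positivity) Metric.infDist_nonneg)

theorem cutoff_le_one (r : ℝ) (x : E d) : cutoff D r x ≤ 1 := min_le_left _ _

theorem cutoff_eq_zero {r : ℝ} {x : E d} (hx : x ∉ D) : cutoff D r x = 0 := by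
  have : Metric.infDist x Dᶜ = 0 := Metric.infDist_zero_of_mem hx
  simp [cutoff, this]

theorem tendsto_cutoff (hDo : IsOpen D) (hne : Dᶜ.Nonempty) {x : E d} (hx : x ∈ D) :
    Tendsto (fun r => cutoff D r x) (𝓝[>] 0) (𝓝 1) := by
  refine tendsto_const_nhds.congr' ?_
  filter_upwards [Ioo_mem_nhdsGT (infDist_compl_pos hDo hne hx)] with r hr
  rw [cutoff, min_eq_left]
  rw [inv_mul_eq_div, one_le_div hr.1]
  exact hr.2.le

/-- The cutoff attains its global maximum there. This includes the points at distance exactly `r`,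
where it may have a kink and `fderiv` is zero by default. -/
theorem fderiv_cutoff_of_le {r : ℝ} (hr : 0 < r) {x : E d} (h : r ≤ Metric.infDist x Dᶜ) :
    fderiv ℝ (cutoff D r) x = 0 := by
  refine IsLocalMax.fderiv_eq_zero (Eventually.of_forall fun y => ?_)
  have : cutoff D r x = 1 := by
    rw [cutoff, min_eq_left]
    rwa [inv_mul_eq_div, one_le_div hr]
  rw [this]
  exact cutoff_le_one r y

theorem fderiv_cutoff_of_lt {r : ℝ} (hr : 0 < r) {x : E d} (h : Metric.infDist x Dᶜ < r) :
    fderiv ℝ (cutoff D r) x = r⁻¹ • fderiv ℝ (fun y => Metric.infDist y Dᶜ) x := by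
  have : cutoff D r =ᶠ[𝓝 x] fun y => r⁻¹ • Metric.infDist y Dᶜ := by
    filter_upwards [(Metric.continuous_infDist_pt Dᶜ).continuousAt.eventually (gt_mem_nhds h)] with y hy
    rw [cutoff, min_eq_right, smul_eq_mul]
    rw [inv_mul_eq_div, div_le_one hr]
    exact hy.le
  rw [this.fderiv_eq]
  exact congrFun (fderiv_const_smul_field (f := fun y => Metric.infDist y Dᶜ) r⁻¹) x

end Distance

/-! ### The divergence theorem for tangential fields -/

section Divergence

variable {d : ℕ} {D : Set (E d)} {S : Geometry.SimplicialComplex ℝ (E d)}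

/-- The derivative of the cutoff along a tangential field is bounded near the flat part of the
boundary and of order `r⁻¹` near the skeleton. -/
theorem IsTriangulation.abs_fderiv_cutoff_le (hS : IsTriangulation D S) (hDo : IsOpen D)
    (hDr : interior (closure D) = D) (hne : Dᶜ.Nonempty) {X : E d → E d} (hXn : IsTangential D X)
    {L : ℝ≥0} (hL : LipschitzOnWith L X (closure D)) {M : ℝ} (hM : ∀ x ∈ closure D, ‖X x‖ ≤ M)
    {r : ℝ} (hr : 0 < r) {x : E d} (hx : x ∈ D)
    (hd : DifferentiableAt ℝ (fun y => Metric.infDist y Dᶜ) x) :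
    |fderiv ℝ (cutoff D r) x (X x)| ≤ {x | Metric.infDist x Dᶜ < r}.indicator (fun _ => (L : ℝ)) x +
      (Metric.thickening r (codimTwoSkeleton S)).indicator (fun _ => r⁻¹ * M) x := by
  have hM0 : 0 ≤ M := (norm_nonneg _).trans (hM x (_root_.subset_closure hx))
  have hi1 : 0 ≤ {x | Metric.infDist x Dᶜ < r}.indicator (fun _ => (L : ℝ)) x :=
    Set.indicator_nonneg (fun _ _ => L.2) x
  have hi2 : 0 ≤ (Metric.thickening r (codimTwoSkeleton S)).indicator (fun _ => r⁻¹ * M) x :=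
    Set.indicator_nonneg (fun _ _ => by positivity) x
  rcases le_or_gt r (Metric.infDist x Dᶜ) with h | h
  · rw [fderiv_cutoff_of_le hr h]
    simpa using add_nonneg hi1 hi2
  have hpos := infDist_compl_pos hDo hne hx
  obtain ⟨p, hp, hxp⟩ := exists_nearest hDo hne x
  have hfd := infDist_mul_fderiv hp hxp hd (X x)
  have hpc : p ∈ closure D := segment_nearest_subset hDo hx hp hxp (right_mem_segment ℝ x p)
  rw [fderiv_cutoff_of_lt hr h, smul_apply, smul_eq_mul, abs_mul,
    abs_of_pos (by positivity : 0 < r⁻¹)]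
  set ρ := Metric.infDist x Dᶜ with hρ
  set q := fderiv ℝ (fun y => Metric.infDist y Dᶜ) x (X x) with hq
  -- If the nearest point lies on the skeleton, the crude bound `‖X‖ / r` is enough, because `x` is
  -- then within `r` of the skeleton. Otherwise the boundary is flat at `p` and tangency applies.
  by_cases hps : p ∈ codimTwoSkeleton S
  · have hthick : x ∈ Metric.thickening r (codimTwoSkeleton S) :=
      Metric.mem_thickening_iff.2 ⟨p, hps, by rw [dist_eq_norm, ← hxp]; exact h⟩
    rw [Set.indicator_of_mem hthick]
    refine le_trans ?_ (le_add_of_nonneg_left hi1)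
    gcongr
    have h1 : ρ * |q| ≤ ρ * M := by
      rw [← abs_of_pos hpos, ← abs_mul, hfd, abs_of_pos hpos, hxp]
      exact (abs_real_inner_le_norm _ _).trans (by gcongr; exact hM x (_root_.subset_closure hx))
    exact le_of_mul_le_mul_left h1 hpos
  · have hpf : p ∈ frontier D := by
      rw [hDo.frontier_eq]
      exact ⟨hpc, hp⟩
    obtain ⟨ν, hν⟩ := hS.exists_isOutwardNormal hDo hDr hpf hps
    have h0 := inner_eq_zero_of_isOutwardNormal (ball_infDist_subset x) hxp.symm hν (hXn p ν hν)
    -- Since `X p` is orthogonal to `x - p`, only `X x - X p` contributes, which gains a second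
    -- factor `ρ`. The quotient `L ρ / r` is then at most `L`.
    have h1 : ρ * |q| ≤ ρ * (L * ρ) := by
      rw [← abs_of_pos hpos, ← abs_mul, hfd, abs_of_pos hpos]
      have e : inner ℝ (x - p) (X x) = inner ℝ (x - p) (X x - X p) := by
        rw [inner_sub_right, h0, sub_zero]
      rw [e]
      refine (abs_real_inner_le_norm _ _).trans ?_
      have := hL.dist_le_mul x (_root_.subset_closure hx) p hpc
      rw [dist_eq_norm, dist_eq_norm, ← hxp] at this
      rw [← hxp]
      gcongr
    have h2 := le_of_mul_le_mul_left h1 hpos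
    rw [Set.indicator_of_mem (show x ∈ {x | Metric.infDist x Dᶜ < r} from h)]
    refine le_trans ?_ (le_add_of_nonneg_right hi2)
    rw [inv_mul_eq_div, div_le_iff₀ hr]
    exact h2.trans (by gcongr)

/-- Equally spaced centres with gaps of at most `r` on the segment give a cover of the neighbourhood
by `⌈‖b - a‖ / r⌉ + 1` balls of radius `2r`. -/
theorem volume_thickening_segment_le (a b : E d) {r : ℝ} (hr : 0 < r) :
    volume.real (Metric.thickening r (segment ℝ a b)) ≤
      (‖b - a‖ / r + 2) * (volume.real (Metric.ball (0 : E d) 1) * (2 * r) ^ d) := by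
  set n := ⌈‖b - a‖ / r⌉₊ with hn
  have hsub : Metric.thickening r (segment ℝ a b) ⊆ ⋃ k ∈ Finset.range (n + 1),
      Metric.ball (AffineMap.lineMap a b ((k : ℝ) / n) : E d) (2 * r) := by
    intro y hy
    obtain ⟨z, hz, hyz⟩ := Metric.mem_thickening_iff.1 hy
    rw [segment_eq_image_lineMap] at hz
    obtain ⟨t, ht, rfl⟩ := hz
    have hk : ⌊t * n⌋₊ ≤ n := by
      apply Nat.floor_le_of_le
      nlinarith [ht.2, (Nat.cast_nonneg n : (0 : ℝ) ≤ n)]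
    refine Set.mem_iUnion₂.2 ⟨⌊t * n⌋₊, Finset.mem_range.2 (by omega), ?_⟩
    rw [Metric.mem_ball]
    have h1 : dist (AffineMap.lineMap a b t : E d) (AffineMap.lineMap a b ((⌊t * n⌋₊ : ℝ) / n)) ≤
        r := by
      rw [dist_lineMap_lineMap, Real.dist_eq, dist_comm, dist_eq_norm]
      -- For `n = 0` the segment is a point, and the value `k / 0 = 0` makes `a` the only centre.
      rcases Nat.eq_zero_or_pos n with h0 | h0
      · have : ‖b - a‖ / r ≤ 0 := Nat.ceil_eq_zero.1 h0
        have h2 : ‖b - a‖ = 0 := by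
          refine le_antisymm ?_ (norm_nonneg _)
          rwa [div_le_iff₀ hr, zero_mul] at this
        rw [h2, mul_zero]
        exact hr.le
      · have h0' : (0 : ℝ) < n := by exact_mod_cast h0
        have h3 : |t - (⌊t * n⌋₊ : ℝ) / n| ≤ 1 / n := by
          have e : t - (⌊t * n⌋₊ : ℝ) / n = (t * n - ⌊t * n⌋₊) / n := by field_simp
          rw [e, abs_div, abs_of_pos h0']
          gcongr
          have := Nat.floor_le (mul_nonneg ht.1 h0'.le)
          have := Nat.lt_floor_add_one (t * n)
          rw [abs_le]
          constructor <;> linarith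
        have h4 : ‖b - a‖ ≤ n * r := by
          rw [← div_le_iff₀ hr]
          exact Nat.le_ceil _
        calc |t - (⌊t * n⌋₊ : ℝ) / n| * ‖b - a‖ ≤ 1 / n * (n * r) := by gcongr
          _ = r := by field_simp
    have := dist_triangle y (AffineMap.lineMap a b t : E d)
      (AffineMap.lineMap a b ((⌊t * n⌋₊ : ℝ) / n))
    linarith
  have hball : ∀ c : E d, volume.real (Metric.ball c (2 * r)) =
      volume.real (Metric.ball (0 : E d) 1) * (2 * r) ^ d := by
    intro c
    rw [Measure.real, Measure.addHaar_ball_of_pos volume c (by positivity), ENNReal.toReal_mul,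
      ENNReal.toReal_ofReal (by positivity), mul_comm]
    simp [Measure.real]
  have hfin : volume (⋃ k ∈ Finset.range (n + 1),
      Metric.ball (AffineMap.lineMap a b ((k : ℝ) / n) : E d) (2 * r)) ≠ ⊤ := by
    refine ((Bornology.isBounded_biUnion_finset _).2 fun k _ => Metric.isBounded_ball).measure_lt_top.ne
  calc volume.real (Metric.thickening r (segment ℝ a b))
      ≤ volume.real (⋃ k ∈ Finset.range (n + 1),
          Metric.ball (AffineMap.lineMap a b ((k : ℝ) / n) : E d) (2 * r)) :=
        measureReal_mono hsub hfin
    _ ≤ ∑ k ∈ Finset.range (n + 1),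
          volume.real (Metric.ball (AffineMap.lineMap a b ((k : ℝ) / n) : E d) (2 * r)) :=
        measureReal_biUnion_finset_le _ _
    _ = (n + 1) * (volume.real (Metric.ball (0 : E d) 1) * (2 * r) ^ d) := by
        simp [hball]
    _ ≤ _ := by
        gcongr ?_ * _
        have := (Nat.ceil_lt_add_one (by positivity : 0 ≤ ‖b - a‖ / r)).le
        rw [← hn] at this
        linarith

/-- In dimension two these faces are vertices, in dimension three vertices and edges. A vertex is
treated as a degenerate segment. -/
theorem exists_segment_of_card_le (hd : d = 2 ∨ d = 3) {s : Finset (E d)} (hs : s.Nonempty)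
    (hc : s.card + 1 ≤ d) :
    ∃ a b : E d, convexHull ℝ (s : Set (E d)) = segment ℝ a b ∧ (d = 2 → a = b) := by
  have hpos := Finset.card_pos.2 hs
  have h12 : s.card = 1 ∨ (s.card = 2 ∧ d = 3) := by omega
  rcases h12 with h | ⟨h, h3⟩
  · obtain ⟨a, rfl⟩ := Finset.card_eq_one.1 h
    exact ⟨a, a, by simp, fun _ => rfl⟩
  · classical
    obtain ⟨a, b, -, rfl⟩ := Finset.card_eq_two.1 h
    refine ⟨a, b, by simp [convexHull_pair], fun h2 => by omega⟩

/-- The neighbourhood has volume of order `r²` both for a point in the plane and for a segment in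
space, so it is `o(r)`. -/
theorem tendsto_volume_thickening_segment (hd : d = 2 ∨ d = 3) (a b : E d) (hab : d = 2 → a = b) :
    Tendsto (fun r : ℝ => r⁻¹ * volume.real (Metric.thickening r (segment ℝ a b)))
      (𝓝[>] 0) (𝓝 0) := by
  set c := volume.real (Metric.ball (0 : E d) 1) with hc
  have hc0 : 0 ≤ c := measureReal_nonneg
  have hlim : Tendsto (fun r : ℝ => 8 * c * (‖b - a‖ * r + 2 * r + 2 * r ^ 2)) (𝓝[>] 0) (𝓝 0) := by
    have h1 : Continuous fun r : ℝ => 8 * c * (‖b - a‖ * r + 2 * r + 2 * r ^ 2) := by fun_prop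
    have h2 : Tendsto _ (𝓝 (0 : ℝ)) (𝓝 _) := h1.continuousAt
    simp only [mul_zero, add_zero, zero_pow two_ne_zero] at h2
    exact h2.mono_left nhdsWithin_le_nhds
  refine squeeze_zero' ?_ ?_ hlim
  · filter_upwards [self_mem_nhdsWithin] with r hr
    have hr : (0 : ℝ) < r := hr
    positivity
  · filter_upwards [self_mem_nhdsWithin] with r hr
    have hr : (0 : ℝ) < r := hr
    have hv := volume_thickening_segment_le a b hr
    rw [inv_mul_le_iff₀ hr]
    refine hv.trans ?_
    rw [← hc]
    rcases hd with rfl | rfl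
    · rw [hab rfl, sub_self, norm_zero, zero_div, zero_add, zero_mul, zero_add]
      nlinarith [mul_nonneg hc0 (pow_pos hr 3).le]
    · have e : (‖b - a‖ / r + 2) * (c * (2 * r) ^ 3) = 8 * c * (‖b - a‖ * r ^ 2 + 2 * r ^ 3) := by
        field_simp
        ring
      rw [e]
      nlinarith [mul_nonneg hc0 (pow_pos hr 2).le]

end Divergence

end SCH

namespace SCH

/-! ### Removing the cutoff in the divergence theorem -/

section Divergence

variable {d : ℕ} {D : Set (E d)} {S : Geometry.SimplicialComplex ℝ (E d)}

theorem IsTriangulation.tendsto_volume_thickening (hS : IsTriangulation D S)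
    (hd : d = 2 ∨ d = 3) :
    Tendsto (fun r : ℝ => r⁻¹ * volume.real (Metric.thickening r (codimTwoSkeleton S)))
      (𝓝[>] 0) (𝓝 0) := by
  have hfin : {s ∈ S.faces | s.card + 1 ≤ d}.Finite := hS.finite.subset fun s hs => hs.1
  have hlim : Tendsto (fun r : ℝ => ∑ s ∈ hfin.toFinset,
      r⁻¹ * volume.real (Metric.thickening r (convexHull ℝ (s : Set (E d))))) (𝓝[>] 0) (𝓝 0) := by
    have := tendsto_finsetSum (x := 𝓝[>] (0 : ℝ)) hfin.toFinset
      (f := fun (s : Finset (E d)) r => r⁻¹ * volume.real (Metric.thickening r (convexHull ℝ (s : Set (E d)))))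
      (a := fun _ => (0 : ℝ)) fun s hs => by
        have hs := hfin.mem_toFinset.1 hs
        obtain ⟨a, b, hab, h2⟩ := exists_segment_of_card_le hd
          (Geometry.SimplicialComplex.nonempty_of_mem_faces hs.1) hs.2
        rw [hab]
        exact tendsto_volume_thickening_segment hd a b h2
    simpa using this
  refine squeeze_zero' ?_ ?_ hlim
  · filter_upwards [self_mem_nhdsWithin] with r hr
    have hr : (0 : ℝ) < r := hr
    positivity
  · filter_upwards [self_mem_nhdsWithin] with r hr
    have hr : (0 : ℝ) < r := hr
    rw [← Finset.mul_sum]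
    gcongr
    have e : Metric.thickening r (codimTwoSkeleton S) =
        ⋃ s ∈ hfin.toFinset, Metric.thickening r (convexHull ℝ (s : Set (E d))) := by
      rw [codimTwoSkeleton, Metric.thickening_biUnion]
      simp
    rw [e]
    exact measureReal_biUnion_finset_le _ _

/-- A boundary point of `D` lies in some element but in the interior of none, so the frontier is
covered by the null frontiers of the elements. -/
theorem IsTriangulation.volume_frontier (hS : IsTriangulation D S) (hDo : IsOpen D)
    (hDr : interior (closure D) = D) : ∀ᵐ x : E d, x ∉ frontier D := by
  filter_upwards [hS.ae_notMem_frontier] with x hx hxf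
  have hxc : x ∈ ⋃₀ elements S := hS.closure_eq ▸ frontier_subset_closure hxf
  obtain ⟨K, hK, hxK⟩ := hxc
  refine hx K hK ⟨_root_.subset_closure hxK, fun hi => ?_⟩
  rw [hDo.frontier_eq] at hxf
  exact hxf.2 (hDr ▸ interior_mono (hS.subset_closure hK) hi)

theorem integral_lineDeriv_eq_zero {f : E d → ℝ} {C : ℝ≥0} (hf : LipschitzWith C f)
    (hc : HasCompactSupport f) (w : E d) : ∫ x, lineDeriv ℝ f x w = 0 := by
  have h := LipschitzWith.integral_lineDeriv_mul_eq (μ := volume)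
    (LipschitzWith.const (1 : ℝ) : LipschitzWith 0 fun _ : E d => (1 : ℝ)) hf hc (-w)
  simp only [neg_neg, mul_one] at h
  rw [← h]
  simp [lineDeriv]

theorem compl_nonempty_of_isBounded (hd : d = 2 ∨ d = 3) (hDb : Bornology.IsBounded D) :
    Dᶜ.Nonempty := by
  have : Nontrivial (E d) := by rcases hd with rfl | rfl <;> infer_instance
  rw [Set.nonempty_compl]
  rintro rfl
  exact NormedSpace.unbounded_univ ℝ (E d) hDb

theorem sum_coord_smul_single (w : E d) : ∑ i, w i • EuclideanSpace.single i (1 : ℝ) = w := by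
  ext j
  simp [Finset.sum_apply, Pi.single_apply]

/-- With the cutoff, each component of `χ f X`, where `χ` is the cutoff, vanishes off `D`, so it is
Lipschitz on the whole space with compact support and its partial derivatives integrate to zero.
Summing them gives the integral of `div(χ f X)`, in which `div X = 0` leaves just the two terms of
the integrand. -/
theorem IsTriangulation.integral_cutoff (hS : IsTriangulation D S) (hDo : IsOpen D)
    (hDb : Bornology.IsBounded D) (hDr : interior (closure D) = D) {X : E d → E d}
    (hX : ContDiff ℝ 1 X) (hXdiv : ∀ x ∈ D, divergence X x = 0) {f : E d → ℝ}
    (hf : SegmentLipschitz D f) (hfd : ∀ᵐ x ∂volume.restrict D, DifferentiableAt ℝ f x)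
    {r : ℝ} (hr : 0 < r) :
    ∫ x in D, (f x * fderiv ℝ (cutoff D r) x (X x) + cutoff D r x * fderiv ℝ f x (X x)) = 0 := by
  have hXi : ∀ i, ContDiff ℝ 1 fun x => X x i := fun i => by
    have := (EuclideanSpace.proj i : E d →L[ℝ] ℝ).contDiff (n := 1)
    exact this.comp hX
  let G : Fin d → E d → ℝ := fun i x => (cutoff D r x * f x) * X x i
  have hG0 : ∀ i x, x ∉ D → G i x = 0 := fun i x hx => by simp [G, cutoff_eq_zero hx]
  have hGlip : ∀ i, ∃ C, LipschitzWith C (G i) := fun i => by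
    obtain ⟨C, hC⟩ := exists_lipschitzOnWith_of_contDiff (hXi i) hDb.closure
    obtain ⟨M, L, -, hL⟩ := ((segmentLipschitz_of_lipschitzOnWith hDb
      (lipschitzWith_cutoff D hr).lipschitzOnWith).mul hf).mul
        (segmentLipschitz_of_lipschitzOnWith hDb hC)
    exact exists_lipschitzWith_of_segment hDo hL (hG0 i)
  have hGc : ∀ i, HasCompactSupport (G i) := fun i =>
    HasCompactSupport.intro hDb.isCompact_closure fun x hx =>
      hG0 i x fun h => hx (_root_.subset_closure h)
  have hcd : ∀ᵐ x : E d, DifferentiableAt ℝ (cutoff D r) x :=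
    (lipschitzWith_cutoff D hr).ae_differentiableAt
  have hint : ∀ i, IntegrableOn (fun x => lineDeriv ℝ (G i) x (EuclideanSpace.single i 1)) D := by
    intro i
    obtain ⟨C, hC⟩ := hGlip i
    exact ((hC.locallyIntegrable_lineDeriv (μ := volume) _).integrableOn_isCompact
      hDb.isCompact_closure).mono_set _root_.subset_closure
  have hzero : ∀ i, ∫ x in D, lineDeriv ℝ (G i) x (EuclideanSpace.single i 1) = 0 := by
    intro i
    obtain ⟨C, hC⟩ := hGlip i
    rw [setIntegral_eq_integral_of_ae_compl_eq_zero, integral_lineDeriv_eq_zero hC (hGc i)]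
    filter_upwards [hS.volume_frontier hDo hDr] with x hx hxD
    have hxc : x ∉ closure D := fun h => hx (by rw [hDo.frontier_eq]; exact ⟨h, hxD⟩)
    have hev : G i =ᶠ[𝓝 x] fun _ => 0 := by
      filter_upwards [isClosed_closure.isOpen_compl.mem_nhds hxc] with y hy
      exact hG0 i y fun h => hy (_root_.subset_closure h)
    rw [hev.lineDeriv_eq]
    simp [lineDeriv]
  calc ∫ x in D, (f x * fderiv ℝ (cutoff D r) x (X x) + cutoff D r x * fderiv ℝ f x (X x))
      = ∫ x in D, ∑ i, lineDeriv ℝ (G i) x (EuclideanSpace.single i 1) := by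
        refine integral_congr_ae ?_
        filter_upwards [hfd, ae_restrict_of_ae hcd, ae_restrict_mem hDo.measurableSet]
          with x hfx hcx hxD
        have hXx : DifferentiableAt ℝ X x := hX.differentiable one_ne_zero x
        have hXix : ∀ i, DifferentiableAt ℝ (fun x => X x i) x := fun i =>
          (hXi i).differentiable one_ne_zero x
        have hXif : ∀ i w, fderiv ℝ (fun x => X x i) x w = (fderiv ℝ X x w) i := fun i w => by
          have := ((EuclideanSpace.proj i : E d →L[ℝ] ℝ).hasFDerivAt.comp x
            hXx.hasFDerivAt).fderiv
          exact congrArg (fun φ => φ w) this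
        have hGd : ∀ i, lineDeriv ℝ (G i) x (EuclideanSpace.single i 1) =
            (f x * fderiv ℝ (cutoff D r) x (X x i • EuclideanSpace.single i 1) +
              cutoff D r x * fderiv ℝ f x (X x i • EuclideanSpace.single i 1)) +
            (cutoff D r x * f x) * (fderiv ℝ X x (EuclideanSpace.single i 1)) i := by
          intro i
          have h1 := (hcx.hasFDerivAt.mul hfx.hasFDerivAt).mul (hXix i).hasFDerivAt
          have h2 : lineDeriv ℝ (G i) x (EuclideanSpace.single i 1) = _ :=
            (h1.hasLineDerivAt (EuclideanSpace.single i 1)).lineDeriv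
          rw [h2]
          simp only [add_apply, smul_apply, smul_eq_mul,
            map_smul, hXif, Pi.mul_apply]
          ring
        simp_rw [hGd]
        rw [Finset.sum_add_distrib, Finset.sum_add_distrib, ← Finset.mul_sum, ← Finset.mul_sum,
          ← Finset.mul_sum, ← map_sum, ← map_sum, sum_coord_smul_single]
        have := hXdiv x hxD
        rw [divergence] at this
        rw [this, mul_zero, add_zero]
    _ = ∑ i, ∫ x in D, lineDeriv ℝ (G i) x (EuclideanSpace.single i 1) :=
        integral_finsetSum _ fun i _ => hint i
    _ = 0 := by simp [hzero]

theorem inner_gradient_eq_fderiv (g : E d → ℝ) (x w : E d) :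
    inner ℝ (gradient g x) w = fderiv ℝ g x w := by
  rw [gradient, InnerProductSpace.toDual_symm_apply]

/-- The integral of the derivative of a function along a divergence-free tangential field
vanishes. -/
theorem IsTriangulation.integral_fderiv_tangential (hS : IsTriangulation D S)
    (hd : d = 2 ∨ d = 3) (hDo : IsOpen D)
    (hDb : Bornology.IsBounded D) (hDr : interior (closure D) = D) {X : E d → E d}
    (hX : ContDiff ℝ 1 X) (hXdiv : ∀ x ∈ D, divergence X x = 0) (hXn : IsTangential D X)
    {f : E d → ℝ} (hf : SegmentLipschitz D f) (hfm : Measurable f)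
    (hfd : ∀ᵐ x ∂volume.restrict D, DifferentiableAt ℝ f x) {B : ℝ}
    (hfb : ∀ᵐ x ∂volume.restrict D, ‖fderiv ℝ f x‖ ≤ B) :
    ∫ x in D, fderiv ℝ f x (X x) = 0 := by
  have hne := compl_nonempty_of_isBounded hd hDb
  have hfin : IsFiniteMeasure (volume.restrict D) := ⟨by simpa using hDb.measure_lt_top⟩
  obtain ⟨L, hL⟩ := exists_lipschitzOnWith_of_contDiff hX hDb.closure
  obtain ⟨M, hM⟩ := hDb.isCompact_closure.exists_bound_of_continuousOn hX.continuous.continuousOn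
  obtain ⟨A, -, hA, -⟩ := id hf
  have hDm := hDo.measurableSet
  have hXm : Measurable X := hX.continuous.measurable
  have happ : ∀ g : E d → ℝ, Measurable fun x => fderiv ℝ g x (X x) := fun g => by
    simp_rw [← inner_gradient_eq_fderiv]
    exact (measurable_gradient g).inner hXm
  have hρm : Measurable fun x : E d => Metric.infDist x Dᶜ :=
    (Metric.continuous_infDist_pt Dᶜ).measurable
  have hcm : ∀ r, Measurable (cutoff D r) := fun r => measurable_const.min (hρm.const_mul _)
  have hbd : ∀ᵐ x ∂volume.restrict D, ‖fderiv ℝ f x (X x)‖ ≤ B * M := by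
    filter_upwards [hfb, ae_restrict_mem hDm] with x hx hxD
    refine (ContinuousLinearMap.le_opNorm _ _).trans ?_
    exact mul_le_mul hx (hM x (_root_.subset_closure hxD)) (norm_nonneg _) ((norm_nonneg _).trans hx)
  have hlim1 : Tendsto (fun r => ∫ x in D, cutoff D r x * fderiv ℝ f x (X x)) (𝓝[>] 0)
      (𝓝 (∫ x in D, fderiv ℝ f x (X x))) := by
    refine tendsto_integral_filter_of_dominated_convergence (fun _ => B * M) ?_ ?_
      (integrable_const _) ?_
    · exact Eventually.of_forall fun r => ((hcm r).mul (happ f)).aestronglyMeasurable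
    · filter_upwards [self_mem_nhdsWithin] with r hr
      filter_upwards [hbd] with x hx
      rw [norm_mul, Real.norm_of_nonneg (cutoff_nonneg hr x)]
      exact (mul_le_of_le_one_left (norm_nonneg _) (cutoff_le_one r x)).trans hx
    · filter_upwards [ae_restrict_mem hDm] with x hx
      simpa using (tendsto_cutoff hDo hne hx).mul_const (fderiv ℝ f x (X x))
  let bound : ℝ → E d → ℝ := fun r x =>
    {x | Metric.infDist x Dᶜ < r}.indicator (fun _ => (L : ℝ)) x +
      (Metric.thickening r (codimTwoSkeleton S)).indicator (fun _ => r⁻¹ * M) x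
  have hm1 : ∀ r, MeasurableSet {x : E d | Metric.infDist x Dᶜ < r} := fun r =>
    measurableSet_lt hρm measurable_const
  have hm2 : ∀ r, MeasurableSet (Metric.thickening r (codimTwoSkeleton S)) := fun r =>
    Metric.isOpen_thickening.measurableSet
  have hi1 : ∀ r, Integrable ({x : E d | Metric.infDist x Dᶜ < r}.indicator (fun _ => (L : ℝ)))
      (volume.restrict D) := fun r => (integrable_const _).indicator (hm1 r)
  have hi2 : ∀ r, Integrable ((Metric.thickening r (codimTwoSkeleton S)).indicator
      (fun _ => r⁻¹ * M)) (volume.restrict D) := fun r => (integrable_const _).indicator (hm2 r)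
  have hρd : ∀ᵐ x : E d, DifferentiableAt ℝ (fun y => Metric.infDist y Dᶜ) x :=
    (Metric.lipschitz_infDist_pt Dᶜ).ae_differentiableAt
  have hptb : ∀ r, 0 < r → ∀ᵐ x ∂volume.restrict D,
      ‖f x * fderiv ℝ (cutoff D r) x (X x)‖ ≤ A * bound r x := by
    intro r hr
    filter_upwards [ae_restrict_of_ae hρd, ae_restrict_mem hDm] with x hx hxD
    rw [norm_mul]
    exact mul_le_mul (hA x (_root_.subset_closure hxD))
      (hS.abs_fderiv_cutoff_le hDo hDr hne hXn hL hM hr hxD hx) (norm_nonneg _)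
      ((abs_nonneg _).trans (hA x (_root_.subset_closure hxD)))
  -- The strips `{dist < r}` shrink to nothing inside `D`, which disposes of the bounded part by
  -- dominated convergence. The part of size `r⁻¹` lives on a set of volume `o(r)`.
  have hlimb : Tendsto (fun r => ∫ x in D, A * bound r x) (𝓝[>] 0) (𝓝 0) := by
    have e : ∀ r, ∫ x in D, A * bound r x =
        A * ((∫ x in D, {x : E d | Metric.infDist x Dᶜ < r}.indicator (fun _ => (L : ℝ)) x) +
          ∫ x in D, (Metric.thickening r (codimTwoSkeleton S)).indicator (fun _ => r⁻¹ * M) x) := by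
      intro r
      rw [integral_const_mul, ← integral_add (hi1 r) (hi2 r)]
    simp_rw [e]
    have l1 : Tendsto (fun r => ∫ x in D,
        {x : E d | Metric.infDist x Dᶜ < r}.indicator (fun _ => (L : ℝ)) x) (𝓝[>] 0) (𝓝 0) := by
      suffices h : Tendsto (fun r => ∫ x in D,
          {x : E d | Metric.infDist x Dᶜ < r}.indicator (fun _ => (L : ℝ)) x) (𝓝[>] 0)
          (𝓝 (∫ x in D, (0 : ℝ))) by simpa using h
      refine tendsto_integral_filter_of_dominated_convergence (fun _ => (L : ℝ)) ?_ ?_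
        (integrable_const _) ?_
      · exact Eventually.of_forall fun r => (hi1 r).aestronglyMeasurable
      · refine Eventually.of_forall fun r => ae_of_all _ fun x => ?_
        refine (norm_indicator_le_norm_self _ _).trans ?_
        simp
      · filter_upwards [ae_restrict_mem hDm] with x hx
        refine tendsto_const_nhds.congr' ?_
        filter_upwards [Ioo_mem_nhdsGT (infDist_compl_pos hDo hne hx)] with r hr
        rw [Set.indicator_of_notMem]
        exact fun h => absurd hr.2 (not_lt.2 (le_of_lt h))
    have l2 : Tendsto (fun r => ∫ x in D,
        (Metric.thickening r (codimTwoSkeleton S)).indicator (fun _ => r⁻¹ * M) x)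
        (𝓝[>] 0) (𝓝 0) := by
      have h3 := (hS.tendsto_volume_thickening hd).mul_const |M|
      rw [zero_mul] at h3
      refine squeeze_zero_norm' ?_ h3
      filter_upwards [self_mem_nhdsWithin] with r hr
      have hr : (0 : ℝ) < r := hr
      rw [integral_indicator (hm2 r), setIntegral_const, Measure.real,
        Measure.restrict_apply (hm2 r), smul_eq_mul, norm_mul, norm_mul, Real.norm_eq_abs,
        Real.norm_eq_abs, Real.norm_eq_abs, abs_of_pos (by positivity : 0 < r⁻¹),
        abs_of_nonneg ENNReal.toReal_nonneg]
      have hb : Bornology.IsBounded (codimTwoSkeleton S) := by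
        refine hDb.closure.subset ?_
        rw [← hS.space_eq]
        exact Set.iUnion₂_subset fun s hs => S.convexHull_subset_space hs.1
      have h4 : (volume (Metric.thickening r (codimTwoSkeleton S) ∩ D)).toReal ≤
          volume.real (Metric.thickening r (codimTwoSkeleton S)) :=
        ENNReal.toReal_mono hb.thickening.measure_lt_top.ne (measure_mono Set.inter_subset_left)
      calc _ = (r⁻¹ * (volume (Metric.thickening r (codimTwoSkeleton S) ∩ D)).toReal) * |M| := by
            ring
        _ ≤ _ := by gcongr
    simpa using (l1.add l2).const_mul A
  have hi3 : ∀ r, 0 < r →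
      Integrable (fun x => f x * fderiv ℝ (cutoff D r) x (X x)) (volume.restrict D) := by
    intro r hr
    exact (((hi1 r).add (hi2 r)).const_mul A).mono' (hfm.mul (happ _)).aestronglyMeasurable
      (hptb r hr)
  have hi4 : ∀ r, 0 < r →
      Integrable (fun x => cutoff D r x * fderiv ℝ f x (X x)) (volume.restrict D) := by
    intro r hr
    refine Integrable.of_bound ((hcm r).mul (happ f)).aestronglyMeasurable (B * M) ?_
    filter_upwards [hbd] with x hx
    rw [norm_mul, Real.norm_of_nonneg (cutoff_nonneg hr x)]
    exact (mul_le_of_le_one_left (norm_nonneg _) (cutoff_le_one r x)).trans hx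
  have hlim2 : Tendsto (fun r => ∫ x in D, cutoff D r x * fderiv ℝ f x (X x)) (𝓝[>] 0) (𝓝 0) := by
    refine squeeze_zero_norm' ?_ hlimb
    filter_upwards [self_mem_nhdsWithin] with r hr
    have hz := hS.integral_cutoff hDo hDb hDr hX hXdiv hf hfd hr
    rw [integral_add (hi3 r hr) (hi4 r hr)] at hz
    rw [eq_neg_of_add_eq_zero_right hz, norm_neg]
    exact norm_integral_le_of_norm_le (((hi1 r).add (hi2 r)).const_mul A) (hptb r hr)
  -- By the identity with cutoff, the integral with `χ` in front equals minus the boundary-layer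
  -- term. It therefore tends to zero, and also to the integral without cutoff.
  exact tendsto_nhds_unique hlim1 hlim2

end Divergence

end SCH

namespace SCH

/-! ### The finite element space as a vector space -/

section FiniteElementSpace

variable {d : ℕ} {D : Set (E d)} {S : Geometry.SimplicialComplex ℝ (E d)} {X : E d → E d}

theorem continuous_gradient {φ : E d → ℝ} (hφ : ContDiff ℝ (⊤ : ℕ∞) φ) :
    Continuous (gradient φ) := by
  unfold gradient
  exact (LinearIsometryEquiv.continuous _).comp (hφ.continuous_fderiv (by simp))

theorem hasCompactSupport_gradient {φ : E d → ℝ} (hc : HasCompactSupport φ) :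
    HasCompactSupport (gradient φ) := by
  unfold gradient
  exact (hc.fderiv ℝ).comp_left (map_zero _)

theorem integrable_smul_gradient {v φ : E d → ℝ} (hv : MemLp v 2 (volume.restrict D))
    (hφ : ContDiff ℝ (⊤ : ℕ∞) φ) (hc : HasCompactSupport φ) :
    Integrable (fun x => v x • gradient φ x) (volume.restrict D) := by
  have h1 : MemLp (gradient φ) 2 (volume.restrict D) :=
    ((continuous_gradient hφ).memLp_of_hasCompactSupport (hasCompactSupport_gradient hc)).restrict D
  exact memLp_one_iff_integrable.1 (h1.smul (p := 2) (q := 2) (r := 1) hv)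

theorem integrable_smul_of_memLp {φ : E d → ℝ} {G : E d → E d}
    (hG : MemLp G 2 (volume.restrict D)) (hφ : ContDiff ℝ (⊤ : ℕ∞) φ) (hc : HasCompactSupport φ) :
    Integrable (fun x => φ x • G x) (volume.restrict D) := by
  have h1 : MemLp φ 2 (volume.restrict D) := (hφ.continuous.memLp_of_hasCompactSupport hc).restrict D
  exact memLp_one_iff_integrable.1 (hG.smul (p := 2) (q := 2) (r := 1) h1)

theorem MemH1.add {v w : E d → ℝ} (hv : MemH1 D v) (hw : MemH1 D w) : MemH1 D (v + w) := by
  obtain ⟨hv, G, hG, hvG⟩ := hv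
  obtain ⟨hw, H, hH, hwH⟩ := hw
  refine ⟨hv.add hw, G + H, hG.add hH, fun φ hφ hc hs => ?_⟩
  simp only [Pi.add_apply, add_smul, smul_add]
  rw [integral_add (integrable_smul_gradient hv hφ hc) (integrable_smul_gradient hw hφ hc),
    integral_add (integrable_smul_of_memLp hG hφ hc) (integrable_smul_of_memLp hH hφ hc),
    hvG φ hφ hc hs, hwH φ hφ hc hs, neg_add]

theorem MemH1.const_smul {v : E d → ℝ} (hv : MemH1 D v) (c : ℝ) : MemH1 D (c • v) := by
  obtain ⟨hv, G, hG, hvG⟩ := hv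
  refine ⟨hv.const_smul c, c • G, hG.const_smul c, fun φ hφ hc hs => ?_⟩
  have e1 : ∀ x, (c • v) x • gradient φ x = c • (v x • gradient φ x) := fun x => by
    simp [mul_smul]
  have e2 : ∀ x, φ x • (c • G) x = c • (φ x • G x) := fun x => by
    simp [smul_comm c]
  simp_rw [e1, e2]
  rw [integral_smul, integral_smul, hvG φ hφ hc hs, smul_neg]

/-- The finite element space as a vector space. -/
def femSpace (D : Set (E d)) (S : Geometry.SimplicialComplex ℝ (E d)) : Submodule ℝ (E d → ℝ) where
  carrier := Vh D S
  zero_mem' := by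
    refine ⟨⟨MemLp.zero, 0, MemLp.zero, fun φ _ _ _ => by simp⟩, fun _ _ => rfl,
      fun K _ => ⟨0, fun x _ => by simp⟩⟩
  add_mem' := by
    rintro v w ⟨hv1, hv2, hv3⟩ ⟨hw1, hw2, hw3⟩
    refine ⟨hv1.add hw1, fun x hx => by simp [hv2 x hx, hw2 x hx], fun K hK => ?_⟩
    obtain ⟨p, hp⟩ := hv3 K hK
    obtain ⟨q, hq⟩ := hw3 K hK
    exact ⟨p + q, fun x hx => by simp [hp hx, hq hx]⟩
  smul_mem' := by
    rintro c v ⟨hv1, hv2, hv3⟩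
    refine ⟨hv1.const_smul c, fun x hx => by simp [hv2 x hx], fun K hK => ?_⟩
    obtain ⟨p, hp⟩ := hv3 K hK
    exact ⟨c • p, fun x hx => by simp [hp hx]⟩

theorem integral_gradient_eq_zero {φ : E d → ℝ} (hφ : ContDiff ℝ (⊤ : ℕ∞) φ)
    (hc : HasCompactSupport φ) : ∫ x, gradient φ x = 0 := by
  have hint : Integrable (gradient φ) :=
    (continuous_gradient hφ).integrable_of_hasCompactSupport (hasCompactSupport_gradient hc)
  obtain ⟨C, hC⟩ := hφ.lipschitzWith_of_hasCompactSupport hc (by simp)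
  refine ext_inner_left ℝ fun w => ?_
  rw [← integral_inner hint, inner_zero_right, ← integral_lineDeriv_eq_zero hC hc w]
  refine integral_congr_ae (ae_of_all _ fun x => ?_)
  have hd : DifferentiableAt ℝ φ x := hφ.differentiable (by simp) x
  simp only [real_inner_comm (gradient φ x) w, inner_gradient_eq_fderiv, hd.lineDeriv_eq_fderiv]

/-- The constant function one on `closure D`, extended by zero. -/
noncomputable def unitFun (D : Set (E d)) : E d → ℝ := (closure D).indicator fun _ => 1

theorem IsTriangulation.unitFun_mem (hS : IsTriangulation D S) (hDo : IsOpen D)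
    (hDb : Bornology.IsBounded D) : unitFun D ∈ Vh D S := by
  have hfin : IsFiniteMeasure (volume.restrict D) := ⟨by simpa using hDb.measure_lt_top⟩
  refine ⟨⟨?_, 0, MemLp.zero, fun φ hφ hc hs => ?_⟩, fun x hx => by simp [unitFun, hx],
    fun K hK => ⟨AffineMap.const ℝ (E d) 1, fun x hx => ?_⟩⟩
  · exact (memLp_const 1).indicator isClosed_closure.measurableSet
  · have e : ∫ x in D, unitFun D x • gradient φ x = ∫ x in D, gradient φ x := by
      refine setIntegral_congr_fun hDo.measurableSet fun x hx => ?_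
      simp [unitFun, _root_.subset_closure hx]
    rw [e, setIntegral_eq_integral_of_forall_compl_eq_zero, integral_gradient_eq_zero hφ hc]
    · simp
    · intro x hx
      have hx' : x ∉ tsupport φ := fun h => hx (hs h)
      have : φ =ᶠ[𝓝 x] 0 := notMem_tsupport_iff_eventuallyEq.1 hx'
      rw [gradient, this.fderiv_eq]
      simp
  · simp [unitFun, hS.subset_closure hK hx]

/-- A triangulation of a polyhedral domain. -/
structure IsPolyhedral (D : Set (E d)) (S : Geometry.SimplicialComplex ℝ (E d)) : Prop where
  tri : IsTriangulation D S
  isOpen : IsOpen D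
  isBounded : Bornology.IsBounded D

namespace IsPolyhedral

theorem isFiniteMeasure (h : IsPolyhedral D S) : IsFiniteMeasure (volume.restrict D) :=
  ⟨by simpa using h.isBounded.measure_lt_top⟩

/-- The constant function one as an element of the finite element space. -/
noncomputable def one (h : IsPolyhedral D S) : femSpace D S :=
  ⟨unitFun D, h.tri.unitFun_mem h.isOpen h.isBounded⟩

theorem memLp_coe (v : femSpace D S) : MemLp (v : E d → ℝ) 2 (volume.restrict D) := v.2.1.1

theorem memLp_gradient (h : IsPolyhedral D S) (v : femSpace D S) :
    MemLp (gradient (v : E d → ℝ)) 2 (volume.restrict D) := by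
  have := h.isFiniteMeasure
  obtain ⟨M, hM⟩ := h.tri.exists_gradient_bound h.isOpen.measurableSet v.2
  exact MemLp.of_bound (measurable_gradient _).aestronglyMeasurable M hM

theorem memLp_gradDot (h : IsPolyhedral D S) (hX : Continuous X) (v : femSpace D S) :
    MemLp (gradDot X (v : E d → ℝ)) 2 (volume.restrict D) := by
  have := h.isFiniteMeasure
  obtain ⟨M, hM⟩ := h.isBounded.isCompact_closure.exists_bound_of_continuousOn hX.continuousOn
  refine (h.memLp_gradient v).of_le_mul (c := M)
    ((measurable_gradient _).inner hX.measurable).aestronglyMeasurable ?_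
  filter_upwards [ae_restrict_mem h.isOpen.measurableSet] with x hx
  rw [mul_comm]
  exact (norm_inner_le_norm _ _).trans (by gcongr; exact hM x (subset_closure hx))

theorem gradient_add_ae (h : IsPolyhedral D S) (v w : femSpace D S) :
    ∀ᵐ x ∂volume.restrict D, gradient ((v + w : femSpace D S) : E d → ℝ) x =
      gradient (v : E d → ℝ) x + gradient (w : E d → ℝ) x := by
  filter_upwards [h.tri.ae_differentiableAt h.isOpen.measurableSet v.2,
    h.tri.ae_differentiableAt h.isOpen.measurableSet w.2] with x hv hw
  rw [gradient, gradient, gradient, ← map_add, ← fderiv_add hv hw]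
  rfl

theorem gradient_smul (c : ℝ) (v : femSpace D S) (x : E d) :
    gradient ((c • v : femSpace D S) : E d → ℝ) x = c • gradient (v : E d → ℝ) x := by
  have e : fderiv ℝ ((c • v : femSpace D S) : E d → ℝ) x = c • fderiv ℝ (v : E d → ℝ) x :=
    congrFun (fderiv_const_smul_field (f := (v : E d → ℝ)) c) x
  rw [gradient, gradient, e, map_smul]

/-- The embedding of the finite element space into `L²(D)`. -/
noncomputable def val (_ : IsPolyhedral D S) : femSpace D S →ₗ[ℝ] Lp ℝ 2 (volume.restrict D) where
  toFun v := (memLp_coe v).toLp v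
  map_add' _ _ := rfl
  map_smul' _ _ := rfl

/-- The gradient as a map into `L²(D)`. -/
noncomputable def grad (h : IsPolyhedral D S) :
    femSpace D S →ₗ[ℝ] Lp (E d) 2 (volume.restrict D) where
  toFun v := (h.memLp_gradient v).toLp _
  map_add' v w := by
    rw [← MemLp.toLp_add, MemLp.toLp_eq_toLp_iff]
    exact h.gradient_add_ae v w
  map_smul' c v := by
    rw [RingHom.id_apply, ← MemLp.toLp_const_smul, MemLp.toLp_eq_toLp_iff]
    exact ae_of_all _ fun x => gradient_smul c v x

/-- The derivative along a vector field as a map into `L²(D)`. -/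
noncomputable def gradX (h : IsPolyhedral D S) (hX : Continuous X) :
    femSpace D S →ₗ[ℝ] Lp ℝ 2 (volume.restrict D) where
  toFun v := (h.memLp_gradDot hX v).toLp _
  map_add' v w := by
    rw [← MemLp.toLp_add, MemLp.toLp_eq_toLp_iff]
    filter_upwards [h.gradient_add_ae v w] with x hx
    rw [Pi.add_apply, gradDot, gradDot, gradDot, hx, inner_add_left]
  map_smul' c v := by
    rw [RingHom.id_apply, ← MemLp.toLp_const_smul, MemLp.toLp_eq_toLp_iff]
    refine ae_of_all _ fun x => ?_
    rw [Pi.smul_apply, gradDot, gradDot, gradient_smul, inner_smul_left, smul_eq_mul]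
    rfl

theorem toLp_eq_zero_iff {F : Type*} [NormedAddCommGroup F] {f : E d → F}
    (hf : MemLp f 2 (volume.restrict D)) : hf.toLp f = 0 ↔ f =ᵐ[volume.restrict D] 0 := by
  rw [Lp.eq_zero_iff_ae_eq_zero]
  exact ⟨fun h => hf.coeFn_toLp.symm.trans h, fun h => hf.coeFn_toLp.trans h⟩

theorem inner_toLp {F : Type*} [NormedAddCommGroup F] [InnerProductSpace ℝ F] {f g : E d → F}
    (hf : MemLp f 2 (volume.restrict D)) (hg : MemLp g 2 (volume.restrict D)) :
    inner ℝ (hf.toLp f) (hg.toLp g) = ∫ x in D, inner ℝ (f x) (g x) := by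
  rw [L2.inner_def]
  refine integral_congr_ae ?_
  filter_upwards [hf.coeFn_toLp, hg.coeFn_toLp] with x h1 h2
  rw [h1, h2]

theorem inner_toLp_real {f g : E d → ℝ}
    (hf : MemLp f 2 (volume.restrict D)) (hg : MemLp g 2 (volume.restrict D)) :
    inner ℝ (hf.toLp f) (hg.toLp g) = ip D f g := by
  rw [inner_toLp, ip]
  simp only [RCLike.inner_apply, conj_trivial, mul_comm]

theorem ip_eq (h : IsPolyhedral D S) (v w : femSpace D S) :
    ip D v w = inner ℝ (h.val v) (h.val w) :=
  (inner_toLp_real (memLp_coe v) (memLp_coe w)).symm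

theorem gradIp_eq (h : IsPolyhedral D S) (v w : femSpace D S) :
    gradIp D v w = inner ℝ (h.grad v) (h.grad w) :=
  (inner_toLp (h.memLp_gradient v) (h.memLp_gradient w)).symm

theorem gradNormSq_eq (h : IsPolyhedral D S) (v : femSpace D S) :
    gradNormSq D v = ‖h.grad v‖ ^ 2 := by
  rw [← real_inner_self_eq_norm_sq, ← gradIp_eq, gradNormSq, gradIp]
  simp only [real_inner_self_eq_norm_sq]

theorem ip_gradDot_gradDot_eq (h : IsPolyhedral D S) (hX : Continuous X) (v w : femSpace D S) :
    ip D (gradDot X v) (gradDot X w) = inner ℝ (h.gradX hX v) (h.gradX hX w) :=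
  (inner_toLp_real (h.memLp_gradDot hX v) (h.memLp_gradDot hX w)).symm

theorem ip_gradDot_eq (h : IsPolyhedral D S) (hX : Continuous X) (v w : femSpace D S) :
    ip D (gradDot X v) w = inner ℝ (h.gradX hX v) (h.val w) :=
  (inner_toLp_real (h.memLp_gradDot hX v) (memLp_coe w)).symm

theorem ip_mul_const (f g : E d → ℝ) (c : ℝ) : ip D (fun x => f x * c) g = c * ip D f g := by
  rw [ip, ip, ← integral_const_mul]
  exact integral_congr_ae (ae_of_all _ fun x => by ring)

theorem ip_one (h : IsPolyhedral D S) (f : E d → ℝ) : ip D f h.one = ∫ x in D, f x := by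
  refine setIntegral_congr_fun h.isOpen.measurableSet fun x hx => ?_
  simp [one, unitFun, subset_closure hx]

theorem gradient_one (h : IsPolyhedral D S) {x : E d} (hx : x ∈ D) :
    gradient (h.one : E d → ℝ) x = 0 := by
  have : (h.one : E d → ℝ) =ᶠ[𝓝 x] fun _ => 1 := by
    filter_upwards [h.isOpen.mem_nhds hx] with y hy
    simp [one, unitFun, subset_closure hy]
  rw [gradient, this.fderiv_eq]
  simp

theorem grad_one (h : IsPolyhedral D S) : h.grad h.one = 0 := by
  change (h.memLp_gradient h.one).toLp _ = 0
  rw [toLp_eq_zero_iff]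
  filter_upwards [ae_restrict_mem h.isOpen.measurableSet] with x hx
  exact h.gradient_one hx

theorem gradX_one (h : IsPolyhedral D S) (hX : Continuous X) : h.gradX hX h.one = 0 := by
  change (h.memLp_gradDot hX h.one).toLp _ = 0
  rw [toLp_eq_zero_iff]
  filter_upwards [ae_restrict_mem h.isOpen.measurableSet] with x hx
  simp [gradDot, h.gradient_one hx]

theorem norm_gradX_le (h : IsPolyhedral D S) (hX : Continuous X) {C : ℝ}
    (hC : ∀ x ∈ closure D, ‖X x‖ ≤ C) (v : femSpace D S) : ‖h.gradX hX v‖ ≤ C * ‖h.grad v‖ := by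
  refine Lp.norm_le_mul_norm_of_ae_le_mul ?_
  filter_upwards [(h.memLp_gradDot hX v).coeFn_toLp, (h.memLp_gradient v).coeFn_toLp,
    ae_restrict_mem h.isOpen.measurableSet] with x h1 h2 hx
  change ‖(h.memLp_gradDot hX v).toLp _ x‖ ≤ C * ‖(h.memLp_gradient v).toLp _ x‖
  rw [h1, h2, mul_comm]
  exact (norm_inner_le_norm _ _).trans (by gcongr; exact hC x (subset_closure hx))

/-- Continuity turns vanishing almost everywhere into vanishing on `closure D`, and the extension by
zero settles the other points. Thus `L²`-identities in `V_h` are identities of functions. -/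
theorem val_injective (h : IsPolyhedral D S) : Function.Injective h.val := by
  rw [injective_iff_map_eq_zero]
  intro v hv
  have hv := (toLp_eq_zero_iff (memLp_coe v)).1 hv
  have hcont := h.tri.continuousOn v.2
  have hD : Set.EqOn (v : E d → ℝ) 0 D :=
    Measure.eqOn_open_of_ae_eq hv h.isOpen (hcont.mono subset_closure) continuousOn_const
  have hcl : Set.EqOn (v : E d → ℝ) 0 (closure D) :=
    hD.of_subset_closure hcont continuousOn_const subset_closure subset_rfl
  ext x
  by_cases hx : x ∈ closure D
  · exact hcl hx
  · exact v.2.2.1 x hx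

theorem segmentLipschitz (h : IsPolyhedral D S) (v : femSpace D S) : SegmentLipschitz D v := by
  obtain ⟨M, hM⟩ := h.tri.exists_bound h.isBounded v.2
  obtain ⟨L, hL⟩ := h.tri.exists_lipschitz_segment v.2
  exact ⟨M, L, fun x _ => hM x, hL⟩

/-- Integration by parts along a divergence-free tangential field. -/
theorem inner_gradX_val (h : IsPolyhedral D S) (hd : d = 2 ∨ d = 3)
    (hDr : interior (closure D) = D) (hX : ContDiff ℝ 1 X)
    (hXdiv : ∀ x ∈ D, divergence X x = 0) (hXn : IsTangential D X) (v w : femSpace D S) :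
    inner ℝ (h.gradX hX.continuous v) (h.val w) =
      - inner ℝ (h.val v) (h.gradX hX.continuous w) := by
  have hDm := h.isOpen.measurableSet
  have hvd := h.tri.ae_differentiableAt hDm v.2
  have hwd := h.tri.ae_differentiableAt hDm w.2
  obtain ⟨Mv, hMv⟩ := h.tri.exists_bound h.isBounded v.2
  obtain ⟨Mw, hMw⟩ := h.tri.exists_bound h.isBounded w.2
  obtain ⟨Bv, hBv⟩ := h.tri.exists_gradient_bound hDm v.2
  obtain ⟨Bw, hBw⟩ := h.tri.exists_gradient_bound hDm w.2
  have hng : ∀ (g : E d → ℝ) x, ‖fderiv ℝ g x‖ = ‖gradient g x‖ := fun g x => by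
    rw [gradient, LinearIsometryEquiv.norm_map]
  have hmul : ∀ᵐ x ∂volume.restrict D, HasFDerivAt (fun x => (v : E d → ℝ) x * (w : E d → ℝ) x)
      ((v : E d → ℝ) x • fderiv ℝ (w : E d → ℝ) x + (w : E d → ℝ) x • fderiv ℝ (v : E d → ℝ) x)
      x := by
    filter_upwards [hvd, hwd] with x hv hw using hv.hasFDerivAt.mul hw.hasFDerivAt
  -- The divergence theorem is applied to the product `v w`, whose derivative along `X` is the sum
  -- of the two sides.
  have hz := h.tri.integral_fderiv_tangential hd h.isOpen h.isBounded hDr hX hXdiv hXn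
    (f := fun x => (v : E d → ℝ) x * (w : E d → ℝ) x) (B := Mv * Bw + Mw * Bv)
    ((h.segmentLipschitz v).mul (h.segmentLipschitz w))
    ((h.tri.measurable v.2).mul (h.tri.measurable w.2))
    (hmul.mono fun x hx => hx.differentiableAt) (by
      filter_upwards [hmul, hBv, hBw] with x hx hv hw
      rw [hx.fderiv]
      refine (norm_add_le _ _).trans ?_
      rw [norm_smul, norm_smul, hng, hng]
      exact add_le_add
        (mul_le_mul (hMv x) hw (norm_nonneg _) ((abs_nonneg _).trans (hMv x)))
        (mul_le_mul (hMw x) hv (norm_nonneg _) ((abs_nonneg _).trans (hMw x))))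
  have hi1 : Integrable (fun x => gradDot X v x * (w : E d → ℝ) x) (volume.restrict D) :=
    (h.memLp_gradDot hX.continuous v).integrable_mul w.2.1.1
  have hi2 : Integrable (fun x => (v : E d → ℝ) x * gradDot X w x) (volume.restrict D) :=
    MemLp.integrable_mul v.2.1.1 (h.memLp_gradDot hX.continuous w)
  have e1 : inner ℝ (h.gradX hX.continuous v) (h.val w) =
      ∫ x in D, gradDot X v x * (w : E d → ℝ) x :=
    inner_toLp_real (h.memLp_gradDot hX.continuous v) (memLp_coe w)
  have e2 : inner ℝ (h.val v) (h.gradX hX.continuous w) =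
      ∫ x in D, (v : E d → ℝ) x * gradDot X w x :=
    inner_toLp_real (memLp_coe v) (h.memLp_gradDot hX.continuous w)
  rw [e1, e2, eq_neg_iff_add_eq_zero, ← integral_add hi1 hi2, ← hz]
  refine integral_congr_ae ?_
  filter_upwards [hmul] with x hx
  rw [hx.fderiv]
  simp only [gradDot, inner_gradient_eq_fderiv, add_apply, smul_apply, smul_eq_mul]
  ring

/-- The evaluation of a discrete function at the vertices. -/
noncomputable def vertexEval (D : Set (E d)) (S : Geometry.SimplicialComplex ℝ (E d)) :
    femSpace D S →ₗ[ℝ] (S.vertices → ℝ) where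
  toFun v a := (v : E d → ℝ) a
  map_add' _ _ := rfl
  map_smul' _ _ := rfl

theorem finite_vertices (h : IsPolyhedral D S) : Finite S.vertices := by
  refine Set.Finite.to_subtype ?_
  rw [Geometry.SimplicialComplex.vertices_eq]
  exact h.tri.finite.biUnion fun s _ => s.finite_toSet

theorem vertexEval_injective (h : IsPolyhedral D S) : Function.Injective (vertexEval D S) := by
  rw [injective_iff_map_eq_zero]
  intro v hv
  ext x
  by_cases hx : x ∈ closure D
  · rw [h.tri.closure_eq] at hx
    obtain ⟨K, hK, hxK⟩ := hx
    obtain ⟨p, hp⟩ := v.2.2.2 K hK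
    rw [hp hxK]
    obtain ⟨s, hs, hc, rfl⟩ := hK
    have hcv : Convex ℝ (p ⁻¹' {0}) := (convex_singleton 0).affine_preimage p
    refine convexHull_min (fun a ha => ?_) hcv hxK
    have hav : a ∈ S.vertices := by
      rw [Geometry.SimplicialComplex.vertices_eq]
      exact Set.mem_biUnion hs ha
    rw [Set.mem_preimage, Set.mem_singleton_iff, ← hp (subset_convexHull ℝ _ ha)]
    exact congrFun hv ⟨a, hav⟩
  · exact v.2.2.1 x hx

theorem finiteDimensional (h : IsPolyhedral D S) : FiniteDimensional ℝ (femSpace D S) := by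
  have := h.finite_vertices
  exact FiniteDimensional.of_injective _ h.vertexEval_injective

/-- Linear functionals of a pointwise measurable family of discrete functions are measurable. -/
theorem measurable_functional (h : IsPolyhedral D S) {Ω : Type*} {m : MeasurableSpace Ω}
    {u : Ω → femSpace D S} (hu : ∀ x, Measurable fun ω => (u ω : E d → ℝ) x)
    (φ : femSpace D S →ₗ[ℝ] ℝ) : Measurable fun ω => φ (u ω) := by
  classical
  have := h.finite_vertices
  have := Fintype.ofFinite S.vertices
  -- A left inverse of the evaluation at the vertices expresses every functional as a fixed linear
  -- combination of vertex values, which are measurable by assumption.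
  obtain ⟨ψ, hψ⟩ := LinearMap.exists_leftInverse_of_injective (vertexEval D S)
    (LinearMap.ker_eq_bot.2 h.vertexEval_injective)
  have e : ∀ v, φ v = ∑ a : S.vertices, (v : E d → ℝ) a * φ (ψ (Pi.single a 1)) := by
    intro v
    have h1 : ψ (vertexEval D S v) = v := LinearMap.congr_fun hψ v
    conv_lhs => rw [← h1, pi_eq_sum_univ' (vertexEval D S v), map_sum, map_sum]
    refine Finset.sum_congr rfl fun a _ => ?_
    rw [map_smul, map_smul, smul_eq_mul]
    congr 3
  rw [show (fun ω => φ (u ω)) = fun ω => ∑ a : S.vertices, (u ω : E d → ℝ) a *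
    φ (ψ (Pi.single a 1)) from funext fun ω => e (u ω)]
  exact Finset.measurable_sum _ fun a _ => (hu a).mul_const _

theorem measurable_bilinear (h : IsPolyhedral D S) {Ω : Type*} {m : MeasurableSpace Ω}
    {u : Ω → femSpace D S} (hu : ∀ x, Measurable fun ω => (u ω : E d → ℝ) x)
    (φ : femSpace D S →ₗ[ℝ] femSpace D S →ₗ[ℝ] ℝ) : Measurable fun ω => φ (u ω) (u ω) := by
  have := h.finiteDimensional
  let b := Module.finBasis ℝ (femSpace D S)
  have e : ∀ v, φ v v = ∑ i, b.coord i v * φ (b i) v := by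
    intro v
    have h1 : φ v = ∑ i, b.coord i v • φ (b i) := by
      conv_lhs => rw [← b.sum_repr v, map_sum]
      exact Finset.sum_congr rfl fun i _ => by rw [map_smul, b.coord_apply]
    conv_lhs => rw [h1]
    simp [LinearMap.sum_apply]
  rw [show (fun ω => φ (u ω) (u ω)) = fun ω => ∑ i, b.coord i (u ω) * φ (b i) (u ω) from
    funext fun ω => e (u ω)]
  exact Finset.measurable_sum _ fun i _ =>
    (h.measurable_functional hu (b.coord i)).mul (h.measurable_functional hu (φ (b i)))

end IsPolyhedral

end FiniteElementSpace

end SCH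

namespace SCH

/-! ### The energy estimate for one time step -/

section Energy

variable {V H G : Type*} [AddCommGroup V] [Module ℝ V] [NormedAddCommGroup H]
  [InnerProductSpace ℝ H] [NormedAddCommGroup G] [InnerProductSpace ℝ G]
  {val : V →ₗ[ℝ] H} {grad : V →ₗ[ℝ] G} {one : V}

/-- `T` is an inverse of the discrete negative Laplace operator on functions of zero mean. -/
def IsInverse (val : V →ₗ[ℝ] H) (grad : V →ₗ[ℝ] G) (one : V) (T : V →ₗ[ℝ] V) : Prop :=
  ∀ ζ, inner ℝ (val ζ) (val one) = 0 → inner ℝ (val (T ζ)) (val one) = 0 ∧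
    ∀ v, inner ℝ (grad (T ζ)) (grad v) = inner ℝ (val ζ) (val v)

/-- The form `(∇u, ∇v) + ℓ(u) ℓ(v)`, with `ℓ` the integral, is definite by the Poincaré inequality
and therefore invertible in finite dimensions. Testing with the constant shows that the solution has
mean zero when the datum has, so the added term drops out. The construction makes `T` linear on the
whole space, as the splitting of the noise and the measurability arguments require. -/
theorem exists_isInverse [FiniteDimensional ℝ V] (hval : Function.Injective val)
    (hone : grad one = 0) (hone0 : one ≠ 0) {C : ℝ}
    (hP : ∀ v, inner ℝ (val v) (val one) = 0 → ‖val v‖ ^ 2 ≤ C * ‖grad v‖ ^ 2) :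
    ∃ T, IsInverse val grad one T := by
  let ℓ : V →ₗ[ℝ] ℝ := (innerₗ H (val one)).comp val
  let B : V →ₗ[ℝ] V →ₗ[ℝ] ℝ :=
    ((innerₗ G).compl₁₂ grad grad) + (LinearMap.mul ℝ ℝ).compl₁₂ ℓ ℓ
  let M : V →ₗ[ℝ] V →ₗ[ℝ] ℝ := (innerₗ H).compl₁₂ val val
  have hℓ : ∀ v, ℓ v = inner ℝ (val v) (val one) := fun v => by
    simp [ℓ, real_inner_comm]
  have hB : ∀ u v, B u v = inner ℝ (grad u) (grad v) + ℓ u * ℓ v := fun u v => by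
    simp [B]
  have hM : ∀ u v, M u v = inner ℝ (val u) (val v) := fun u v => by simp [M]
  have hinj : Function.Injective B := by
    rw [injective_iff_map_eq_zero]
    intro v hv
    have h1 := hB v v
    rw [hv, LinearMap.zero_apply, real_inner_self_eq_norm_sq] at h1
    have h2 : ‖grad v‖ ^ 2 = 0 := by nlinarith [sq_nonneg ‖grad v‖, mul_self_nonneg (ℓ v)]
    have h3 : ℓ v = 0 := by nlinarith [sq_nonneg ‖grad v‖, mul_self_nonneg (ℓ v)]
    have h4 := hP v ((hℓ v).symm.trans h3)
    rw [h2, mul_zero] at h4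
    have h5 : val v = 0 := by
      rw [← norm_eq_zero]
      nlinarith [norm_nonneg (val v)]
    exact hval (h5.trans (map_zero val).symm)
  let e : V ≃ₗ[ℝ] (V →ₗ[ℝ] ℝ) :=
    LinearEquiv.ofInjectiveOfFinrankEq B hinj (Subspace.dual_finrank_eq).symm
  have he : ∀ v, e v = B v := fun v => rfl
  refine ⟨e.symm.toLinearMap.comp M, fun ζ hζ => ?_⟩
  have hT : ∀ v, inner ℝ (grad (e.symm (M ζ))) (grad v) + ℓ (e.symm (M ζ)) * ℓ v =
      inner ℝ (val ζ) (val v) := fun v => by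
    rw [← hB, ← he, e.apply_symm_apply, hM]
  have hℓ1 : ℓ one ≠ 0 := by
    rw [hℓ, real_inner_self_eq_norm_sq]
    have : val one ≠ 0 := fun h => hone0 (hval (h.trans (map_zero val).symm))
    positivity
  have h0 : ℓ (e.symm (M ζ)) = 0 := by
    have := hT one
    rw [hone, inner_zero_right, zero_add, hζ] at this
    exact (mul_eq_zero.1 this).resolve_right hℓ1
  refine ⟨(hℓ _).symm.trans h0, fun v => ?_⟩
  have := hT v
  rwa [h0, zero_mul, add_zero] at this

variable {T : V →ₗ[ℝ] V} {gradX : V →ₗ[ℝ] H} {C : ℝ}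

/-- Interpolation between the discrete `H⁻¹` norm and the `H¹` seminorm: `‖ζ‖² = (∇Tζ, ∇ζ)`. -/
theorem IsInverse.norm_val_sq_le (hT : IsInverse val grad one T) {ζ : V}
    (hζ : inner ℝ (val ζ) (val one) = 0) : ‖val ζ‖ ^ 2 ≤ ‖grad (T ζ)‖ * ‖grad ζ‖ := by
  rw [← real_inner_self_eq_norm_sq, ← (hT ζ hζ).2 ζ]
  exact real_inner_le_norm _ _

/-- The dual form of the Poincaré inequality, used for the initial value. It comes from `‖∇Tζ‖² =
(ζ, Tζ)` and the Poincaré inequality for `Tζ`. -/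
theorem IsInverse.norm_grad_sq_le (hT : IsInverse val grad one T) {K : ℝ} (hK : 0 ≤ K)
    (hP : ∀ v, inner ℝ (val v) (val one) = 0 → ‖val v‖ ^ 2 ≤ K * ‖grad v‖ ^ 2) {ζ : V}
    (hζ : inner ℝ (val ζ) (val one) = 0) : ‖grad (T ζ)‖ ^ 2 ≤ K * ‖val ζ‖ ^ 2 := by
  have h1 : ‖grad (T ζ)‖ ^ 2 ≤ ‖val ζ‖ * ‖val (T ζ)‖ := by
    rw [← real_inner_self_eq_norm_sq, (hT ζ hζ).2 (T ζ)]
    exact real_inner_le_norm _ _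
  have h2 := hP (T ζ) (hT ζ hζ).1
  rcases eq_or_lt_of_le (norm_nonneg (grad (T ζ))) with h0 | h0
  · rw [← h0, zero_pow two_ne_zero]
    positivity
  · have h3 : (‖grad (T ζ)‖ ^ 2) ^ 2 ≤ ‖val ζ‖ ^ 2 * (K * ‖grad (T ζ)‖ ^ 2) :=
      calc (‖grad (T ζ)‖ ^ 2) ^ 2 ≤ (‖val ζ‖ * ‖val (T ζ)‖) ^ 2 := by gcongr
        _ = ‖val ζ‖ ^ 2 * ‖val (T ζ)‖ ^ 2 := by ring
        _ ≤ _ := by gcongr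
    have h4 : 0 < ‖grad (T ζ)‖ ^ 2 := by positivity
    nlinarith

/-- Integration by parts moves the derivative off the rough factor `v`, so only its `L²` norm is
needed. -/
theorem abs_inner_gradX_val_le
    (hibp : ∀ v w, inner ℝ (gradX v) (val w) = - inner ℝ (val v) (gradX w))
    (hC : ∀ v, ‖gradX v‖ ≤ C * ‖grad v‖) (v w : V) :
    |inner ℝ (gradX v) (val w)| ≤ C * ‖val v‖ * ‖grad w‖ := by
  rw [hibp, abs_neg]
  refine (abs_real_inner_le_norm _ _).trans ?_
  calc ‖val v‖ * ‖gradX w‖ ≤ ‖val v‖ * (C * ‖grad w‖) := by gcongr; exact hC w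
    _ = _ := by ring

/-- The first equation is tested with `Tζ`. The martingale part `ξ (∇ζ'·X, Tζ')` is kept as it is,
because it vanishes only in expectation. Of the coercive term `ε‖∇ζ‖²`, a quarter is spent on the
nonlinearity and an eighth on the correction term, and `5/8` remains. -/
theorem IsInverse.energy_step (hT : IsInverse val grad one T)
    (hibp : ∀ v w, inner ℝ (gradX v) (val w) = - inner ℝ (val v) (gradX w))
    (hC : ∀ v, ‖gradX v‖ ≤ C * ‖grad v‖) {ζ ζ' w : V}
    (hζ : inner ℝ (val ζ) (val one) = 0) (hζ' : inner ℝ (val ζ') (val one) = 0)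
    {τ δ ε ξ F : ℝ} (hτ : 0 ≤ τ) (hε : 0 < ε)
    (hstep : ∀ η, inner ℝ (val ζ) (val η) = inner ℝ (val ζ') (val η)
      - τ * inner ℝ (grad w) (grad η) - τ * (δ ^ 2 / 2) * inner ℝ (gradX ζ) (gradX η)
      + δ * (ξ * inner ℝ (gradX ζ') (val η)))
    (hw : inner ℝ (val w) (val ζ) = ε * ‖grad ζ‖ ^ 2 + ε⁻¹ * F) (hF : - ‖val ζ‖ ^ 2 ≤ F) :
    1 / 2 * ‖grad (T ζ)‖ ^ 2 + 5 / 8 * τ * ε * ‖grad ζ‖ ^ 2 ≤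
      1 / 2 * ‖grad (T ζ')‖ ^ 2 +
        τ * (ε⁻¹ ^ 3 + C ^ 4 * δ ^ 4 * ε⁻¹ / 2) * ‖grad (T ζ)‖ ^ 2 +
        δ * (ξ * inner ℝ (gradX ζ') (val (T ζ'))) +
        1 / 2 * δ ^ 2 * C ^ 2 * (ξ ^ 2 * ‖val ζ'‖ ^ 2) := by
  have h1 := hstep (T ζ)
  rw [← (hT ζ hζ).2, ← (hT ζ' hζ').2, real_inner_self_eq_norm_sq,
    real_inner_comm (grad (T ζ)) (grad w), (hT ζ hζ).2 w, real_inner_comm (val w), hw] at h1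
  -- Polarization produces the dissipation `½‖∇(Tζ - Tζ')‖²` of the implicit step.
  have h2 : inner ℝ (grad (T ζ')) (grad (T ζ)) =
      (‖grad (T ζ)‖ ^ 2 + ‖grad (T ζ')‖ ^ 2 - ‖grad (T ζ - T ζ')‖ ^ 2) / 2 := by
    rw [map_sub, norm_sub_sq_real, real_inner_comm]
    ring
  have h3 : inner ℝ (gradX ζ') (val (T ζ)) =
      inner ℝ (gradX ζ') (val (T ζ')) + inner ℝ (gradX ζ') (val (T ζ - T ζ')) := by
    rw [map_sub, inner_sub_right]
    ring
  have h4 : |inner ℝ (gradX ζ) (gradX (T ζ))| ≤ C ^ 2 * (‖grad (T ζ)‖ * ‖grad ζ‖) := by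
    refine (abs_real_inner_le_norm _ _).trans ?_
    calc ‖gradX ζ‖ * ‖gradX (T ζ)‖ ≤ (C * ‖grad ζ‖) * (C * ‖grad (T ζ)‖) :=
          mul_le_mul (hC _) (hC _) (norm_nonneg _) ((norm_nonneg _).trans (hC _))
      _ = _ := by ring
  have h5 := abs_inner_gradX_val_le hibp hC ζ' (T ζ - T ζ')
  have h6 := hT.norm_val_sq_le hζ
  rw [h2, h3] at h1
  set a := ‖grad (T ζ)‖
  set b := ‖grad ζ‖
  set l := ‖val ζ'‖
  set q := ‖grad (T ζ - T ζ')‖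
  set y := inner ℝ (gradX ζ') (val (T ζ - T ζ'))
  set g := inner ℝ (gradX ζ) (gradX (T ζ))
  set s := ε⁻¹ with hs
  have hs0 : 0 < s := by positivity
  have hes : ε * s = 1 := mul_inv_cancel₀ hε.ne'
  have i1 : s * (a * b) ≤ ε / 4 * b ^ 2 + s ^ 3 * a ^ 2 := by
    have : 0 ≤ ε * (b / 2 - s ^ 2 * a) ^ 2 := by positivity
    have e : ε * (b / 2 - s ^ 2 * a) ^ 2 =
        ε / 4 * b ^ 2 - (ε * s) * s * (a * b) + (ε * s) * s ^ 3 * a ^ 2 := by ring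
    rw [e, hes] at this
    linarith
  have i2 : δ ^ 2 / 2 * (C ^ 2 * (a * b)) ≤ ε / 8 * b ^ 2 + C ^ 4 * δ ^ 4 * s / 2 * a ^ 2 := by
    have : 0 ≤ ε / 8 * (b - 2 * s * δ ^ 2 * C ^ 2 * a) ^ 2 := by positivity
    have e : ε / 8 * (b - 2 * s * δ ^ 2 * C ^ 2 * a) ^ 2 = ε / 8 * b ^ 2 -
        (ε * s) * (1 / 2) * δ ^ 2 * C ^ 2 * (a * b) +
        (ε * s) * s * (1 / 2) * δ ^ 4 * C ^ 4 * a ^ 2 := by ring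
    rw [e, hes] at this
    linarith
  -- The non-adapted half of the noise is absorbed exactly by this dissipation.
  have i3 : δ * (ξ * y) ≤ 1 / 2 * q ^ 2 + 1 / 2 * δ ^ 2 * C ^ 2 * (ξ ^ 2 * l ^ 2) := by
    have hy : (δ * ξ) * y ≤ |δ * ξ| * (C * l * q) := by
      refine (le_abs_self _).trans ?_
      rw [abs_mul]
      gcongr
    have : 0 ≤ (q - |δ * ξ| * (C * l)) ^ 2 := sq_nonneg _
    have e : (q - |δ * ξ| * (C * l)) ^ 2 = q ^ 2 - 2 * (|δ * ξ| * (C * l * q)) +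
        |δ * ξ| ^ 2 * (C * l) ^ 2 := by ring
    rw [e, sq_abs] at this
    nlinarith
  have i4 : -(τ * (s * F)) ≤ τ * (ε / 4 * b ^ 2 + s ^ 3 * a ^ 2) := by
    have : -(s * F) ≤ ε / 4 * b ^ 2 + s ^ 3 * a ^ 2 := by
      have : s * (-F) ≤ s * (a * b) := by
        gcongr
        linarith
      linarith
    have := mul_le_mul_of_nonneg_left this hτ
    linarith
  have i5 : -(τ * (δ ^ 2 / 2) * g) ≤ τ * (ε / 8 * b ^ 2 + C ^ 4 * δ ^ 4 * s / 2 * a ^ 2) := by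
    have h7 : -(δ ^ 2 / 2 * g) ≤ δ ^ 2 / 2 * (C ^ 2 * (a * b)) := by
      have : δ ^ 2 / 2 * (-g) ≤ δ ^ 2 / 2 * (C ^ 2 * (a * b)) := by
        gcongr
        exact (neg_le_abs g).trans h4
      linarith
    have := mul_le_mul_of_nonneg_left (h7.trans i2) hτ
    linarith
  linarith

/-- Applied with `A = ‖ζ‖²₋₁`, `B = ‖∇ζ‖²` and `L = ‖ζ‖²`, this pays for the quadratic variation of
the noise with another eighth of the coercive term. -/
theorem young_half_sq {ε δ c A B L : ℝ} (hε : 0 < ε) (hA : 0 ≤ A) (hB : 0 ≤ B)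
    (hLAB : L ^ 2 ≤ A * B) :
    1 / 2 * δ ^ 2 * c * L ≤ ε / 8 * B + c ^ 2 * δ ^ 4 * ε⁻¹ / 2 * A := by
  have hs0 : 0 < ε⁻¹ := by positivity
  -- After squaring, the claim is `4xy ≤ (x + y)²` for the two terms on the right.
  refine abs_le_of_sq_le_sq' ?_ (by positivity) |>.2
  have hes : ε * ε⁻¹ = 1 := mul_inv_cancel₀ hε.ne'
  have h1 : 4 * (ε / 8 * B) * (c ^ 2 * δ ^ 4 * ε⁻¹ / 2 * A) = 1 / 4 * δ ^ 4 * c ^ 2 * (A * B) := by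
    have : 4 * (ε / 8 * B) * (c ^ 2 * δ ^ 4 * ε⁻¹ / 2 * A) =
      (ε * ε⁻¹) * (1 / 4) * δ ^ 4 * c ^ 2 * (A * B) := by ring
    rw [this, hes, one_mul]
  have h2 : (1 / 2 * δ ^ 2 * c * L) ^ 2 ≤ 1 / 4 * δ ^ 4 * c ^ 2 * (A * B) := by
    have : (1 / 2 * δ ^ 2 * c * L) ^ 2 = 1 / 4 * δ ^ 4 * c ^ 2 * L ^ 2 := by ring
    rw [this]
    gcongr
  nlinarith [sq_nonneg (ε / 8 * B - c ^ 2 * δ ^ 4 * ε⁻¹ / 2 * A)]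

end Energy

end SCH

namespace SCH

/-! ### The discrete Gronwall argument -/

section Gronwall

theorem discrete_gronwall {N : ℕ} {e b : ℕ → ℝ} {θ β : ℝ} (hθ0 : 0 ≤ θ) (hθ : θ ≤ 1 / 4)
    (he : ∀ n, 0 ≤ e n) (hb : ∀ n, 0 ≤ b n) (hβ : 0 ≤ β)
    (h : ∀ n < N, (1 - θ) * e (n + 1) + β * b (n + 1) ≤ (1 + θ) * e n) :
    (∀ n ≤ N, e n ≤ Real.exp (3 * (θ * N)) * e 0) ∧
      β * ∑ n ∈ Finset.Icc 1 N, b n ≤ e 0 * (1 + 2 * (θ * N) * Real.exp (3 * (θ * N))) := by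
  -- Since `exp(3θ) ≥ 1 + 3θ`, it suffices that `(1 - θ)(1 + 3θ) ≥ 1 + θ`, which holds for `0 ≤ θ ≤
  -- 1/3`.
  have hexp : 1 + θ ≤ (1 - θ) * Real.exp (3 * θ) := by
    have := Real.add_one_le_exp (3 * θ)
    nlinarith
  have hgrow : ∀ n ≤ N, e n ≤ Real.exp (3 * (θ * n)) * e 0 := by
    intro n
    induction n with
    | zero => intro _; simp
    | succ n ih =>
      intro hn
      have h1 := h n (by omega)
      have h2 := ih (by omega)
      have h3 : (1 - θ) * e (n + 1) ≤ (1 - θ) * (Real.exp (3 * θ) * e n) := by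
        have := mul_le_mul_of_nonneg_right hexp (he n)
        nlinarith [mul_nonneg hβ (hb (n + 1))]
      have h4 : e (n + 1) ≤ Real.exp (3 * θ) * e n := le_of_mul_le_mul_left h3 (by linarith)
      calc e (n + 1) ≤ Real.exp (3 * θ) * (Real.exp (3 * (θ * n)) * e 0) := by
            refine h4.trans ?_
            gcongr
        _ = Real.exp (3 * (θ * (n + 1 : ℕ))) * e 0 := by
            rw [← mul_assoc, ← Real.exp_add]
            congr 2
            push_cast
            ring
  have hgrow' : ∀ n ≤ N, e n ≤ Real.exp (3 * (θ * N)) * e 0 := fun n hn => by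
    refine (hgrow n hn).trans ?_
    gcongr
    exact he 0
  refine ⟨hgrow', ?_⟩
  -- Telescoping: each step adds at most `θ(e (k + 1) + e k)`, and both values are under the uniform
  -- bound just found.
  have hsum : ∀ k ≤ N, β * ∑ n ∈ Finset.Icc 1 k, b n + e k ≤
      e 0 + 2 * θ * k * (Real.exp (3 * (θ * N)) * e 0) := by
    intro k
    induction k with
    | zero => intro _; simp
    | succ k ih =>
      intro hk
      have h1 := h k (by omega)
      have h2 := ih (by omega)
      rw [Finset.sum_Icc_succ_top (by omega)]
      have h3 := mul_le_mul_of_nonneg_left (hgrow' k (by omega)) hθ0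
      have h4 := mul_le_mul_of_nonneg_left (hgrow' (k + 1) hk) hθ0
      push_cast
      nlinarith
  have := hsum N le_rfl
  nlinarith [he N]

variable {Ω : Type*} {m : MeasurableSpace Ω} {P : Measure Ω}

theorem indepFun_of_indep_comap {𝒢 : MeasurableSpace Ω} {ξ f : Ω → ℝ}
    (hind : Indep (MeasurableSpace.comap ξ inferInstance) 𝒢 P) (hf : Measurable[𝒢] f) :
    IndepFun ξ f P := by
  rw [IndepFun_iff_Indep]
  exact indep_of_indep_of_le_right hind hf.comap_le

/-- The expected energy estimate for processes that satisfy the pathwise one. -/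
theorem energy_estimate [IsProbabilityMeasure P] {𝒢 : ℕ → MeasurableSpace Ω} (h𝒢 : ∀ n, 𝒢 n ≤ m)
    {ξ : ℕ → Ω → ℝ} {N : ℕ} {τ δ ε c K a₀ l₀ : ℝ} (hτ : 0 < τ) (hε : 0 < ε) (hc : 0 ≤ c)
    (hK : 0 ≤ K) (hτK : τ * K ≤ 1 / 8)
    (hξ2 : ∀ n, MemLp (ξ n) 2 P) (hξ0 : ∀ n, ∫ ω, ξ n ω ∂P = 0) (hξτ : ∀ n, ∫ ω, ξ n ω ^ 2 ∂P = τ)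
    (hind : ∀ n, Indep (MeasurableSpace.comap (ξ n) inferInstance) (𝒢 n) P)
    {A B L M : ℕ → Ω → ℝ}
    (hAm : ∀ n ≤ N, Measurable[𝒢 n] (A n)) (hBm : ∀ n ≤ N, Measurable[𝒢 n] (B n))
    (hLm : ∀ n ≤ N, Measurable[𝒢 n] (L n)) (hMm : ∀ n ≤ N, Measurable[𝒢 n] (M n))
    (hA : ∀ n ω, 0 ≤ A n ω) (hB : ∀ n ω, 0 ≤ B n ω) (hL : ∀ n ω, 0 ≤ L n ω)
    (hLAB : ∀ n ≤ N, ∀ᵐ ω ∂P, L n ω ≤ A n ω + B n ω)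
    (hM : ∀ n ≤ N, ∀ᵐ ω ∂P, |M n ω| ≤ c * L n ω + A n ω)
    (hyoung : ∀ n ≤ N, ∀ᵐ ω ∂P, 1 / 2 * δ ^ 2 * c * L n ω ≤ ε / 8 * B n ω + K * A n ω)
    (hA0 : ∀ᵐ ω ∂P, A 0 ω ≤ a₀) (hL0 : ∀ᵐ ω ∂P, L 0 ω ≤ l₀)
    (hstep : ∀ n < N, ∀ᵐ ω ∂P, 1 / 2 * A (n + 1) ω + 5 / 8 * τ * ε * B (n + 1) ω ≤
      1 / 2 * A n ω + τ * K * A (n + 1) ω + δ * (ξ n ω * M n ω) +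
        1 / 2 * δ ^ 2 * c * (ξ n ω ^ 2 * L n ω)) :
    (∀ n ≤ N, Integrable (A n) P) ∧ (∀ n ∈ Finset.Icc 1 N, Integrable (B n) P) ∧
      (∀ n ≤ N, ∫ ω, A n ω ∂P ≤ 2 * (Real.exp (3 * (2 * (τ * K) * N)) *
        (1 / 2 * a₀ + 1 / 2 * δ ^ 2 * c * τ * l₀))) ∧
      ∑ n ∈ Finset.Icc 1 N, τ * ∫ ω, B n ω ∂P ≤ 2 * ε⁻¹ *
        ((1 / 2 * a₀ + 1 / 2 * δ ^ 2 * c * τ * l₀) *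
          (1 + 2 * (2 * (τ * K) * N) * Real.exp (3 * (2 * (τ * K) * N)))) := by
  have hAm' : ∀ n ≤ N, Measurable (A n) := fun n hn => (hAm n hn).mono (h𝒢 n) le_rfl
  have hBm' : ∀ n ≤ N, Measurable (B n) := fun n hn => (hBm n hn).mono (h𝒢 n) le_rfl
  have hLm' : ∀ n ≤ N, Measurable (L n) := fun n hn => (hLm n hn).mono (h𝒢 n) le_rfl
  have hMm' : ∀ n ≤ N, Measurable (M n) := fun n hn => (hMm n hn).mono (h𝒢 n) le_rfl
  have hξ1 : ∀ n, Integrable (ξ n) P := fun n => (hξ2 n).integrable (by norm_num)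
  have hξsq : ∀ n, Integrable (fun ω => ξ n ω ^ 2) P := fun n => (hξ2 n).integrable_sq
  have hMi : ∀ n ≤ N, Integrable (A n) P → Integrable (L n) P → Integrable (M n) P := by
    intro n hn h1 h2
    exact ((h2.const_mul c).add h1).mono' (hMm' n hn).aestronglyMeasurable (hM n hn)
  have hiM : ∀ n ≤ N, IndepFun (ξ n) (M n) P := fun n hn =>
    indepFun_of_indep_comap (hind n) (hMm n hn)
  have hiL : ∀ n ≤ N, IndepFun (fun ω => ξ n ω ^ 2) (L n) P := fun n hn =>
    (indepFun_of_indep_comap (hind n) (hLm n hn)).comp (φ := fun x : ℝ => x ^ 2) (ψ := id)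
      (by fun_prop) measurable_id
  have hξM : ∀ n ≤ N, Integrable (A n) P → Integrable (L n) P →
      Integrable (fun ω => ξ n ω * M n ω) P := fun n hn h1 h2 =>
    (hiM n hn).integrable_mul (hξ1 n) (hMi n hn h1 h2)
  have hξL : ∀ n ≤ N, Integrable (L n) P → Integrable (fun ω => ξ n ω ^ 2 * L n ω) P :=
    fun n hn h2 => (hiL n hn).integrable_mul (hξsq n) h2
  have hR : ∀ n ≤ N, Integrable (A n) P → Integrable (L n) P →
      Integrable (fun ω => 1 / 2 * A n ω + δ * (ξ n ω * M n ω) +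
        1 / 2 * δ ^ 2 * c * (ξ n ω ^ 2 * L n ω)) P := fun n hn h1 h2 =>
    ((h1.const_mul _).add ((hξM n hn h1 h2).const_mul _)).add ((hξL n hn h2).const_mul _)
  have hstepR : ∀ n < N, ∀ᵐ ω ∂P, 3 / 8 * A (n + 1) ω + 5 / 8 * τ * ε * B (n + 1) ω ≤
      1 / 2 * A n ω + δ * (ξ n ω * M n ω) + 1 / 2 * δ ^ 2 * c * (ξ n ω ^ 2 * L n ω) := by
    intro n hn
    filter_upwards [hstep n hn] with ω h
    have := mul_le_mul_of_nonneg_right hτK (hA (n + 1) ω)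
    linarith
  have hBi : ∀ n < N, Integrable (A n) P → Integrable (L n) P → Integrable (B (n + 1)) P := by
    intro n hn h1 h2
    refine ((hR n hn.le h1 h2).const_mul (5 / 8 * τ * ε)⁻¹).mono'
      (hBm' (n + 1) hn).aestronglyMeasurable ?_
    filter_upwards [hstepR n hn] with ω h
    have h3 : 0 < 5 / 8 * τ * ε := by positivity
    rw [Real.norm_of_nonneg (hB _ _), inv_mul_eq_div, le_div_iff₀ h3]
    linarith [hA (n + 1) ω]
  -- Integrability is propagated along with the recursion: the pathwise estimate dominates the new
  -- `A` and `B` by integrable quantities of the previous step, where independence makes the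
  -- products with `ξ` and `ξ²` integrable.
  have hint : ∀ n ≤ N, Integrable (A n) P ∧ Integrable (L n) P := by
    intro n
    induction n with
    | zero =>
      intro hn
      refine ⟨Integrable.of_bound (hAm' 0 hn).aestronglyMeasurable a₀ ?_,
        Integrable.of_bound (hLm' 0 hn).aestronglyMeasurable l₀ ?_⟩
      · filter_upwards [hA0] with ω h
        rwa [Real.norm_of_nonneg (hA _ _)]
      · filter_upwards [hL0] with ω h
        rwa [Real.norm_of_nonneg (hL _ _)]
    | succ n ih =>
      intro hn
      obtain ⟨h1, h2⟩ := ih (by omega)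
      have h3 : Integrable (A (n + 1)) P := by
        refine ((hR n (by omega) h1 h2).const_mul (8 / 3)).mono'
          (hAm' (n + 1) hn).aestronglyMeasurable ?_
        filter_upwards [hstepR n hn] with ω h
        have h3 : 0 ≤ 5 / 8 * τ * ε * B (n + 1) ω := mul_nonneg (by positivity) (hB _ _)
        rw [Real.norm_of_nonneg (hA _ _)]
        linarith
      refine ⟨h3, (h3.add (hBi n hn h1 h2)).mono' (hLm' (n + 1) hn).aestronglyMeasurable ?_⟩
      filter_upwards [hLAB (n + 1) hn] with ω h
      rwa [Real.norm_of_nonneg (hL _ _)]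
  have hBint : ∀ n ∈ Finset.Icc 1 N, Integrable (B n) P := by
    intro n hn
    obtain ⟨h1, h2⟩ := Finset.mem_Icc.1 hn
    obtain ⟨k, rfl⟩ : ∃ k, n = k + 1 := ⟨n - 1, by omega⟩
    exact hBi k (by omega) (hint k (by omega)).1 (hint k (by omega)).2
  let a : ℕ → ℝ := fun n => ∫ ω, A n ω ∂P
  let b : ℕ → ℝ := fun n => ∫ ω, B n ω ∂P
  let l : ℕ → ℝ := fun n => ∫ ω, L n ω ∂P
  have ha : ∀ n, 0 ≤ a n := fun n => integral_nonneg (hA n)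
  have hb : ∀ n, 0 ≤ b n := fun n => integral_nonneg (hB n)
  have hl : ∀ n, 0 ≤ l n := fun n => integral_nonneg (hL n)
  have hexp : ∀ n < N, 1 / 2 * a (n + 1) + 5 / 8 * τ * ε * b (n + 1) ≤
      1 / 2 * a n + τ * K * a (n + 1) + 1 / 2 * δ ^ 2 * c * (τ * l n) := by
    intro n hn
    obtain ⟨h1, h2⟩ := hint n hn.le
    have h3 := (hint (n + 1) hn).1
    have h4 := hBi n hn h1 h2
    have i1 := h1.const_mul (1 / 2)
    have i2 := h3.const_mul (τ * K)
    have i3 := (hξM n hn.le h1 h2).const_mul δ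
    have i4 := (hξL n hn.le h2).const_mul (1 / 2 * δ ^ 2 * c)
    have i12 : Integrable (fun ω => 1 / 2 * A n ω + τ * K * A (n + 1) ω) P := i1.add i2
    have i123 : Integrable (fun ω => 1 / 2 * A n ω + τ * K * A (n + 1) ω + δ * (ξ n ω * M n ω)) P :=
      i12.add i3
    have hmono := integral_mono_ae ((h3.const_mul (1 / 2)).add (h4.const_mul (5 / 8 * τ * ε)))
      (i123.add i4) (hstep n hn)
    simp only [Pi.add_apply] at hmono
    rw [integral_add (h3.const_mul (1 / 2)) (h4.const_mul (5 / 8 * τ * ε)),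
      integral_add i123 i4, integral_add i12 i3, integral_add i1 i2] at hmono
    simp only [integral_const_mul] at hmono
    have e1 : ∫ ω, ξ n ω * M n ω ∂P = 0 := by
      rw [(hiM n hn.le).integral_fun_mul_eq_mul_integral (hξ1 n).aestronglyMeasurable
        (hMm' n hn.le).aestronglyMeasurable, hξ0, zero_mul]
    have e2 : ∫ ω, ξ n ω ^ 2 * L n ω ∂P = τ * l n := by
      rw [(hiL n hn.le).integral_fun_mul_eq_mul_integral (hξsq n).aestronglyMeasurable
        (hLm' n hn.le).aestronglyMeasurable, hξτ]
    rw [e1, e2] at hmono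
    linarith
  have hyoungE : ∀ n ∈ Finset.Icc 1 N, 1 / 2 * δ ^ 2 * c * l n ≤ ε / 8 * b n + K * a n := by
    intro n hn
    have hn' := (Finset.mem_Icc.1 hn).2
    obtain ⟨h1, h2⟩ := hint n hn'
    have h3 := hBint n hn
    have hmono := integral_mono_ae (h2.const_mul (1 / 2 * δ ^ 2 * c))
      ((h3.const_mul (ε / 8)).add (h1.const_mul K)) (hyoung n hn')
    simp only [Pi.add_apply] at hmono
    rw [integral_add (h3.const_mul (ε / 8)) (h1.const_mul K)] at hmono
    simpa only [integral_const_mul] using hmono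
  -- The energy carries `τε/8` of the gradient term to the next step, where it pays for the noise.
  -- At `n = 0` the `L²` norm of the initial value takes that place, since the initial gradient has
  -- no bound in terms of `u₀`.
  let e : ℕ → ℝ := fun n => if n = 0 then 1 / 2 * a 0 + 1 / 2 * δ ^ 2 * c * τ * l 0 else
    1 / 2 * a n + τ * ε / 8 * b n
  have he0 : e 0 = 1 / 2 * a 0 + 1 / 2 * δ ^ 2 * c * τ * l 0 := if_pos rfl
  have hes : ∀ n, e (n + 1) = 1 / 2 * a (n + 1) + τ * ε / 8 * b (n + 1) := fun n =>
    if_neg (Nat.succ_ne_zero n)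
  have hen : ∀ n, 0 ≤ e n := by
    intro n
    have := ha n
    have := hb n
    have := ha 0
    have := hl 0
    rcases n with _ | n
    · rw [he0]
      positivity
    · rw [hes]
      positivity
  have hae : ∀ n, 1 / 2 * a n ≤ e n := by
    intro n
    rcases n with _ | n
    · rw [he0]
      have := mul_nonneg (by positivity : 0 ≤ 1 / 2 * δ ^ 2 * c * τ) (hl 0)
      linarith
    · rw [hes]
      have := mul_nonneg (by positivity : 0 ≤ τ * ε / 8) (hb (n + 1))
      linarith
  have hτK0 : 0 ≤ τ * K := by positivity
  -- The coefficient `5/8` splits into the `1/8` stored in `e (n + 1)` and the `1/2` that survives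
  -- for the sum. The terms in `K` from the new level and from the old level give the two factors
  -- with `2τK`.
  have hrec : ∀ n < N, (1 - 2 * (τ * K)) * e (n + 1) + τ * ε / 2 * b (n + 1) ≤
      (1 + 2 * (τ * K)) * e n := by
    intro n hn
    have h1 := hexp n hn
    have h2 : 0 ≤ 2 * (τ * K) * (τ * ε / 8 * b (n + 1)) :=
      mul_nonneg (by positivity) (mul_nonneg (by positivity) (hb _))
    have h3 : 1 / 2 * a n + 1 / 2 * δ ^ 2 * c * (τ * l n) ≤ (1 + 2 * (τ * K)) * e n := by
      rcases n with _ | n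
      · have h4 : 0 ≤ 2 * (τ * K) * e 0 := mul_nonneg (by positivity) (hen 0)
        rw [add_mul, one_mul]
        rw [he0] at h4 ⊢
        linarith
      · have h5 := hyoungE (n + 1) (Finset.mem_Icc.2 ⟨by omega, by omega⟩)
        have h6 := mul_le_mul_of_nonneg_left h5 hτ.le
        have h7 : 0 ≤ 2 * (τ * K) * (τ * ε / 8 * b (n + 1)) :=
          mul_nonneg (by positivity) (mul_nonneg (by positivity) (hb _))
        rw [hes]
        linarith
    rw [hes]
    linarith
  obtain ⟨hg1, hg2⟩ := discrete_gronwall (by positivity : 0 ≤ 2 * (τ * K)) (by linarith) hen hb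
    (by positivity : 0 ≤ τ * ε / 2) hrec
  have he0' : e 0 ≤ 1 / 2 * a₀ + 1 / 2 * δ ^ 2 * c * τ * l₀ := by
    rw [he0]
    have h1 : a 0 ≤ a₀ := by
      have := integral_mono_ae (hint 0 (Nat.zero_le _)).1 (integrable_const a₀) hA0
      simpa using this
    have h2 : l 0 ≤ l₀ := by
      have := integral_mono_ae (hint 0 (Nat.zero_le _)).2 (integrable_const l₀) hL0
      simpa using this
    gcongr
  refine ⟨fun n hn => (hint n hn).1, hBint, fun n hn => ?_, ?_⟩
  · have h1 := hg1 n hn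
    have h2 := hae n
    have h3 : Real.exp (3 * (2 * (τ * K) * N)) * e 0 ≤ Real.exp (3 * (2 * (τ * K) * N)) *
        (1 / 2 * a₀ + 1 / 2 * δ ^ 2 * c * τ * l₀) := by gcongr
    change a n ≤ _
    linarith
  · rw [← Finset.mul_sum]
    have h3 : e 0 * (1 + 2 * (2 * (τ * K) * N) * Real.exp (3 * (2 * (τ * K) * N))) ≤
        (1 / 2 * a₀ + 1 / 2 * δ ^ 2 * c * τ * l₀) *
          (1 + 2 * (2 * (τ * K) * N) * Real.exp (3 * (2 * (τ * K) * N))) := by gcongr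
    have h4 := hg2.trans h3
    have h5 := mul_le_mul_of_nonneg_left h4 (by positivity : 0 ≤ 2 * ε⁻¹)
    refine le_trans (le_of_eq ?_) h5
    change τ * ∑ n ∈ Finset.Icc 1 N, b n = _
    field_simp

end Gronwall

end SCH

namespace SCH

/-! ### The scheme -/

section Scheme

theorem IsWiener.increment {Ω : Type*} [m : MeasurableSpace Ω] {P : Measure Ω}
    {ℱ : Filtration ℝ≥0 m} {W : ℝ≥0 → Ω → ℝ} (hW : IsWiener P ℱ W) {s t : ℝ≥0} (hst : s ≤ t) :
    MemLp (fun ω => W t ω - W s ω) 2 P ∧ ∫ ω, (W t ω - W s ω) ∂P = 0 ∧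
      ∫ ω, (W t ω - W s ω) ^ 2 ∂P = (t : ℝ) - s := by
  have hlaw : HasLaw (fun ω => W t ω - W s ω) (gaussianReal 0 (nndist t.1 s.1)) P :=
    hW.brownian.hasLaw_sub t s
  have h0 : ∫ ω, (W t ω - W s ω) ∂P = 0 := by
    rw [hlaw.integral_eq, integral_id_gaussianReal]
  refine ⟨?_, h0, ?_⟩
  · have h1 : MemLp id 2 (P.map fun ω => W t ω - W s ω) := by
      rw [hlaw.map_eq]
      exact memLp_id_gaussianReal 2
    exact (memLp_map_measure_iff aestronglyMeasurable_id hlaw.aemeasurable).1 h1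
  · rw [← variance_of_integral_eq_zero hlaw.aemeasurable h0, hlaw.variance_eq,
      variance_id_gaussianReal, coe_nndist, Real.dist_eq]
    exact abs_of_nonneg (sub_nonneg.2 (by exact_mod_cast hst))

variable {d : ℕ} {D : Set (E d)} {S : Geometry.SimplicialComplex ℝ (E d)} {X : E d → E d}

namespace IsPolyhedral

theorem subConst_eq (h : IsPolyhedral D S) (v : femSpace D S) (c : ℝ) :
    subConst D v c = (v - c • h.one : femSpace D S) := by
  ext x
  by_cases hx : x ∈ closure D <;> simp [subConst, one, unitFun, hx]

theorem inner_val_one (h : IsPolyhedral D S) (v : femSpace D S) :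
    inner ℝ (h.val v) (h.val h.one) = ∫ x in D, (v : E d → ℝ) x := by
  rw [← h.ip_eq, h.ip_one]

theorem norm_val_one_sq (h : IsPolyhedral D S) : ‖h.val h.one‖ ^ 2 = volume.real D := by
  rw [← real_inner_self_eq_norm_sq, inner_val_one]
  have : ∫ x in D, (h.one : E d → ℝ) x = ∫ _ in D, (1 : ℝ) :=
    setIntegral_congr_fun h.isOpen.measurableSet fun x hx => by
      simp [one, unitFun, subset_closure hx]
  rw [this]
  simp

theorem grad_sub_smul_one (h : IsPolyhedral D S) (v : femSpace D S) (c : ℝ) :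
    h.grad (v - c • h.one) = h.grad v := by
  rw [map_sub, map_smul, h.grad_one, smul_zero, sub_zero]

theorem gradX_sub_smul_one (h : IsPolyhedral D S) (hX : Continuous X) (v : femSpace D S) (c : ℝ) :
    h.gradX hX (v - c • h.one) = h.gradX hX v := by
  rw [map_sub, map_smul, h.gradX_one, smul_zero, sub_zero]

/-- `discInvLap` is merely a chosen solution, but two solutions of the discrete Poisson problem have
the same gradient, and the norm depends only on that. -/
theorem negNorm_sq (h : IsPolyhedral D S) {T : femSpace D S →ₗ[ℝ] femSpace D S}
    (hT : IsInverse h.val h.grad h.one T) {ζ : femSpace D S}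
    (hζ : inner ℝ (h.val ζ) (h.val h.one) = 0) :
    negNorm D S ζ ^ 2 = ‖h.grad (T ζ)‖ ^ 2 := by
  have hex : ∃ z, IsDiscInvLap D S ζ z := by
    refine ⟨(-(T ζ) : femSpace D S), ⟨(-(T ζ) : femSpace D S).2, ?_⟩, fun v hv => ?_⟩
    · rw [← h.inner_val_one, map_neg, inner_neg_left, (hT ζ hζ).1, neg_zero]
    · have e : -((-(T ζ) : femSpace D S) : E d → ℝ) = (T ζ : femSpace D S) := by simp
      rw [e]
      have := (hT ζ hζ).2 ⟨v, hv⟩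
      rwa [← h.gradIp_eq, ← h.ip_eq] at this
  have hz : IsDiscInvLap D S ζ (discInvLap D S ζ) := by
    rw [discInvLap, dif_pos hex]
    exact hex.choose_spec
  obtain ⟨⟨hzV, -⟩, hzeq⟩ := hz
  let z : femSpace D S := ⟨discInvLap D S ζ, hzV⟩
  have hz' : ∀ v, inner ℝ (h.grad (-z)) (h.grad v) = inner ℝ (h.val ζ) (h.val v) := fun v => by
    rw [← h.gradIp_eq, ← h.ip_eq]
    exact hzeq v v.2
  have hg : h.grad (-z) = h.grad (T ζ) := by
    rw [← sub_eq_zero, ← map_sub, ← inner_self_eq_zero (𝕜 := ℝ)]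
    conv_lhs => rw [map_sub, inner_sub_left]
    rw [← map_sub, hz', (hT ζ hζ).2, sub_self]
  have hneg : negIp D S ζ ζ = ‖h.grad (T ζ)‖ ^ 2 := by
    rw [← hg, ← real_inner_self_eq_norm_sq, ← h.gradIp_eq]
    rfl
  rw [negNorm, hneg, Real.sq_sqrt (sq_nonneg _)]

/-- With `f(y) = y³ - y`, monotonicity of the cube gives `(f(y) - f(c))(y - c) ≥ -(y - c)²`, and the
constant `f(c)` is invisible to a function of mean zero. -/
theorem neg_norm_sq_le_ip_fNl (h : IsPolyhedral D S) (v : femSpace D S) {c : ℝ}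
    (hc : inner ℝ (h.val (v - c • h.one)) (h.val h.one) = 0) :
    - ‖h.val (v - c • h.one)‖ ^ 2 ≤ ip D (fNl v) (v - c • h.one : femSpace D S) := by
  have := h.isFiniteMeasure
  set ζ : femSpace D S := v - c • h.one with hζ
  rw [h.inner_val_one] at hc
  obtain ⟨M, hM⟩ := h.tri.exists_bound h.isBounded v.2
  obtain ⟨M', hM'⟩ := h.tri.exists_bound h.isBounded ζ.2
  have hvm := h.tri.measurable v.2
  have hζm := h.tri.measurable ζ.2
  have hi1 : Integrable (ζ : E d → ℝ) (volume.restrict D) :=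
    (memLp_coe ζ).integrable (by norm_num)
  have hi2 : Integrable (fun x => (ζ : E d → ℝ) x ^ 2) (volume.restrict D) :=
    (memLp_coe ζ).integrable_sq
  have hi3 : Integrable (fun x => fNl (v : E d → ℝ) x * (ζ : E d → ℝ) x) (volume.restrict D) := by
    refine hi1.bdd_mul (c := M ^ 3 + M) ((hvm.pow_const 3).sub hvm).aestronglyMeasurable
      (ae_of_all _ fun x => ?_)
    refine (norm_sub_le _ _).trans (add_le_add ?_ (hM x))
    rw [norm_pow]
    exact pow_le_pow_left₀ (norm_nonneg _) (hM x) 3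
  have hi2' : Integrable (fun x => -(ζ : E d → ℝ) x ^ 2) (volume.restrict D) := hi2.neg
  have hi4 : Integrable (fun x => -(ζ : E d → ℝ) x ^ 2 + (c ^ 3 - c) * (ζ : E d → ℝ) x)
      (volume.restrict D) := hi2'.add (hi1.const_mul _)
  have hle : ∫ x in D, (-(ζ : E d → ℝ) x ^ 2 + (c ^ 3 - c) * (ζ : E d → ℝ) x) ≤
      ∫ x in D, fNl (v : E d → ℝ) x * (ζ : E d → ℝ) x := by
    refine setIntegral_mono_on hi4 hi3 h.isOpen.measurableSet fun x hx => ?_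
    have e : (ζ : E d → ℝ) x = (v : E d → ℝ) x - c := by
      simp [hζ, one, unitFun, subset_closure hx]
    rw [e, fNl]
    set y := (v : E d → ℝ) x
    -- This is twice `(y³ - c³)(y - c)`.
    have : 0 ≤ (y - c) ^ 2 * ((y + c) ^ 2 + y ^ 2 + c ^ 2) := by positivity
    nlinarith
  rw [integral_add hi2' (hi1.const_mul _), integral_neg, integral_const_mul, hc, mul_zero,
    add_zero] at hle
  have e2 : ‖h.val ζ‖ ^ 2 = ∫ x in D, (ζ : E d → ℝ) x ^ 2 := by
    rw [← real_inner_self_eq_norm_sq, ← h.ip_eq, ip]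
    simp only [sq]
  rw [e2]
  exact hle

/-- The energy estimate for one time step of the scheme. -/
theorem scheme_energy_step (h : IsPolyhedral D S) (hX : Continuous X)
    (hibp : ∀ v w, inner ℝ (h.gradX hX v) (h.val w) = - inner ℝ (h.val v) (h.gradX hX w))
    {C : ℝ} (hC : ∀ v, ‖h.gradX hX v‖ ≤ C * ‖h.grad v‖)
    {T : femSpace D S →ₗ[ℝ] femSpace D S} (hT : IsInverse h.val h.grad h.one T)
    {U U' w : femSpace D S} {c τ δ ε ξ : ℝ}
    (hU : inner ℝ (h.val (U - c • h.one)) (h.val h.one) = 0)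
    (hU' : inner ℝ (h.val (U' - c • h.one)) (h.val h.one) = 0) (hτ : 0 ≤ τ) (hε : 0 < ε)
    (hstep : ∀ η ∈ Vh D S, ip D U η = ip D U' η - τ * gradIp D w η
      - τ * (δ ^ 2 / 2) * ip D (gradDot X U) (gradDot X η)
      + δ * ip D (fun x => gradDot X U' x * ξ) η)
    (hw : ∀ v ∈ Vh D S, ip D w v = ε * gradIp D U v + ε⁻¹ * ip D (fNl U) v) :
    1 / 2 * ‖h.grad (T (U - c • h.one))‖ ^ 2 + 5 / 8 * τ * ε * ‖h.grad (U - c • h.one)‖ ^ 2 ≤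
      1 / 2 * ‖h.grad (T (U' - c • h.one))‖ ^ 2 +
        τ * (ε⁻¹ ^ 3 + C ^ 4 * δ ^ 4 * ε⁻¹ / 2) * ‖h.grad (T (U - c • h.one))‖ ^ 2 +
        δ * (ξ * inner ℝ (h.gradX hX (U' - c • h.one)) (h.val (T (U' - c • h.one)))) +
        1 / 2 * δ ^ 2 * C ^ 2 * (ξ ^ 2 * ‖h.val (U' - c • h.one)‖ ^ 2) := by
  refine hT.energy_step (w := w) (F := ip D (fNl U) (U - c • h.one : femSpace D S)) hibp hC hU hU'
    hτ hε (fun η => ?_) ?_ (h.neg_norm_sq_le_ip_fNl U hU)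
  · have h1 := hstep η η.2
    rw [ip_mul_const, h.ip_eq, h.ip_eq, h.gradIp_eq, h.ip_gradDot_gradDot_eq hX,
      h.ip_gradDot_eq hX] at h1
    rw [gradX_sub_smul_one, gradX_sub_smul_one, map_sub, map_sub, inner_sub_left, inner_sub_left,
      h1]
    ring
  · have h1 := hw _ (U - c • h.one : femSpace D S).2
    rw [h.ip_eq, h.gradIp_eq] at h1
    rw [h1, grad_sub_smul_one, real_inner_self_eq_norm_sq]

/-- The scheme conserves the mean. -/
theorem scheme_mean_step (h : IsPolyhedral D S) (hX : Continuous X)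
    (hibp : ∀ v w, inner ℝ (h.gradX hX v) (h.val w) = - inner ℝ (h.val v) (h.gradX hX w))
    {U U' w : femSpace D S} {τ δ ξ : ℝ}
    (hstep : ∀ η ∈ Vh D S, ip D U η = ip D U' η - τ * gradIp D w η
      - τ * (δ ^ 2 / 2) * ip D (gradDot X U) (gradDot X η)
      + δ * ip D (fun x => gradDot X U' x * ξ) η) :
    inner ℝ (h.val U) (h.val h.one) = inner ℝ (h.val U') (h.val h.one) := by
  have h1 := hstep h.one h.one.2
  rw [ip_mul_const, h.ip_eq, h.ip_eq, h.gradIp_eq, h.ip_gradDot_gradDot_eq hX,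
    h.ip_gradDot_eq hX, hibp, h.grad_one, h.gradX_one] at h1
  simpa using h1

theorem inner_val_sub_smul_one (h : IsPolyhedral D S) (hD : volume.real D ≠ 0) {U : femSpace D S}
    {f : E d → ℝ} (hU : inner ℝ (h.val U) (h.val h.one) = ∫ x in D, f x) :
    inner ℝ (h.val (U - mean D f • h.one)) (h.val h.one) = 0 := by
  rw [map_sub, map_smul, inner_sub_left, inner_smul_left, real_inner_self_eq_norm_sq,
    norm_val_one_sq, hU, mean]
  simp only [conj_trivial]
  field_simp
  ring

/-- The initial value is the `L²` projection of the datum, and removing the mean is a further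
orthogonal projection: `‖ζ‖² = (f, ζ)`. -/
theorem norm_projection_le (h : IsPolyhedral D S) {f : E d → ℝ}
    (hf : MemLp f 2 (volume.restrict D)) {U : femSpace D S} {c : ℝ}
    (hU : ∀ v ∈ Vh D S, ip D U v = ip D f v)
    (hc : inner ℝ (h.val (U - c • h.one)) (h.val h.one) = 0) :
    ‖h.val (U - c • h.one)‖ ^ 2 ≤ ‖hf.toLp f‖ ^ 2 := by
  set ζ := U - c • h.one with hζ
  have h1 : ‖h.val ζ‖ ^ 2 = inner ℝ (hf.toLp f) (h.val ζ) := by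
    have h2 := hU ζ ζ.2
    rw [h.ip_eq, ← inner_toLp_real hf (memLp_coe ζ)] at h2
    have e : h.val ζ = h.val U - c • h.val h.one := by rw [hζ, map_sub, map_smul]
    calc ‖h.val ζ‖ ^ 2 = inner ℝ (h.val U - c • h.val h.one) (h.val ζ) := by
          rw [← e, real_inner_self_eq_norm_sq]
      _ = inner ℝ (h.val U) (h.val ζ) := by
          rw [inner_sub_left, inner_smul_left, real_inner_comm (h.val ζ) (h.val h.one), hc,
            mul_zero, sub_zero]
      _ = _ := h2
  have h3 := real_inner_le_norm (hf.toLp f) (h.val ζ)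
  rw [← h1] at h3
  nlinarith [norm_nonneg (h.val ζ), norm_nonneg (hf.toLp f), sq_nonneg (‖hf.toLp f‖ - ‖h.val ζ‖)]

end IsPolyhedral

end Scheme

end SCH

namespace SCH

/-! ### Stability on a fixed triangulation -/

section Estimate

variable {d : ℕ} {D : Set (E d)} {S : Geometry.SimplicialComplex ℝ (E d)} {X : E d → E d}

/-- The stability estimate on a fixed triangulation, with explicit constants: `C` bounds the vector
field and `CP` is the Poincaré constant. -/
theorem IsPolyhedral.stability (h : IsPolyhedral D S) (hX : Continuous X)
    (hibp : ∀ v w, inner ℝ (h.gradX hX v) (h.val w) = - inner ℝ (h.val v) (h.gradX hX w))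
    {C CP : ℝ} (hC : ∀ v, ‖h.gradX hX v‖ ≤ C * ‖h.grad v‖) (hCP : 0 ≤ CP)
    (hP : ∀ v, inner ℝ (h.val v) (h.val h.one) = 0 → ‖h.val v‖ ^ 2 ≤ CP * ‖h.grad v‖ ^ 2)
    (hD : 0 < volume.real D) {u0 : E d → ℝ} (hu0 : MemLp u0 2 (volume.restrict D))
    {δ ε K : ℝ} (hε : 0 < ε) (hK : K = (1 + C ^ 4) * (ε⁻¹ ^ 3 + ε⁻¹ * δ ^ 4))
    {N : ℕ} {τ : ℝ≥0} (hτ : 0 < τ) (hτK : τ * K ≤ 1 / 8)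
    {Ω : Type*} [m : MeasurableSpace Ω] {P : Measure Ω} [IsProbabilityMeasure P]
    {ℱ : Filtration ℝ≥0 m} {W : ℝ≥0 → Ω → ℝ} (hW : IsWiener P ℱ W) {u w : ℕ → Ω → E d → ℝ}
    (hsol : IsDiscreteSolution D X u0 δ ε S N τ P ℱ W u w) :
    (∀ n ≤ N, ∀ᵐ ω ∂P, subConst D (u n ω) (mean D u0) ∈ Vh0 D S) ∧
    (∀ n ≤ N, Integrable (fun ω => negNorm D S (subConst D (u n ω) (mean D u0)) ^ 2) P) ∧
    Integrable (fun ω => ∑ n ∈ Finset.Icc 1 N, (τ : ℝ) * gradNormSq D (u n ω)) P ∧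
    (∀ n ≤ N, ∫ ω, negNorm D S (subConst D (u n ω) (mean D u0)) ^ 2 ∂P ≤
      2 * (Real.exp (3 * (2 * (τ * K) * N)) * (1 / 2 * (CP * ‖hu0.toLp u0‖ ^ 2) +
        1 / 2 * δ ^ 2 * C ^ 2 * τ * ‖hu0.toLp u0‖ ^ 2))) ∧
    ∫ ω, (∑ n ∈ Finset.Icc 1 N, (τ : ℝ) * gradNormSq D (u n ω)) ∂P ≤
      2 * ε⁻¹ * ((1 / 2 * (CP * ‖hu0.toLp u0‖ ^ 2) +
        1 / 2 * δ ^ 2 * C ^ 2 * τ * ‖hu0.toLp u0‖ ^ 2) *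
          (1 + 2 * (2 * (τ * K) * N) * Real.exp (3 * (2 * (τ * K) * N)))) := by
  classical
  have := h.finiteDimensional
  have hone0 : h.one ≠ 0 := by
    intro h0
    have := h.norm_val_one_sq
    rw [h0, map_zero, norm_zero, zero_pow two_ne_zero] at this
    exact hD.ne this
  obtain ⟨T, hT⟩ := exists_isInverse h.val_injective h.grad_one hone0 hP
  -- The default value is never taken for `n ≤ N`; it only makes the lift total in `n`.
  let lift : (E d → ℝ) → femSpace D S := fun v => if hv : v ∈ Vh D S then ⟨v, hv⟩ else 0
  have hlift : ∀ v ∈ Vh D S, ((lift v : femSpace D S) : E d → ℝ) = v := fun v hv => by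
    simp only [lift, dif_pos hv]
  set c := mean D u0 with hc
  let ζ : ℕ → Ω → femSpace D S := fun n ω => lift (u n ω) - c • h.one
  have hul : ∀ n ≤ N, ∀ ω, ((lift (u n ω) : femSpace D S) : E d → ℝ) = u n ω := fun n hn ω =>
    hlift _ (hsol.mem_u n hn ω)
  have hwl : ∀ n ≤ N, ∀ ω, ((lift (w n ω) : femSpace D S) : E d → ℝ) = w n ω := fun n hn ω =>
    hlift _ (hsol.mem_w n hn ω)
  have hsub : ∀ n ≤ N, ∀ ω, subConst D (u n ω) c = (ζ n ω : E d → ℝ) := fun n hn ω => by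
    rw [← h.subConst_eq, hul n hn ω]
  have hgrad : ∀ n ≤ N, ∀ ω, gradNormSq D (u n ω) = ‖h.grad (ζ n ω)‖ ^ 2 := fun n hn ω => by
    rw [h.grad_sub_smul_one, ← h.gradNormSq_eq, hul n hn ω]
  let ξ : ℕ → Ω → ℝ := fun n ω => W ((n + 1 : ℕ) * τ) ω - W (n * τ) ω
  have hle : ∀ n : ℕ, (n * τ : ℝ≥0) ≤ (n + 1 : ℕ) * τ := fun n => by
    gcongr
    exact n.le_succ
  have hstepU : ∀ᵐ ω ∂P, ∀ n < N, ∀ η ∈ Vh D S,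
      ip D (lift (u (n + 1) ω) : femSpace D S) η = ip D (lift (u n ω) : femSpace D S) η
        - τ * gradIp D (lift (w (n + 1) ω) : femSpace D S) η
        - τ * (δ ^ 2 / 2) * ip D (gradDot X (lift (u (n + 1) ω) : femSpace D S)) (gradDot X η)
        + δ * ip D (fun x => gradDot X (lift (u n ω) : femSpace D S) x * ξ n ω) η := by
    filter_upwards [hsol.step_u] with ω hω n hn
    rw [hul _ hn, hul _ hn.le, hwl _ hn]
    exact hω n hn
  have hmean : ∀ᵐ ω ∂P, ∀ n ≤ N, inner ℝ (h.val (ζ n ω)) (h.val h.one) = 0 := by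
    filter_upwards [hsol.init_u, hstepU] with ω h0 hs
    have key : ∀ n ≤ N, inner ℝ (h.val (lift (u n ω))) (h.val h.one) = ∫ x in D, u0 x := by
      intro n
      induction n with
      | zero =>
        intro hn
        rw [← h.ip_eq, hul 0 hn, h0 _ h.one.2, h.ip_one]
      | succ n ih =>
        intro hn
        rw [h.scheme_mean_step hX hibp (hs n hn)]
        exact ih (by omega)
    exact fun n hn => h.inner_val_sub_smul_one hD.ne' (key n hn)
  have hneg : ∀ n ≤ N, ∀ᵐ ω ∂P, negNorm D S (subConst D (u n ω) c) ^ 2 =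
      ‖h.grad (T (ζ n ω))‖ ^ 2 := by
    intro n hn
    filter_upwards [hmean] with ω hω
    rw [hsub n hn, h.negNorm_sq hT (hω n hn)]
  have hζm : ∀ n ≤ N, ∀ x, Measurable[ℱ (n * τ)] fun ω => (ζ n ω : E d → ℝ) x := by
    intro n hn x
    have e : (fun ω => (ζ n ω : E d → ℝ) x) =
        fun ω => u n ω x - (closure D).indicator (fun _ => c) x := by
      ext ω
      rw [← hsub n hn]
      rfl
    rw [e]
    exact (hsol.adapted_u n hn x).sub measurable_const
  have hbil : ∀ n ≤ N, ∀ φ : femSpace D S →ₗ[ℝ] femSpace D S →ₗ[ℝ] ℝ,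
      Measurable[ℱ (n * τ)] fun ω => φ (ζ n ω) (ζ n ω) := fun n hn φ =>
    h.measurable_bilinear (hζm n hn) φ
  have hs0 : 0 < ε⁻¹ := by positivity
  have hK1 : ε⁻¹ ^ 3 + C ^ 4 * δ ^ 4 * ε⁻¹ / 2 ≤ K := by
    rw [hK]
    have h1 : 0 ≤ C ^ 4 * ε⁻¹ ^ 3 := by positivity
    have h2 : 0 ≤ ε⁻¹ * δ ^ 4 := by positivity
    have h3 : 0 ≤ C ^ 4 * δ ^ 4 * ε⁻¹ := by positivity
    nlinarith
  have hK2 : C ^ 4 * δ ^ 4 * ε⁻¹ / 2 ≤ K := by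
    have : 0 ≤ ε⁻¹ ^ 3 := by positivity
    linarith
  have hK0 : 0 ≤ K := by
    rw [hK]
    positivity
  have hprod : ∀ n ≤ N, ∀ᵐ ω ∂P,
      ‖h.val (ζ n ω)‖ ^ 2 ≤ ‖h.grad (T (ζ n ω))‖ * ‖h.grad (ζ n ω)‖ := by
    intro n hn
    filter_upwards [hmean] with ω hω using hT.norm_val_sq_le (hω n hn)
  -- Here `A`, `B` and `L` are the squared `H⁻¹`, gradient and `L²` norms of `ζⁿ`, and `M` is the
  -- integrand of the martingale term. The bound on `A 0` combines the dual Poincaré inequality with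
  -- the contraction property of the projection.
  obtain ⟨hAi, hBi, hAe, hBe⟩ := energy_estimate (P := P) (𝒢 := fun n => ℱ (n * τ))
    (fun n => ℱ.le _) (ξ := ξ) (N := N) (τ := τ) (δ := δ) (ε := ε) (c := C ^ 2) (K := K)
    (a₀ := CP * ‖hu0.toLp u0‖ ^ 2) (l₀ := ‖hu0.toLp u0‖ ^ 2)
    (A := fun n ω => ‖h.grad (T (ζ n ω))‖ ^ 2) (B := fun n ω => ‖h.grad (ζ n ω)‖ ^ 2)
    (L := fun n ω => ‖h.val (ζ n ω)‖ ^ 2)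
    (M := fun n ω => inner ℝ (h.gradX hX (ζ n ω)) (h.val (T (ζ n ω))))
    (by exact_mod_cast hτ) hε (sq_nonneg C) hK0 hτK
    (fun n => (hW.increment (hle n)).1) (fun n => (hW.increment (hle n)).2.1)
    (fun n => by
      rw [(hW.increment (hle n)).2.2]
      push_cast
      ring)
    (fun n => hW.indep _ _ (hle n))
    (fun n hn => by
      have := hbil n hn ((innerₗ _).compl₁₂ (h.grad.comp T) (h.grad.comp T))
      simpa using this)
    (fun n hn => by
      have := hbil n hn ((innerₗ _).compl₁₂ h.grad h.grad)
      simpa using this)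
    (fun n hn => by
      have := hbil n hn ((innerₗ _).compl₁₂ h.val h.val)
      simpa using this)
    (fun n hn => by
      have := hbil n hn ((innerₗ _).compl₁₂ (h.gradX hX) (h.val.comp T))
      simpa using this)
    (fun _ _ => sq_nonneg _) (fun _ _ => sq_nonneg _) (fun _ _ => sq_nonneg _)
    (fun n hn => by
      filter_upwards [hprod n hn] with ω hω
      nlinarith [sq_nonneg (‖h.grad (T (ζ n ω))‖ - ‖h.grad (ζ n ω)‖),
        sq_nonneg ‖h.grad (T (ζ n ω))‖, sq_nonneg ‖h.grad (ζ n ω)‖])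
    (fun n hn => ae_of_all _ fun ω => by
      refine (abs_inner_gradX_val_le hibp hC _ _).trans ?_
      nlinarith [sq_nonneg (C * ‖h.val (ζ n ω)‖ - ‖h.grad (T (ζ n ω))‖),
        sq_nonneg (C * ‖h.val (ζ n ω)‖), sq_nonneg ‖h.grad (T (ζ n ω))‖])
    (fun n hn => by
      filter_upwards [hprod n hn] with ω hω
      refine (young_half_sq (A := ‖h.grad (T (ζ n ω))‖ ^ 2) (B := ‖h.grad (ζ n ω)‖ ^ 2) hε
        (sq_nonneg _) (sq_nonneg _) ?_).trans ?_
      · rw [← mul_pow]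
        exact pow_le_pow_left₀ (sq_nonneg _) hω 2
      · gcongr
        rw [← pow_mul]
        exact hK2)
    (by
      filter_upwards [hmean, hsol.init_u] with ω hω h0
      refine (hT.norm_grad_sq_le hCP hP (hω 0 (Nat.zero_le _))).trans ?_
      gcongr ?_ * ?_
      refine h.norm_projection_le hu0 (fun v hv => ?_) (hω 0 (Nat.zero_le _))
      rw [hul 0 (Nat.zero_le _)]
      exact h0 v hv)
    (by
      filter_upwards [hmean, hsol.init_u] with ω hω h0
      refine h.norm_projection_le hu0 (fun v hv => ?_) (hω 0 (Nat.zero_le _))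
      rw [hul 0 (Nat.zero_le _)]
      exact h0 v hv)
    (fun n hn => by
      filter_upwards [hmean, hstepU, hsol.step_w] with ω hω h1 h2
      have h3 := h.scheme_energy_step hX hibp hC hT (hω (n + 1) hn) (hω n hn.le) τ.coe_nonneg hε
        (h1 n hn) (fun v hv => by
          rw [hul _ hn, hwl _ hn]
          exact h2 n hn v hv)
      refine h3.trans ?_
      gcongr)
  refine ⟨fun n hn => ?_, fun n hn => ?_, ?_, fun n hn => ?_, ?_⟩
  · filter_upwards [hmean] with ω hω
    rw [hsub n hn]
    refine ⟨(ζ n ω).2, ?_⟩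
    rw [← h.inner_val_one]
    exact hω n hn
  · exact (hAi n hn).congr ((hneg n hn).mono fun ω hω => hω.symm)
  · refine integrable_finsetSum _ fun n hn => Integrable.const_mul ?_ _
    refine (hBi n hn).congr (ae_of_all _ fun ω => ?_)
    exact (hgrad n (Finset.mem_Icc.1 hn).2 ω).symm
  · rw [integral_congr_ae (hneg n hn)]
    exact hAe n hn
  · have e : ∀ ω, ∑ n ∈ Finset.Icc 1 N, (τ : ℝ) * gradNormSq D (u n ω) =
        ∑ n ∈ Finset.Icc 1 N, (τ : ℝ) * ‖h.grad (ζ n ω)‖ ^ 2 := fun ω =>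
      Finset.sum_congr rfl fun n hn => by rw [hgrad n (Finset.mem_Icc.1 hn).2 ω]
    simp_rw [e]
    rw [integral_finsetSum _ fun n hn => (hBi n hn).const_mul _]
    simp_rw [integral_const_mul]
    exact hBe

end Estimate

end SCH

/-! ### Constants independent of the discretization -/

theorem mainTheorem5
    (d : ℕ) (hd : d = 2 ∨ d = 3)
    (D : Set (SCH.E d)) (hDo : IsOpen D) (hDc : IsConnected D)
    (hDb : Bornology.IsBounded D) (hDr : interior (closure D) = D)
    (X : SCH.E d → SCH.E d) (hX : ContDiff ℝ (⊤ : ℕ∞) X)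
    (hXdiv : ∀ x ∈ D, SCH.divergence X x = 0) (hXn : SCH.IsTangential D X)
    (T : ℝ≥0) (hT : 0 < T)
    (u0 : SCH.E d → ℝ) (hu0 : MemLp u0 2 (volume.restrict D))
    (κ : ℝ) (hκ : 0 < κ) :
    ∃ C₀ : ℝ, 0 < C₀ ∧ ∃ C : ℝ → ℝ → ℝ,
      ∀ δ ε : ℝ, 0 < δ → 0 < ε →
      ∀ S : Geometry.SimplicialComplex ℝ (SCH.E d),
        SCH.IsTriangulation D S → SCH.IsQuasiUniform κ S →
      ∀ (N : ℕ) (τ : ℝ≥0), 0 < N → τ = T / N →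
        (τ : ℝ) ≤ C₀ * ((ε⁻¹) ^ 3 + ε⁻¹ * δ ^ 4)⁻¹ →
      ∀ (Ω : Type*) [m : MeasurableSpace Ω] (P : Measure Ω) [IsProbabilityMeasure P]
        (ℱ : Filtration ℝ≥0 m) (W : ℝ≥0 → Ω → ℝ), SCH.IsWiener P ℱ W →
      ∀ u w : ℕ → Ω → SCH.E d → ℝ,
        SCH.IsDiscreteSolution D X u0 δ ε S N τ P ℱ W u w →
        (∀ n ≤ N, ∀ᵐ ω ∂P, SCH.subConst D (u n ω) (SCH.mean D u0) ∈ SCH.Vh0 D S) ∧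
        (∀ n ≤ N, Integrable
          (fun ω => SCH.negNorm D S (SCH.subConst D (u n ω) (SCH.mean D u0)) ^ 2) P) ∧
        Integrable (fun ω => ∑ n ∈ Finset.Icc 1 N, (τ : ℝ) * SCH.gradNormSq D (u n ω)) P ∧
        (⨆ n : Fin (N + 1),
            ∫ ω, SCH.negNorm D S (SCH.subConst D (u n ω) (SCH.mean D u0)) ^ 2 ∂P)
          + ∫ ω, (∑ n ∈ Finset.Icc 1 N, (τ : ℝ) * SCH.gradNormSq D (u n ω)) ∂P
          ≤ C δ ε⁻¹ := by
  have hX1 : ContDiff ℝ 1 X := hX.of_le (by exact_mod_cast le_top)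
  obtain ⟨M, hM⟩ := hDb.isCompact_closure.exists_bound_of_continuousOn hX.continuous.continuousOn
  obtain ⟨CP, hCP, hP⟩ := SCH.exists_poincare hDo hDc hDb hDr
  have hD : 0 < volume.real D :=
    ENNReal.toReal_pos (hDo.measure_pos volume hDc.nonempty).ne' hDb.measure_lt_top.ne
  set l₀ := ‖hu0.toLp u0‖ ^ 2 with hl₀
  have hl₀0 : 0 ≤ l₀ := sq_nonneg _
  let K : ℝ → ℝ → ℝ := fun δ s => (1 + M ^ 4) * (s ^ 3 + s * δ ^ 4)
  -- An upper bound for the initial energy, with `τ` replaced by `T`.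
  let e₀ : ℝ → ℝ := fun δ => 1 / 2 * (CP * l₀) + 1 / 2 * δ ^ 2 * M ^ 2 * T * l₀
  -- The constant `C₀` is chosen so that the mesh constraint becomes `τ K ≤ 1/8`. The number of
  -- steps enters the final bound only through `τ N = T`.
  refine ⟨1 / (8 * (1 + M ^ 4)), by positivity, fun δ s =>
    2 * (Real.exp (3 * (2 * (T * K δ s))) * e₀ δ) +
      2 * s * (e₀ δ * (1 + 2 * (2 * (T * K δ s)) * Real.exp (3 * (2 * (T * K δ s))))), ?_⟩
  intro δ ε hδ hε S hS _ N τ hN hτ hτC Ω m P _ ℱ W hW u w hsol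
  have h : SCH.IsPolyhedral D S := ⟨hS, hDo, hDb⟩
  have hs0 : 0 < ε⁻¹ := by positivity
  have hQ : 0 < ε⁻¹ ^ 3 + ε⁻¹ * δ ^ 4 := by positivity
  have hNr : (0 : ℝ) < N := by exact_mod_cast hN
  have hτ0 : 0 < τ := by
    rw [hτ]
    exact div_pos hT (by exact_mod_cast hN)
  have hτN : (τ : ℝ) * N = T := by
    rw [hτ, NNReal.coe_div, NNReal.coe_natCast]
    field_simp
  have hτT : (τ : ℝ) ≤ T := by
    rw [← hτN]
    have h1 : (1 : ℝ) ≤ N := by exact_mod_cast hN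
    nlinarith [τ.coe_nonneg]
  have hτK : (τ : ℝ) * K δ ε⁻¹ ≤ 1 / 8 := by
    rw [← div_eq_mul_inv, le_div_iff₀ hQ] at hτC
    calc (τ : ℝ) * K δ ε⁻¹ = (1 + M ^ 4) * (τ * (ε⁻¹ ^ 3 + ε⁻¹ * δ ^ 4)) := by ring
      _ ≤ (1 + M ^ 4) * (1 / (8 * (1 + M ^ 4))) := by gcongr
      _ = 1 / 8 := by field_simp
  have hK0 : 0 ≤ K δ ε⁻¹ := by positivity
  obtain ⟨h1, h2, h3, h4, h5⟩ := h.stability hX.continuous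
    (h.inner_gradX_val hd hDr hX1 hXdiv hXn) (h.norm_gradX_le hX.continuous hM) hCP
    (fun v hv => by
      rw [h.inner_val_one] at hv
      have := hP S hS v v.2 hv
      rw [h.gradNormSq_eq] at this
      rw [← real_inner_self_eq_norm_sq, ← h.ip_eq, SCH.ip]
      simpa only [sq] using this)
    hD hu0 hε rfl hτ0 hτK hW hsol
  have hτKN : 2 * ((τ : ℝ) * K δ ε⁻¹) * N = 2 * (T * K δ ε⁻¹) := by
    rw [← hτN]
    ring
  have he : 1 / 2 * (CP * l₀) + 1 / 2 * δ ^ 2 * M ^ 2 * τ * l₀ ≤ e₀ δ := by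
    simp only [e₀]
    gcongr
  refine ⟨h1, h2, h3, add_le_add (ciSup_le fun n => ?_) ?_⟩
  · refine (h4 n (Nat.lt_succ_iff.1 n.2)).trans ?_
    change 2 * (Real.exp (3 * (2 * ((τ : ℝ) * K δ ε⁻¹) * N)) * _) ≤ _
    rw [hτKN]
    gcongr
  · refine h5.trans ?_
    change 2 * ε⁻¹ * (_ * (1 + 2 * (2 * ((τ : ℝ) * K δ ε⁻¹) * N) *
      Real.exp (3 * (2 * ((τ : ℝ) * K δ ε⁻¹) * N)))) ≤ _
    rw [hτKN]
    gcongr
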